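/- Let $\lambda\in\mathbb C^*$ with $|\lambda|<1$ and put $\gamma=\frac1{2\pi\sqrt{-1}}$. Let $V=(\mathbb C^2\smallsetminus\{0\})/\langle(x,y)\sim(\lambda x,\lambda y)\rangle$ and $M=(\mathbb C^3\smallsetminus\{0\})/\langle(x,y,z)\sim(\lambda x,\lambda y,\lambda z)\rangle$, let $V=\{z=0\}\subset M$, let $C=\{y=0\}\subset V$, and set $U_0=\{y\neq0\}$, $U_1=\{x\neq 0\}\subset V$. Let $\rho:V\to\mathbb P^1$ be the elliptic fibration $[p]\mapsto\mathbb Cp$ and $L=\rho^*\mathcal O(1)$ the pull-back of the hyperplane bundle. Let $\mathcal F$ be the distribution on $M$ spanned by $v_1=y\partial_y+z\partial_z$ and $v_2=\partial_x$. Then: 1. $\mathcal F$ is well defined on $M$, is involutive and leaves $V$ invariant; its singular set (where $v_1,v_2$ are dependent) is $C$, which is the fiber of $\rho$ over $[1:0]$, and $V\smallsetminus C=U_0$. The normal bundle of $V$ in $M$ is $L$ (its frame $\partial_z$ on $\mathbb C^2\smallsetminus\{0\}$ corresponds to the frame $\nu_p:ap\mapsto a$ of $L$). 2. The Chern class $c^1(L)\in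 H^2_d(V)$ and the Atiyah class $a^1(L)\in H^{1,1}_{\bar\partial}(V)$ vanish. The Bott–Chern class $c^1_{\rm BC}(L)\in H^{1,1}_{\rm BC}(V)$ is represented by $\gamma\bar\partial\partial\log(|x|^2+|y|^2)$ and does not vanish. 3. There is exactly one connection $\nabla_0$ of type $(1,0)$ for $N_V=L$ on $U_0$ that extends the Camacho–Sad action, i.e. $\nabla_{0,u}\,\pi(\tilde v|_V)=\pi([\tilde u,\tilde v]|_V)$ for local sections $\tilde u$ of $\mathcal F$ and $\tilde v$ of $TM$ away from the singular set, where $u=\tilde u|_V$ and $\pi:TM|_V\to N_V$ is the projection. Its connection form in the frame $\nu$ is $-dy/y$; it is the metric connection of the metric $h_0$ with $h_0(\nu,\nu)=1/|y|^2$, and $c^1(\nabla_0)=0$. On $U_1$ the metric $h_1$ with $h_1(\nu,\nu)=1/|x|^2$ has the metric connection with form $-dx/x$. 4. Let $H^{1,1}_{\rm BC}(\{U_0,U_1\},U_0)$ be the relative Bott–Chern cohomology: pairs $(\sigma_1,\sigma_{01})$ of a closed $(1,1)$-form on $U_1$ and a function on $U_0\cap U_1$ with $\sigma_1=\bar\partial\partial\sigma_{01}$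 on $U_0\cap U_1$, modulo the pairs $(\bar\partial\partial\tau,\tau)$, $\tau\in C^\infty(U_1)$. The localization $c^1_{\rm BC}(L;\mathcal F)$ in this group, i.e. the class of $(c^1(\nabla_1),c^1_{\rm BC}(\nabla_0,\nabla_1))$, where $\nabla_1$ is the metric connection of a metric of $L$ on $U_1$, $\nabla_0$ is regarded as the connection of a metric on $U_0$ compatible with it, and $c^1_{\rm BC}(\nabla_0,\nabla_1)$ is the Bott–Chern difference form of the two metrics, does not depend on the choice of these metrics. It is represented by $(0,\gamma\log|x/y|^2)$, and its image under $j^*:(\sigma_1,\sigma_{01})\mapsto(0,\sigma_1,\sigma_{01})$ in the Bott–Chern cohomology of the covering $\{U_0,U_1\}$ of $V$ is $c^1_{\rm BC}(L)$. Thus $c^1_{\rm BC}(L)$ is localized at $C$. 5. Let $H^{1,1}_A[C]=\varinjlim_{W\supset C}H^{1,1}_A(W)$ be the direct limit of the Aeppli cohomology of the neighborhoods of $C$. The residue $R\in H^{1,1}_A[C]^*$, i.e. the image of $c^1_{\rm BC}(L;\mathcal F)$ under $H^{1,1}_{\rm BC}(\{U_0,U_1\},U_0)\to H^{1,1}_A[C]^*$,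 is well defined by $$R(\xi)=\int_{R_1}\sigma_1\wedge\xi+\int_{R_{01}}\Big(\partial\sigma_{01}\wedge\xi-\tfrac12\partial(\sigma_{01}\xi)-\bar\partial\sigma_{01}\wedge\xi+\tfrac12\bar\partial(\sigma_{01}\xi)\Big)$$ for every representative $(\sigma_1,\sigma_{01})$, every $\bar\partial\partial$-closed $(1,1)$-form $\xi$ on a neighborhood of $C$ and every $\delta>0$ such that $R_1=\{|y|\le\delta|x|\}\subset V$ is contained in that neighborhood, with $R_{01}=-\partial R_1$. 6. Let $\xi_0=\dfrac{\gamma}{2\log|\lambda|}\,d\log x\wedge d\log\bar x=\dfrac{\gamma}{\log|\lambda|^2}\,d\log x\wedge d\log\bar x$ on $U_1$. It is a $\bar\partial\partial$-closed $(1,1)$-form; its restriction to $C$ has $\int_C\xi_0=1$, and the class of this restriction is a basis of the one-dimensional space $H^{1,1}_A(C)$. Moreover $$R(\xi_0)=1.$$ -/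

import Mathlib

open Complex TopologicalSpace

set_option maxSynthPendingDepth 3

noncomputable section

namespace HopfBC

/-! ### Hopf manifolds -/

abbrev Vec (n : ℕ) : Type := Fin n → ℂ

/-- `p ∼ q ^ k • p`, `k : ℤ`, on `ℂⁿ ∖ {0}`. -/
def hopfSetoid (q : ℂˣ) (n : ℕ) : Setoid {p : Vec n // p ≠ 0} where
  r p p' := ∃ k : ℤ, ((q ^ k : ℂˣ) : ℂ) • p.1 = p'.1
  iseqv :=
    { refl := fun p => ⟨0, by simp⟩
      symm := by
        rintro p p' ⟨k, hk⟩
        refine ⟨-k, ?_⟩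
        rw [← hk, smul_smul, ← Units.val_mul, ← zpow_add]
        simp
      trans := by
        rintro p p' p'' ⟨k, hk⟩ ⟨l, hl⟩
        refine ⟨l + k, ?_⟩
        rw [← hl, ← hk, smul_smul, ← Units.val_mul, ← zpow_add] }

/-- The Hopf manifold `(ℂⁿ ∖ {0}) / (p ∼ q p)`: an elliptic curve for `n = 1`, a Hopf surface for
`n = 2`. -/
def Hopf (q : ℂˣ) (n : ℕ) : Type := Quotient (hopfSetoid q n)

instance (q : ℂˣ) (n : ℕ) : TopologicalSpace (Hopf q n) :=
  inferInstanceAs (TopologicalSpace (Quotient (hopfSetoid q n)))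

variable {q : ℂˣ} {n k : ℕ}

/-- The canonical surjection `p ↦ [p]`. -/
def Hopf.mk (q : ℂˣ) {n : ℕ} (p : Vec n) (hp : p ≠ 0) : Hopf q n :=
  Quotient.mk (hopfSetoid q n) ⟨p, hp⟩

/-- The inverse image in `ℂⁿ ∖ {0}` of an open set of the Hopf manifold. -/
def cover (U : Opens (Hopf q n)) : Set (Vec n) := {p | ∃ hp : p ≠ 0, Hopf.mk q p hp ∈ U}

theorem isOpen_cover (U : Opens (Hopf q n)) : IsOpen (cover U) := by
  have h1 : IsOpen {p : Vec n | p ≠ 0} := isOpen_ne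
  have h2 : IsOpen ((Quotient.mk (hopfSetoid q n)) ⁻¹' (U : Set (Hopf q n))) :=
    U.isOpen.preimage continuous_quotient_mk'
  have h3 := h1.isOpenMap_subtype_val _ h2
  convert h3 using 1
  ext p
  constructor
  · rintro ⟨hp, h⟩
    exact ⟨⟨p, hp⟩, h, rfl⟩
  · rintro ⟨⟨p', hp⟩, h, rfl⟩
    exact ⟨hp, h⟩

theorem cover_mono {U W : Opens (Hopf q n)} (h : W ≤ U) : cover W ⊆ cover U :=
  fun _ ⟨hp, hm⟩ => ⟨hp, h hm⟩

theorem mk_smul (p : Vec n) (hp : p ≠ 0) (hq : (q : ℂ) • p ≠ 0) :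
    Hopf.mk q ((q : ℂ) • p) hq = Hopf.mk q p hp := by
  refine Eq.symm (Quotient.sound ⟨1, ?_⟩)
  simp

theorem smul_mem_cover {U : Opens (Hopf q n)} {p : Vec n} (h : p ∈ cover U) :
    (q : ℂ) • p ∈ cover U := by
  obtain ⟨hp, hm⟩ := h
  have hq : (q : ℂ) • p ≠ 0 := smul_ne_zero q.ne_zero hp
  exact ⟨hq, by rwa [mk_smul p hp hq]⟩

/-! ### Differential forms on `ℂⁿ` -/

/-- Complex valued real-alternating `k`-forms on the tangent space `ℂⁿ`. -/
abbrev Alt (n k : ℕ) : Type := Vec n [⋀^Fin k]→L[ℝ] ℂ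

/-- Multiplication by the scalar `c`, as a real linear map. -/
def scal (n : ℕ) (c : ℂ) : Vec n →L[ℝ] Vec n := c • ContinuousLinearMap.id ℝ (Vec n)

@[simp] theorem scal_apply (c : ℂ) (v : Vec n) : scal n c v = c • v := rfl

section Parts

variable {F : Type*} [NormedAddCommGroup F] [NormedSpace ℂ F]

/-- The complex linear part `v ↦ (D v - i D (i v)) / 2` of a real linear map. -/
def linPart (D : Vec n →L[ℝ] F) : Vec n →L[ℝ] F :=
  (1 / 2 : ℂ) • (D - I • D.comp (scal n I))

/-- The complex antilinear part `v ↦ (D v + i D (i v)) / 2` of a real linear map. -/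
def antiPart (D : Vec n →L[ℝ] F) : Vec n →L[ℝ] F :=
  (1 / 2 : ℂ) • (D + I • D.comp (scal n I))

end Parts

/-- The operator `∂`: on a form `∑ f_J e^J` with constant `e^J` it is `∑ ∂f_J ∧ e^J`. -/
def del (ω : Vec n → Alt n k) (p : Vec n) : Alt n (k + 1) :=
  .alternatizeUncurryFin (linPart (fderiv ℝ ω p))

/-- The operator `∂̄`: on a form `∑ f_J e^J` with constant `e^J` it is `∑ ∂̄f_J ∧ e^J`. -/
def delbar (ω : Vec n → Alt n k) (p : Vec n) : Alt n (k + 1) :=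
  .alternatizeUncurryFin (antiPart (fderiv ℝ ω p))

theorem extDeriv_eq_del_add_delbar (ω : Vec n → Alt n k) (p : Vec n) :
    extDeriv ω p = del ω p + delbar ω p := by
  rw [del, delbar, ← ContinuousAlternatingMap.alternatizeUncurryFin_add, extDeriv]
  congr 1
  ext1 v
  simp only [linPart, antiPart, add_apply, smul_apply, sub_apply]
  module

/-- Functions as `0`-forms. -/
def fn (f : Vec n → ℂ) (p : Vec n) : Alt n 0 :=
  ContinuousAlternatingMap.constOfIsEmpty ℝ (Vec n) (Fin 0) (f p)

/-- The value of a `0`-form. -/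
def val (ω : Vec n → Alt n 0) (p : Vec n) : ℂ := ω p ![]

/-- A `1`-form at a point as a real linear map. -/
def toLin (α : Alt n 1) : Vec n →L[ℝ] ℂ :=
  (ContinuousAlternatingMap.ofSubsingleton ℝ (Vec n) ℂ (0 : Fin 1)).symm α

/-- A real linear map as a `1`-form at a point. -/
def ofLin (D : Vec n →L[ℝ] ℂ) : Alt n 1 :=
  ContinuousAlternatingMap.ofSubsingleton ℝ (Vec n) ℂ (0 : Fin 1) D

/-- The exterior product; see `wedge_apply` for the formula. -/
def wedge {n k l : ℕ} (α : Alt n k) (β : Alt n l) : Alt n (k + l) :=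
  ((k.factorial : ℂ) * (l.factorial : ℂ))⁻¹ •
    ContinuousMultilinearMap.alternatization
      ({ toMultilinearMap := ((LinearMap.mul' ℝ ℂ).compMultilinearMap
           (MultilinearMap.domCoprod α.toMultilinearMap β.toMultilinearMap)).domDomCongr
             finSumFinEquiv
         cont := by
           have ha : Continuous fun v : Fin (k + l) → Vec n => α fun i => v (Fin.castAdd l i) :=
             α.cont.comp (by fun_prop)
           have hb : Continuous fun v : Fin (k + l) → Vec n => β fun j => v (Fin.natAdd k j) :=
             β.cont.comp (by fun_prop)
           refine (ha.mul hb).congr fun v => ?_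
           simp } :
        ContinuousMultilinearMap ℝ (fun _ : Fin (k + l) => Vec n) ℂ)

/-- `(α ∧ β)(v) = (k! l!)⁻¹ ∑_σ sign σ α(v_σ(1), …, v_σ(k)) β(v_σ(k+1), …, v_σ(k+l))`. -/
theorem wedge_apply {n k l : ℕ} (α : Alt n k) (β : Alt n l) (v : Fin (k + l) → Vec n) :
    wedge α β v = ((k.factorial : ℂ) * (l.factorial : ℂ))⁻¹ *
      ∑ σ : Equiv.Perm (Fin (k + l)), (Equiv.Perm.sign σ : ℤ) *
        (α (fun i => v (σ (Fin.castAdd l i))) * β (fun j => v (σ (Fin.natAdd k j)))) := by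
  rw [wedge, ContinuousAlternatingMap.smul_apply,
    ContinuousMultilinearMap.alternatization_apply_apply, smul_eq_mul]
  congr 1
  refine Finset.sum_congr rfl fun σ hσ => ?_
  rw [Units.smul_def, zsmul_eq_mul]
  congr 1

/-! ### Differential forms on open sets of a Hopf manifold -/

theorem linPart_alternate_scal {D D' : Vec n →L[ℝ] Alt n k} {c : ℂ}
    (h : ∀ v w, D' v w = D (c • v) (fun i => c • w i)) (v : Fin (k + 1) → Vec n) :
    ContinuousAlternatingMap.alternatizeUncurryFin (linPart D') v =
      ContinuousAlternatingMap.alternatizeUncurryFin (linPart D) (fun i => c • v i) := by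
  simp only [ContinuousAlternatingMap.alternatizeUncurryFin_apply]
  refine Finset.sum_congr rfl fun i _ => ?_
  congr 1
  simp only [linPart, smul_apply, sub_apply, ContinuousLinearMap.comp_apply, scal_apply,
    ContinuousAlternatingMap.smul_apply, ContinuousAlternatingMap.sub_apply, h]
  rw [smul_comm I c]
  rfl

theorem antiPart_alternate_scal {D D' : Vec n →L[ℝ] Alt n k} {c : ℂ}
    (h : ∀ v w, D' v w = D (c • v) (fun i => c • w i)) (v : Fin (k + 1) → Vec n) :
    ContinuousAlternatingMap.alternatizeUncurryFin (antiPart D') v =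
      ContinuousAlternatingMap.alternatizeUncurryFin (antiPart D) (fun i => c • v i) := by
  simp only [ContinuousAlternatingMap.alternatizeUncurryFin_apply]
  refine Finset.sum_congr rfl fun i _ => ?_
  congr 1
  simp only [antiPart, smul_apply, add_apply, ContinuousLinearMap.comp_apply, scal_apply,
    ContinuousAlternatingMap.smul_apply, ContinuousAlternatingMap.add_apply, h]
  rw [smul_comm I c]
  rfl

/-- The space `𝓔ᵏ(U)` of smooth complex valued `k`-forms on an open set `U` of the Hopf manifold.
As `p ↦ [p]` is a holomorphic covering whose deck group is generated by `p ↦ q p`, such a form is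
the same as a smooth form on the inverse image of `U` invariant under `p ↦ q p`. Outside the inverse
image of `U` it is given the value `0`, so that equality of forms is equality on `U`. -/
def Form (U : Opens (Hopf q n)) (k : ℕ) : Submodule ℂ (Vec n → Alt n k) where
  carrier := {ω | ContDiffOn ℝ (⊤ : ℕ∞) ω (cover U) ∧
    (∀ p ∈ cover U, ∀ v, ω ((q : ℂ) • p) (fun i => (q : ℂ) • v i) = ω p v) ∧
    ∀ p ∉ cover U, ω p = 0}
  add_mem' := by
    rintro a b ⟨ha, ha', ha''⟩ ⟨hb, hb', hb''⟩
    refine ⟨ha.add hb, fun p hp v => ?_, fun p hp => ?_⟩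
    · simp [ha' p hp v, hb' p hp v]
    · simp [ha'' p hp, hb'' p hp]
  zero_mem' := ⟨contDiffOn_const, by simp, by simp⟩
  smul_mem' := by
    rintro c a ⟨ha, ha', ha''⟩
    refine ⟨ha.const_smul c, fun p hp v => ?_, fun p hp => ?_⟩
    · simp [ha' p hp v]
    · simp [ha'' p hp]

theorem Form.fderiv_scal {U : Opens (Hopf q n)} (ω : Form U k) {p : Vec n} (hp : p ∈ cover U)
    (v : Vec n) (w : Fin k → Vec n) :
    fderiv ℝ ω.1 p v w = fderiv ℝ ω.1 ((q : ℂ) • p) ((q : ℂ) • v) (fun i => (q : ℂ) • w i) := by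
  have hd : DifferentiableAt ℝ ω.1 ((q : ℂ) • p) :=
    (ω.2.1.contDiffAt ((isOpen_cover U).mem_nhds (smul_mem_cover hp))).differentiableAt (by simp)
  let S : Alt n k →L[ℝ] Alt n k :=
    ContinuousAlternatingMap.compContinuousLinearMapCLM (scal n (q : ℂ))
  have h1 : HasFDerivAt (fun x => S (ω.1 (scal n (q : ℂ) x)))
      (S.comp ((fderiv ℝ ω.1 ((q : ℂ) • p)).comp (scal n (q : ℂ)))) p :=
    S.hasFDerivAt.comp p (HasFDerivAt.comp p hd.hasFDerivAt (scal n (q : ℂ)).hasFDerivAt)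
  have h2 : ω.1 =ᶠ[nhds p] fun x => S (ω.1 (scal n (q : ℂ) x)) := by
    filter_upwards [(isOpen_cover U).mem_nhds hp] with x hx
    ext u
    exact (ω.2.2.1 x hx u).symm
  rw [(h1.congr_of_eventuallyEq h2).fderiv]
  rfl

theorem del_scal {U : Opens (Hopf q n)} (ω : Form U k) {p : Vec n} (hp : p ∈ cover U)
    (v : Fin (k + 1) → Vec n) :
    del ω.1 ((q : ℂ) • p) (fun i => (q : ℂ) • v i) = del ω.1 p v :=
  (linPart_alternate_scal (fun v w => Form.fderiv_scal ω hp v w) v).symm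

theorem delbar_scal {U : Opens (Hopf q n)} (ω : Form U k) {p : Vec n} (hp : p ∈ cover U)
    (v : Fin (k + 1) → Vec n) :
    delbar ω.1 ((q : ℂ) • p) (fun i => (q : ℂ) • v i) = delbar ω.1 p v :=
  (antiPart_alternate_scal (fun v w => Form.fderiv_scal ω hp v w) v).symm

theorem Form.contDiffOn_fderiv {U : Opens (Hopf q n)} (ω : Form U k) :
    ContDiffOn ℝ (⊤ : ℕ∞) (fderiv ℝ ω.1) (cover U) :=
  ω.2.1.fderiv_of_isOpen (isOpen_cover U) (by simp)

theorem contDiffOn_del {U : Opens (Hopf q n)} (ω : Form U k) :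
    ContDiffOn ℝ (⊤ : ℕ∞) (del ω.1) (cover U) := by
  have h := Form.contDiffOn_fderiv ω
  have h2 : ContDiffOn ℝ (⊤ : ℕ∞) (fun p => linPart (fderiv ℝ ω.1 p)) (cover U) :=
    (h.sub ((h.clm_comp contDiffOn_const).const_smul I)).const_smul (1 / 2 : ℂ)
  exact (ContinuousAlternatingMap.alternatizeUncurryFinCLM ℝ (Vec n) ℂ).contDiff.comp_contDiffOn h2

theorem contDiffOn_delbar {U : Opens (Hopf q n)} (ω : Form U k) :
    ContDiffOn ℝ (⊤ : ℕ∞) (delbar ω.1) (cover U) := by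
  have h := Form.contDiffOn_fderiv ω
  have h2 : ContDiffOn ℝ (⊤ : ℕ∞) (fun p => antiPart (fderiv ℝ ω.1 p)) (cover U) :=
    (h.add ((h.clm_comp contDiffOn_const).const_smul I)).const_smul (1 / 2 : ℂ)
  exact (ContinuousAlternatingMap.alternatizeUncurryFinCLM ℝ (Vec n) ℂ).contDiff.comp_contDiffOn h2

theorem Form.differentiableAt {U : Opens (Hopf q n)} (ω : Form U k) {p : Vec n}
    (hp : p ∈ cover U) : DifferentiableAt ℝ ω.1 p :=
  (ω.2.1.contDiffAt ((isOpen_cover U).mem_nhds hp)).differentiableAt (by simp)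

open Classical in
/-- `∂ : 𝓔ᵏ(U) → 𝓔ᵏ⁺¹(U)`. -/
def Form.del (U : Opens (Hopf q n)) (k : ℕ) : Form U k →ₗ[ℂ] Form U (k + 1) where
  toFun ω := ⟨(cover U).indicator (HopfBC.del ω.1),
    (contDiffOn_del ω).congr fun p hp => by simp [hp],
    fun p hp v => by
      simp only [Set.indicator_of_mem hp, Set.indicator_of_mem (smul_mem_cover hp)]
      exact del_scal ω hp v,
    fun p hp => by simp [hp]⟩
  map_add' a b := by
    ext1
    funext p
    by_cases hp : p ∈ cover U
    · simp only [Submodule.coe_add, Pi.add_apply, Set.indicator_of_mem hp, HopfBC.del]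
      rw [fderiv_add (Form.differentiableAt a hp) (Form.differentiableAt b hp),
        ← ContinuousAlternatingMap.alternatizeUncurryFin_add]
      congr 1
      ext1 v
      simp only [linPart, add_apply, smul_apply, sub_apply, ContinuousLinearMap.comp_apply]
      module
    · simp [hp]
  map_smul' c a := by
    ext1
    funext p
    by_cases hp : p ∈ cover U
    · simp only [Submodule.coe_smul, Pi.smul_apply, Set.indicator_of_mem hp, HopfBC.del,
        RingHom.id_apply]
      rw [fderiv_const_smul (Form.differentiableAt a hp)]
      ext v
      simp only [ContinuousAlternatingMap.alternatizeUncurryFin_apply,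
        ContinuousAlternatingMap.smul_apply, Finset.smul_sum]
      refine Finset.sum_congr rfl fun i hi => ?_
      rw [smul_comm c]
      congr 1
      simp only [linPart, smul_apply, sub_apply, ContinuousLinearMap.comp_apply,
        ContinuousAlternatingMap.smul_apply, ContinuousAlternatingMap.sub_apply, smul_eq_mul]
      ring
    · simp only [Submodule.coe_smul, Pi.smul_apply, Set.indicator_of_notMem hp, RingHom.id_apply]
      exact (smul_zero (A := Alt n (k + 1)) c).symm

open Classical in
/-- `∂̄ : 𝓔ᵏ(U) → 𝓔ᵏ⁺¹(U)`. -/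
def Form.delbar (U : Opens (Hopf q n)) (k : ℕ) : Form U k →ₗ[ℂ] Form U (k + 1) where
  toFun ω := ⟨(cover U).indicator (HopfBC.delbar ω.1),
    (contDiffOn_delbar ω).congr fun p hp => by simp [hp],
    fun p hp v => by
      simp only [Set.indicator_of_mem hp, Set.indicator_of_mem (smul_mem_cover hp)]
      exact delbar_scal ω hp v,
    fun p hp => by simp [hp]⟩
  map_add' a b := by
    ext1
    funext p
    by_cases hp : p ∈ cover U
    · simp only [Submodule.coe_add, Pi.add_apply, Set.indicator_of_mem hp, HopfBC.delbar]
      rw [fderiv_add (Form.differentiableAt a hp) (Form.differentiableAt b hp),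
        ← ContinuousAlternatingMap.alternatizeUncurryFin_add]
      congr 1
      ext1 v
      simp only [antiPart, add_apply, smul_apply, ContinuousLinearMap.comp_apply]
      module
    · simp [hp]
  map_smul' c a := by
    ext1
    funext p
    by_cases hp : p ∈ cover U
    · simp only [Submodule.coe_smul, Pi.smul_apply, Set.indicator_of_mem hp, HopfBC.delbar,
        RingHom.id_apply]
      rw [fderiv_const_smul (Form.differentiableAt a hp)]
      ext v
      simp only [ContinuousAlternatingMap.alternatizeUncurryFin_apply,
        ContinuousAlternatingMap.smul_apply, Finset.smul_sum]
      refine Finset.sum_congr rfl fun i hi => ?_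
      rw [smul_comm c]
      congr 1
      simp only [antiPart, smul_apply, add_apply, ContinuousLinearMap.comp_apply,
        ContinuousAlternatingMap.smul_apply, ContinuousAlternatingMap.add_apply, smul_eq_mul]
      ring
    · simp only [Submodule.coe_smul, Pi.smul_apply, Set.indicator_of_notMem hp, RingHom.id_apply]
      exact (smul_zero (A := Alt n (k + 1)) c).symm

open Classical in
/-- The exterior derivative `d : 𝓔ᵏ(U) → 𝓔ᵏ⁺¹(U)`; it is `∂ + ∂̄`. -/
def Form.d (U : Opens (Hopf q n)) (k : ℕ) : Form U k →ₗ[ℂ] Form U (k + 1) where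
  toFun ω := ⟨(cover U).indicator (extDeriv ω.1), by
    have h : (cover U).indicator (extDeriv ω.1) = (Form.del U k ω + Form.delbar U k ω).1 := by
      funext p
      by_cases hp : p ∈ cover U <;>
        simp [hp, Form.del, Form.delbar, extDeriv_eq_del_add_delbar]
    rw [h]
    exact (Form.del U k ω + Form.delbar U k ω).2⟩
  map_add' a b := by
    ext1
    funext p
    by_cases hp : p ∈ cover U
    · simp only [Submodule.coe_add, Pi.add_apply, Set.indicator_of_mem hp]
      exact extDeriv_add (Form.differentiableAt a hp) (Form.differentiableAt b hp)
    · simp [hp]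
  map_smul' c a := by
    ext1
    funext p
    by_cases hp : p ∈ cover U
    · have h1 := congrArg (fun ω => ω.1 p) ((Form.del U k).map_smul c a)
      have h2 := congrArg (fun ω => ω.1 p) ((Form.delbar U k).map_smul c a)
      simp only [Form.del, Form.delbar, LinearMap.coe_mk, AddHom.coe_mk, Submodule.coe_smul,
        Pi.smul_apply, Set.indicator_of_mem hp] at h1 h2
      simp only [Submodule.coe_smul, Pi.smul_apply, Set.indicator_of_mem hp, RingHom.id_apply,
        extDeriv_eq_del_add_delbar, smul_add, h1, h2]
    · simp only [Submodule.coe_smul, Pi.smul_apply, Set.indicator_of_notMem hp, RingHom.id_apply]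
      exact (smul_zero (A := Alt n (k + 1)) c).symm

open Classical in
/-- Restriction of forms to a smaller open set. -/
def Form.res {U W : Opens (Hopf q n)} (h : W ≤ U) (k : ℕ) : Form U k →ₗ[ℂ] Form W k where
  toFun ω := ⟨(cover W).indicator ω.1,
    (ω.2.1.mono (cover_mono h)).congr fun p hp => by simp [hp],
    fun p hp v => by
      simp only [Set.indicator_of_mem hp, Set.indicator_of_mem (smul_mem_cover hp)]
      exact ω.2.2.1 p (cover_mono h hp) v,
    fun p hp => by simp [hp]⟩
  map_add' a b := by
    ext1
    funext p
    by_cases hp : p ∈ cover W <;> simp [hp]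
  map_smul' c a := by
    ext1
    funext p
    by_cases hp : p ∈ cover W
    · simp [hp]
    · simp only [Submodule.coe_smul, Pi.smul_apply, Set.indicator_of_notMem hp, RingHom.id_apply]
      exact (smul_zero (A := Alt n k) c).symm

theorem Form.eventuallyEq_res {U W : Opens (Hopf q n)} (h : W ≤ U) (ω : Form U k) {p : Vec n}
    (hp : p ∈ cover W) : (Form.res h k ω).1 =ᶠ[nhds p] ω.1 := by
  filter_upwards [(isOpen_cover W).mem_nhds hp] with x hx
  simp [Form.res, hx]

theorem Form.del_res {U W : Opens (Hopf q n)} (h : W ≤ U) (ω : Form U k) :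
    Form.del W k (Form.res h k ω) = Form.res h (k + 1) (Form.del U k ω) := by
  ext1
  funext p
  by_cases hp : p ∈ cover W
  · have hd := (Form.eventuallyEq_res h ω hp).fderiv_eq (𝕜 := ℝ)
    have : (Form.del W k (Form.res h k ω)).1 p = HopfBC.del (Form.res h k ω).1 p := by
      simp [Form.del, hp]
    rw [this, HopfBC.del, hd]
    simp [Form.res, Form.del, hp, cover_mono h hp, HopfBC.del]
  · simp [Form.res, Form.del, hp]

theorem Form.delbar_res {U W : Opens (Hopf q n)} (h : W ≤ U) (ω : Form U k) :
    Form.delbar W k (Form.res h k ω) = Form.res h (k + 1) (Form.delbar U k ω) := by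
  ext1
  funext p
  by_cases hp : p ∈ cover W
  · have hd := (Form.eventuallyEq_res h ω hp).fderiv_eq (𝕜 := ℝ)
    have : (Form.delbar W k (Form.res h k ω)).1 p = HopfBC.delbar (Form.res h k ω).1 p := by
      simp [Form.delbar, hp]
    rw [this, HopfBC.delbar, hd]
    simp [Form.res, Form.delbar, hp, cover_mono h hp, HopfBC.delbar]
  · simp [Form.res, Form.delbar, hp]

theorem Form.d_res {U W : Opens (Hopf q n)} (h : W ≤ U) (ω : Form U k) :
    Form.d W k (Form.res h k ω) = Form.res h (k + 1) (Form.d U k ω) := by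
  ext1
  funext p
  by_cases hp : p ∈ cover W
  · have hd := (Form.eventuallyEq_res h ω hp).extDeriv_eq
    simp [Form.res, Form.d, hp, cover_mono h hp] at hd ⊢
    exact hd
  · simp [Form.res, Form.d, hp]

theorem Form.res_res {U W X : Opens (Hopf q n)} (h : W ≤ U) (h' : X ≤ W) (ω : Form U k) :
    Form.res h' k (Form.res h k ω) = Form.res (h'.trans h) k ω := by
  ext1
  funext p
  by_cases hp : p ∈ cover X
  · simp [Form.res, hp, cover_mono h' hp]
  · simp [Form.res, hp]

/-- Forms of type `(a, b)`, `a + b = k`: multiplying all tangent vectors by `c ∈ ℂ` multiplies the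
value by `c ^ a * c̄ ^ b`. -/
def Form.type (U : Opens (Hopf q n)) (k a b : ℕ) : Submodule ℂ (Form U k) where
  carrier := {ω | ∀ p v (c : ℂ),
    ω.1 p (fun i => c • v i) = c ^ a * (starRingEnd ℂ c) ^ b * ω.1 p v}
  add_mem' := by
    intro x y hx hy p v c
    simp only [Submodule.coe_add, Pi.add_apply, ContinuousAlternatingMap.add_apply, hx p v c,
      hy p v c]
    ring
  zero_mem' := by
    intro p v c
    simp
  smul_mem' := by
    intro r x hx p v c
    simp only [Submodule.coe_smul, Pi.smul_apply, ContinuousAlternatingMap.smul_apply, hx p v c,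
      smul_eq_mul]
    ring

/-- `∂̄∂` on functions. -/
def Form.ddbar (U : Opens (Hopf q n)) : Form U 0 →ₗ[ℂ] Form U 2 :=
  Form.delbar U 1 ∘ₗ Form.del U 0

theorem Form.ddbar_res {U W : Opens (Hopf q n)} (h : W ≤ U) (ω : Form U 0) :
    Form.ddbar W (Form.res h 0 ω) = Form.res h 2 (Form.ddbar U ω) := by
  simp [Form.ddbar, Form.del_res, Form.delbar_res]

theorem Form.res_type {U W : Opens (Hopf q n)} (h : W ≤ U) {a b : ℕ} {ω : Form U k}
    (hω : ω ∈ Form.type U k a b) : Form.res h k ω ∈ Form.type W k a b := by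
  intro p v c
  by_cases hp : p ∈ cover W
  · simpa [Form.res, hp] using hω p v c
  · simp [Form.res, hp]

/-! ### Cohomology groups -/

section Coh

variable {A A' : Type*} [AddCommGroup A] [Module ℂ A] [AddCommGroup A'] [Module ℂ A']

/-- Cocycles `Z` modulo coboundaries `B`. -/
abbrev Coh (Z B : Submodule ℂ A) : Type _ := Z ⧸ B.submoduleOf Z

/-- The class of a cocycle. -/
def Coh.mk {Z : Submodule ℂ A} (B : Submodule ℂ A) (z : Z) : Coh Z B :=
  (B.submoduleOf Z).mkQ z

/-- The map in cohomology induced by a map of cochains. -/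
def Coh.map {Z B : Submodule ℂ A} {Z' B' : Submodule ℂ A'} (f : A →ₗ[ℂ] A')
    (hZ : ∀ z ∈ Z, f z ∈ Z') (hB : ∀ b ∈ B, f b ∈ B') : Coh Z B →ₗ[ℂ] Coh Z' B' :=
  Submodule.mapQ _ _ (f.restrict hZ) fun z hz => hB z.1 hz

end Coh

/-- `Z²_d(U)`, `B²_d(U)`, `H²_d(U)`: de Rham cohomology. -/
def ZdR (U : Opens (Hopf q n)) : Submodule ℂ (Form U 2) := LinearMap.ker (Form.d U 2)

def BdR (U : Opens (Hopf q n)) : Submodule ℂ (Form U 2) := LinearMap.range (Form.d U 1)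

abbrev HdR (U : Opens (Hopf q n)) : Type := Coh (ZdR U) (BdR U)

/-- Dolbeault cohomology of type `(1, 1)`. -/
def ZDol (U : Opens (Hopf q n)) : Submodule ℂ (Form U 2) :=
  Form.type U 2 1 1 ⊓ LinearMap.ker (Form.delbar U 2)

def BDol (U : Opens (Hopf q n)) : Submodule ℂ (Form U 2) :=
  (Form.type U 1 1 0).map (Form.delbar U 1)

abbrev HDol (U : Opens (Hopf q n)) : Type := Coh (ZDol U) (BDol U)

/-- Bott-Chern cohomology of type `(1, 1)`. -/
def ZBC (U : Opens (Hopf q n)) : Submodule ℂ (Form U 2) :=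
  Form.type U 2 1 1 ⊓ LinearMap.ker (Form.d U 2)

def BBC (U : Opens (Hopf q n)) : Submodule ℂ (Form U 2) := LinearMap.range (Form.ddbar U)

abbrev HBC (U : Opens (Hopf q n)) : Type := Coh (ZBC U) (BBC U)

/-- Aeppli cohomology of type `(1, 1)`. -/
def ZA (U : Opens (Hopf q n)) : Submodule ℂ (Form U 2) :=
  Form.type U 2 1 1 ⊓ LinearMap.ker (Form.delbar U 3 ∘ₗ Form.del U 2)

def BA (U : Opens (Hopf q n)) : Submodule ℂ (Form U 2) :=
  (Form.type U 1 1 0).map (Form.delbar U 1) ⊔ (Form.type U 1 0 1).map (Form.del U 1)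

abbrev HA (U : Opens (Hopf q n)) : Type := Coh (ZA U) (BA U)

instance (U : Opens (Hopf q n)) : AddCommGroup (HA U) := inferInstance

instance (U : Opens (Hopf q n)) : Module ℂ (HA U) := inferInstance

/-- Restriction in Aeppli cohomology. -/
def HA.res {U W : Opens (Hopf q n)} (h : W ≤ U) : HA U →ₗ[ℂ] HA W :=
  Coh.map (Form.res h 2)
    (fun z hz => ⟨Form.res_type h hz.1, by
      have h2 : Form.delbar U 3 (Form.del U 2 z) = 0 := hz.2
      change Form.delbar W 3 (Form.del W 2 (Form.res h 2 z)) = 0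
      rw [Form.del_res, Form.delbar_res, h2, map_zero]⟩)
    (fun b hb => by
      obtain ⟨x, ⟨a, ha, rfl⟩, y, ⟨c, hc, rfl⟩, rfl⟩ := Submodule.mem_sup.1 hb
      rw [map_add, ← Form.delbar_res, ← Form.del_res]
      exact Submodule.add_mem_sup ⟨_, Form.res_type h ha, rfl⟩ ⟨_, Form.res_type h hc, rfl⟩)

/-- Čech-Bott-Chern cochains `(σ₀, σ₁, σ₀₁)` of the covering `{U₀, U₁}` of `U₀ ∪ U₁`, before the
types are imposed. -/
abbrev Cochain (U₀ U₁ : Opens (Hopf q n)) : Type :=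
  Form U₀ 2 × Form U₁ 2 × Form (U₀ ⊓ U₁) 0

/-- Čech-Bott-Chern cocycles of type `(1, 1)`. -/
def ZCech (U₀ U₁ : Opens (Hopf q n)) : Submodule ℂ (Cochain U₀ U₁) where
  carrier := {σ | σ.1 ∈ Form.type U₀ 2 1 1 ∧ σ.2.1 ∈ Form.type U₁ 2 1 1 ∧
    Form.d U₀ 2 σ.1 = 0 ∧ Form.d U₁ 2 σ.2.1 = 0 ∧
    Form.res inf_le_right 2 σ.2.1 - Form.res inf_le_left 2 σ.1 - Form.ddbar (U₀ ⊓ U₁) σ.2.2 = 0}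
  add_mem' := by
    rintro a b ⟨h1, h2, h3, h4, h5⟩ ⟨k1, k2, k3, k4, k5⟩
    refine ⟨add_mem h1 k1, add_mem h2 k2, ?_, ?_, ?_⟩
    · simp [h3, k3]
    · simp [h4, k4]
    · simp only [Prod.fst_add, Prod.snd_add, map_add]
      rw [← add_zero (0 : Form (U₀ ⊓ U₁) 2)]
      nth_rewrite 2 [← h5]
      rw [← k5]
      abel
  zero_mem' := by simp
  smul_mem' := by
    rintro c a ⟨h1, h2, h3, h4, h5⟩
    refine ⟨Submodule.smul_mem _ c h1, Submodule.smul_mem _ c h2, ?_, ?_, ?_⟩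
    · simp [h3]
    · simp [h4]
    · simp only [Prod.smul_fst, Prod.smul_snd, map_smul]
      rw [← smul_sub, ← smul_sub, h5, smul_zero]

/-- Čech-Bott-Chern coboundaries of type `(1, 1)`. -/
def BCech (U₀ U₁ : Opens (Hopf q n)) : Submodule ℂ (Cochain U₀ U₁) :=
  LinearMap.range
    ((Form.ddbar U₀ ∘ₗ LinearMap.fst ℂ (Form U₀ 0) (Form U₁ 0)).prod
      ((Form.ddbar U₁ ∘ₗ LinearMap.snd ℂ (Form U₀ 0) (Form U₁ 0)).prod
        (Form.res (inf_le_right : U₀ ⊓ U₁ ≤ U₁) 0 ∘ₗ LinearMap.snd ℂ (Form U₀ 0) (Form U₁ 0) -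
          Form.res (inf_le_left : U₀ ⊓ U₁ ≤ U₀) 0 ∘ₗ LinearMap.fst ℂ (Form U₀ 0) (Form U₁ 0))))

/-- `H^{1,1}_BC` of the covering `{U₀, U₁}`. -/
abbrev HCech (U₀ U₁ : Opens (Hopf q n)) : Type := Coh (ZCech U₀ U₁) (BCech U₀ U₁)

/-- Relative Bott-Chern cochains `(σ₁, σ₀₁)`. -/
abbrev RelCochain (U₀ U₁ : Opens (Hopf q n)) : Type := Form U₁ 2 × Form (U₀ ⊓ U₁) 0

/-- Relative Bott-Chern cocycles of type `(1, 1)`. -/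
def ZRel (U₀ U₁ : Opens (Hopf q n)) : Submodule ℂ (RelCochain U₀ U₁) where
  carrier := {σ | σ.1 ∈ Form.type U₁ 2 1 1 ∧ Form.d U₁ 2 σ.1 = 0 ∧
    Form.res inf_le_right 2 σ.1 - Form.ddbar (U₀ ⊓ U₁) σ.2 = 0}
  add_mem' := by
    rintro a b ⟨h2, h4, h5⟩ ⟨k2, k4, k5⟩
    refine ⟨add_mem h2 k2, ?_, ?_⟩
    · simp [h4, k4]
    · simp only [Prod.fst_add, Prod.snd_add, map_add]
      rw [← add_zero (0 : Form (U₀ ⊓ U₁) 2)]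
      nth_rewrite 2 [← h5]
      rw [← k5]
      abel
  zero_mem' := by simp
  smul_mem' := by
    rintro c a ⟨h2, h4, h5⟩
    refine ⟨Submodule.smul_mem _ c h2, ?_, ?_⟩
    · simp [h4]
    · simp only [Prod.smul_fst, Prod.smul_snd, map_smul]
      rw [← smul_sub, h5, smul_zero]

/-- Relative Bott-Chern coboundaries of type `(1, 1)`. -/
def BRel (U₀ U₁ : Opens (Hopf q n)) : Submodule ℂ (RelCochain U₀ U₁) :=
  LinearMap.range ((Form.ddbar U₁).prod (Form.res (inf_le_right : U₀ ⊓ U₁ ≤ U₁) 0))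

/-- The relative Bott-Chern cohomology `H^{1,1}_BC({U₀, U₁}, U₀)`. -/
abbrev HRel (U₀ U₁ : Opens (Hopf q n)) : Type := Coh (ZRel U₀ U₁) (BRel U₀ U₁)

/-- The map `j^*`, induced by `(σ₁, σ₀₁) ↦ (0, σ₁, σ₀₁)`. -/
def jStar (U₀ U₁ : Opens (Hopf q n)) : HRel U₀ U₁ →ₗ[ℂ] HCech U₀ U₁ :=
  Coh.map (LinearMap.inr ℂ (Form U₀ 2) (RelCochain U₀ U₁))
    (fun z hz => ⟨zero_mem _, hz.1, map_zero _, hz.2.1, by simpa using hz.2.2⟩)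
    (by
      rintro _ ⟨τ, rfl⟩
      exact ⟨(0, τ), by simp⟩)

/-- The map from the Bott-Chern cohomology of the whole Hopf manifold to that of the covering,
induced by `ω ↦ (ω, ω, 0)`. -/
def toCech (U₀ U₁ : Opens (Hopf q n)) : HBC (⊤ : Opens (Hopf q n)) →ₗ[ℂ] HCech U₀ U₁ :=
  Coh.map ((Form.res (le_top : U₀ ≤ ⊤) 2).prod
      ((Form.res (le_top : U₁ ≤ ⊤) 2).prod 0))
    (fun z hz => by
      have h2 : Form.d ⊤ 2 z = 0 := hz.2
      refine ⟨Form.res_type _ hz.1, Form.res_type _ hz.1, ?_, ?_, ?_⟩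
      · change Form.d U₀ 2 (Form.res _ 2 z) = 0
        rw [Form.d_res, h2, map_zero]
      · change Form.d U₁ 2 (Form.res _ 2 z) = 0
        rw [Form.d_res, h2, map_zero]
      · change Form.res _ 2 (Form.res _ 2 z) - Form.res _ 2 (Form.res _ 2 z) - _ = _
        change _ - Form.ddbar (U₀ ⊓ U₁) 0 = 0
        rw [Form.res_res, Form.res_res, map_zero, sub_zero, sub_self])
    (by
      rintro _ ⟨τ, rfl⟩
      refine ⟨(Form.res le_top 0 τ, Form.res le_top 0 τ), ?_⟩
      simp [Form.ddbar_res, Form.res_res])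

/-! ### The hyperplane bundle, connections and Hermitian metrics -/

/-- The elliptic fibration `[p] ↦ ℂ p` onto the projective space. -/
def hopfProj (v : Hopf q n) : Projectivization ℂ (Vec n) :=
  Quotient.lift (fun p : {p : Vec n // p ≠ 0} => Projectivization.mk ℂ p.1 p.2)
    (by
      rintro p p' ⟨k, hk⟩
      rw [Projectivization.mk_eq_mk_iff]
      refine ⟨(q ^ k)⁻¹, ?_⟩
      rw [← hk, Units.smul_def, smul_smul, ← Units.val_mul, inv_mul_cancel, Units.val_one,
        one_smul]) v

theorem mem_hopfProj (p : Vec n) (hp : p ≠ 0) : p ∈ (hopfProj (Hopf.mk q p hp)).submodule := by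
  change p ∈ (Projectivization.mk ℂ p hp).submodule
  rw [Projectivization.submodule_mk]
  exact Submodule.mem_span_singleton_self p

/-- The fibre of the pull-back `L` of the hyperplane bundle: linear forms on the line `ℂ p`. -/
abbrev LFiber (v : Hopf q n) : Type := Module.Dual ℂ (hopfProj v).submodule

/-- `f` is the coefficient function `p ↦ s [p] p` of a smooth section `s` of `L` on `U`, that is, the
coefficient of `s` in the frame `ν`, `ν_p : a p ↦ a`, of the pull-back of `L` to `ℂⁿ ∖ {0}`. -/
def IsSection (U : Opens (Hopf q n)) (f : Vec n → ℂ) : Prop :=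
  ContDiffOn ℝ (⊤ : ℕ∞) f (cover U) ∧
    ∃ s : (v : Hopf q n) → LFiber v, ∀ (p : Vec n) (hp : p ≠ 0), Hopf.mk q p hp ∈ U →
      f p = s (Hopf.mk q p hp) ⟨p, mem_hopfProj p hp⟩

/-- A connection for `L` on `U`, given by its connection form `θ` in the frame `ν`. This is a form on
`U` since `ν_{q p} = q⁻¹ ν_p` with `q` constant. -/
abbrev Connection (U : Opens (Hopf q n)) : Type := Form U 1

/-- The coefficient of `∇ s` in the frame `ν`: `d s + s θ`. -/
def covDeriv {U : Opens (Hopf q n)} (θ : Connection U) (s : Vec n → ℂ) (p : Vec n) :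
    Vec n →L[ℝ] ℂ :=
  fderiv ℝ s p + s p • toLin (θ.1 p)

/-- A smooth Hermitian metric `h` of `L` on `U`, given by `N p = h(ν_p, ν_p)`. -/
structure HermMetric (U : Opens (Hopf q n)) where
  N : Vec n → ℝ
  smooth : ContDiffOn ℝ (⊤ : ℕ∞) N (cover U)
  pos : ∀ p ∈ cover U, 0 < N p
  equivariant : ∀ p ∈ cover U, N ((q : ℂ) • p) = (‖(q : ℂ)‖ ^ 2)⁻¹ * N p

/-- The function `h(s, t)` for sections given by their coefficients in the frame `ν`. -/
def HermMetric.herm {U : Opens (Hopf q n)} (h : HermMetric U) (s t : Vec n → ℂ) (p : Vec n) : ℂ :=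
  h.N p * (s p * starRingEnd ℂ (t p))

/-- `d h(s, t) = h(∇ s, t) + h(s, ∇ t)`. -/
def IsHConnection {U : Opens (Hopf q n)} (h : HermMetric U) (θ : Connection U) : Prop :=
  ∀ s t : Vec n → ℂ, IsSection U s → IsSection U t → ∀ p ∈ cover U, ∀ u : Vec n,
    fderiv ℝ (h.herm s t) p u =
      h.N p * (covDeriv θ s p u * starRingEnd ℂ (t p)) +
        h.N p * (s p * starRingEnd ℂ (covDeriv θ t p u))

/-- Connections of type `(1, 0)`. The frame `ν` is holomorphic. -/
def IsType10 {U : Opens (Hopf q n)} (θ : Connection U) : Prop := θ ∈ Form.type U 1 1 0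

/-- The `h`-metric connection: the `h`-connection of type `(1, 0)`. -/
def IsMetricConnection {U : Opens (Hopf q n)} (h : HermMetric U) (θ : Connection U) : Prop :=
  IsType10 θ ∧ IsHConnection h θ

/-- The Chern form `c¹(∇) = (√-1 / 2π) κ`, with curvature `κ = dθ + θ ∧ θ = dθ`. -/
def chernForm {U : Opens (Hopf q n)} (θ : Connection U) : Form U 2 :=
  (I / (2 * Real.pi) : ℂ) • Form.d U 1 θ

/-- The Atiyah form `a¹(∇) = (√-1 / 2π) κ^{1,1}`, `κ^{1,1} = ∂̄θ`, of a `(1, 0)`-connection. -/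
def atiyahForm {U : Opens (Hopf q n)} (θ : Connection U) : Form U 2 :=
  (I / (2 * Real.pi) : ℂ) • Form.delbar U 1 θ

/-- `c` is the Chern class `c¹(L)`: the class of `c¹(∇)` for every connection `∇`. -/
def IsChernClass (c : HdR (⊤ : Opens (Hopf q n))) : Prop :=
  ∀ θ : Connection (⊤ : Opens (Hopf q n)),
    ∃ ω : ZdR (⊤ : Opens (Hopf q n)), ω.1 = chernForm θ ∧ Coh.mk _ ω = c

/-- `c` is the Atiyah class `a¹(L)`: the class of `a¹(∇)` for every `(1, 0)`-connection `∇`. -/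
def IsAtiyahClass (c : HDol (⊤ : Opens (Hopf q n))) : Prop :=
  ∀ θ : Connection (⊤ : Opens (Hopf q n)), IsType10 θ →
    ∃ ω : ZDol (⊤ : Opens (Hopf q n)), ω.1 = atiyahForm θ ∧ Coh.mk _ ω = c

/-- The Bott-Chern difference form `c¹_BC(∇^{h₀}, ∇^{h₁}) = (√-1 / 2π) ∫₀¹ L_t dt`, where
`h_t = (1 - t) h₀ + t h₁` and `h_t(L_t s, s') = (d/dt) h_t(s, s')`. -/
def bcDifference {U₀ U₁ : Opens (Hopf q n)} (h₀ : HermMetric U₀) (h₁ : HermMetric U₁) (p : Vec n) :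
    ℂ :=
  (I / (2 * Real.pi) : ℂ) *
    ((∫ t in (0 : ℝ)..1, (h₁.N p - h₀.N p) / ((1 - t) * h₀.N p + t * h₁.N p) : ℝ) : ℂ)

/-- `c` is the Bott-Chern class `c¹_BC(L)`: the class of `c¹(∇^h)` for every metric `h`. -/
def IsBottChernClass (c : HBC (⊤ : Opens (Hopf q n))) : Prop :=
  ∀ (h : HermMetric (⊤ : Opens (Hopf q n))) (θ : Connection (⊤ : Opens (Hopf q n))),
    IsMetricConnection h θ → ∃ ω : ZBC (⊤ : Opens (Hopf q n)), ω.1 = chernForm θ ∧ Coh.mk _ ω = c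

/-! ### The Hopf surface in the Hopf threefold and the foliation -/

/-- `(x₁, …, xₙ) ↦ (x₁, …, xₙ, 0)`. -/
def inclVec (p : Vec n) : Vec (n + 1) := Fin.snoc (α := fun _ => ℂ) p 0

theorem inclVec_ne {p : Vec n} (hp : p ≠ 0) : inclVec p ≠ 0 := by
  intro h
  apply hp
  ext i
  have := congrFun h (Fin.castSucc i)
  simpa [inclVec] using this

theorem inclVec_smul (c : ℂ) (p : Vec n) : inclVec (c • p) = c • inclVec p := by
  ext i
  refine Fin.lastCases ?_ (fun i => ?_) i <;> simp [inclVec]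

/-- The embedding of Hopf manifolds `[x₁, …, xₙ] ↦ [x₁, …, xₙ, 0]`. -/
def Hopf.incl (v : Hopf q n) : Hopf q (n + 1) :=
  Quotient.map (sa := hopfSetoid q n) (sb := hopfSetoid q (n + 1))
    (fun p => ⟨inclVec p.1, inclVec_ne p.2⟩)
    (by
      rintro p p' ⟨k, hk⟩
      refine ⟨k, ?_⟩
      change _ • inclVec p.1 = inclVec p'.1
      rw [← hk, inclVec_smul]) v

/-- The vector fields `v₁ = y ∂/∂y + z ∂/∂z` and `v₂ = ∂/∂x` on `ℂ³`. -/
def v₁ (p : Vec 3) : Vec 3 := ![0, p 1, p 2]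

def v₂ (_ : Vec 3) : Vec 3 := ![1, 0, 0]

/-- The subspace spanned by `v₁` and `v₂`, defining the distribution `𝓕` on the Hopf threefold. -/
def fol (p : Vec 3) : Submodule ℂ (Vec 3) := Submodule.span ℂ {v₁ p, v₂ p}

/-- The singular set of `𝓕`: the points where the rank drops. -/
def singularSet (q : ℂˣ) : Set (Hopf q 3) :=
  {m | ∃ (p : Vec 3) (hp : p ≠ 0), Hopf.mk q p hp = m ∧ Module.finrank ℂ (fol p) < 2}

/-- The elliptic curve `C = {y = 0}` in the Hopf surface. -/
def curve (q : ℂˣ) : Set (Hopf q 2) := Set.range (Hopf.incl : Hopf q 1 → Hopf q 2)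

/-- The open set where the `i`-th coordinate does not vanish. -/
def coordOpen (q : ℂˣ) {n : ℕ} (i : Fin n) : Opens (Hopf q n) where
  carrier := {v | ∃ (p : Vec n) (hp : p ≠ 0), Hopf.mk q p hp = v ∧ p i ≠ 0}
  is_open' := by
    refine isOpen_coinduced.2 ?_
    have h : (fun p : {p : Vec n // p ≠ 0} => Hopf.mk q p.1 p.2) ⁻¹'
        {v | ∃ (p : Vec n) (hp : p ≠ 0), Hopf.mk q p hp = v ∧ p i ≠ 0} =
        {p : {p : Vec n // p ≠ 0} | p.1 i ≠ 0} := by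
      ext p
      constructor
      · rintro ⟨p', hp', h, hi⟩
        obtain ⟨k, hk⟩ := Quotient.exact h
        change p.1 i ≠ 0
        rw [← hk]
        exact mul_ne_zero (Units.ne_zero _) hi
      · intro h
        exact ⟨p.1, p.2, rfl, h⟩
    change IsOpen ((fun p : {p : Vec n // p ≠ 0} => Hopf.mk q p.1 p.2) ⁻¹' _)
    rw [h]
    exact isOpen_ne_fun ((continuous_apply i).comp continuous_subtype_val) continuous_const

theorem curve_subset (q : ℂˣ) : curve q ⊆ (coordOpen q (0 : Fin 2) : Set (Hopf q 2)) := by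
  rintro _ ⟨v, rfl⟩
  obtain ⟨p, rfl⟩ := Quotient.exists_rep v
  refine ⟨inclVec p.1, inclVec_ne p.2, rfl, ?_⟩
  intro h
  apply p.2
  ext i
  have hi : i = 0 := Subsingleton.elim _ _
  subst hi
  exact h

/-- A smooth section on `U` of the tangent bundle of the `m`-dimensional Hopf manifold along the
`n`-dimensional one: a smooth map `w` on the inverse image of `U` with `w (q p) = q w(p)`. Tangent
vectors are of type `(1, 0)`, so that `w` stands for `∑ w_j ∂/∂z_j`. -/
def IsVectorField (U : Opens (Hopf q n)) {m : ℕ} (w : Vec n → Vec m) : Prop :=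
  ContDiffOn ℝ (⊤ : ℕ∞) w (cover U) ∧ ∀ p ∈ cover U, w ((q : ℂ) • p) = (q : ℂ) • w p

/-- The bracket of smooth vector fields of type `(1, 0)`:
`[u, v]_j = ∑_i (u_i ∂v_j/∂z_i - v_i ∂u_j/∂z_i)`. -/
def bracket (u v : Vec n → Vec n) (p : Vec n) : Vec n :=
  linPart (fderiv ℝ v p) (u p) - linPart (fderiv ℝ u p) (v p)

/-- `θ` is an `F₀`-connection for `N_V = L` on `V ∖ C = {y ≠ 0}`: it is of type `(1, 0)` and
`∇_u ν = π([ũ, ṽ]|_V)`, the Camacho-Sad action, for all local sections `ũ` of `𝓕` and `ṽ` of `TM`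
away from the singular set, where `u = ũ|_V` and `ν = π(ṽ|_V)`. The projection `π` of `TM|_V` onto
`N_V = L` is the last component. -/
def IsCamachoSadConnection (θ : Connection (coordOpen q (1 : Fin 2))) : Prop :=
  IsType10 θ ∧
    ∀ (W : Opens (Hopf q 3)), Disjoint (W : Set (Hopf q 3)) (singularSet q) →
      ∀ u v : Vec 3 → Vec 3, IsVectorField W u → IsVectorField W v →
        (∀ p ∈ cover W, u p ∈ fol p) → ∀ p : Vec 2, inclVec p ∈ cover W →
          linPart (covDeriv θ (fun x => v (inclVec x) 2) p)
              ![u (inclVec p) 0, u (inclVec p) 1] =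
            bracket u v (inclVec p) 2

/-- `c` is the localization `c¹_BC(L; 𝓕)` in `H^{1,1}_BC({U₀, U₁}, U₀)`, `U₀ = V ∖ C = {y ≠ 0}`,
`U₁ = {x ≠ 0}`: for every `F₀`-connection `∇₀` on `U₀` that is an `h₀`-connection and every metric
`h₁` on `U₁` with metric connection `∇₁`, the form `c¹(∇₀)` is zero and `c` is the class of
`(0, c¹(∇₁), c¹_BC(∇₀, ∇₁))`. -/
def IsLocalization (c : HRel (coordOpen q (1 : Fin 2)) (coordOpen q (0 : Fin 2))) : Prop :=
  ∀ (θ₀ : Connection (coordOpen q (1 : Fin 2))) (h₀ : HermMetric (coordOpen q (1 : Fin 2)))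
    (θ₁ : Connection (coordOpen q (0 : Fin 2))) (h₁ : HermMetric (coordOpen q (0 : Fin 2))),
    IsCamachoSadConnection θ₀ → IsHConnection h₀ θ₀ → IsMetricConnection h₁ θ₁ →
      chernForm θ₀ = 0 ∧
        ∃ σ : ZRel (coordOpen q (1 : Fin 2)) (coordOpen q (0 : Fin 2)),
          σ.1.1 = chernForm θ₁ ∧
          (∀ p ∈ cover (coordOpen q (1 : Fin 2) ⊓ coordOpen q (0 : Fin 2)),
            val σ.1.2.1 p = bcDifference h₀ h₁ p) ∧
          Coh.mk _ σ = c

/-! ### Integration and the residue -/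

/-- The integral of an `m`-form over the singular cube `c : [a, b] → ℂⁿ`, `[a, b] ⊆ ℝᵐ`. -/
def cubeIntegral {m : ℕ} (c : (Fin m → ℝ) → Vec n) (a b : Fin m → ℝ) (ω : Vec n → Alt n m) : ℂ :=
  ∫ s in Set.Icc a b, ω (c s) (fun i => fderiv ℝ c s (Pi.single i 1))

/-- The point `[x, t x]` with `t = r e^{iφ}`, `x = e^{u + iψ}`. -/
def tubePoint (r φ u ψ : ℝ) : Vec 2 :=
  ![exp (u + ψ * I), r * exp (φ * I) * exp (u + ψ * I)]

/-- The integral over `R₁ = {|t| ≤ δ}`, `t = y / x`. The annulus `|q| ≤ |x| ≤ 1` is a fundamental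
domain. -/
def integralR₁ (q : ℂˣ) (δ : ℝ) (ω : Vec 2 → Alt 2 4) : ℂ :=
  cubeIntegral (fun s : Fin 4 → ℝ => tubePoint (s 0) (s 1) (s 2) (s 3))
    ![0, 0, Real.log ‖(q : ℂ)‖, 0] ![δ, 2 * Real.pi, 0, 2 * Real.pi] ω

/-- The integral over `∂R₁ = {|t| = δ}`, oriented as a boundary. -/
def integralBdryR₁ (q : ℂˣ) (δ : ℝ) (ω : Vec 2 → Alt 2 3) : ℂ :=
  cubeIntegral (fun s : Fin 3 → ℝ => tubePoint δ (s 0) (s 1) (s 2))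
    ![0, Real.log ‖(q : ℂ)‖, 0] ![2 * Real.pi, 0, 2 * Real.pi] ω

/-- The integral over the elliptic curve `C = (ℂ ∖ {0}) / (x ∼ q x)`. -/
def integralC (q : ℂˣ) (ω : Vec 1 → Alt 1 2) : ℂ :=
  cubeIntegral (fun s : Fin 2 → ℝ => ![exp (s 0 + s 1 * I)])
    ![Real.log ‖(q : ℂ)‖, 0] ![0, 2 * Real.pi] ω

/-- The integral of the cup product of `(σ₁, σ₀₁)` and `ξ`,
`∫_{R₁} σ₁ ∧ ξ + ∫_{R₀₁} (∂σ₀₁ ∧ ξ - ½ ∂(σ₀₁ ξ)) + (- ∂̄σ₀₁ ∧ ξ + ½ ∂̄(σ₀₁ ξ))`,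
with `R₀₁ = -∂R₁`. -/
def pairing (q : ℂˣ) (δ : ℝ) (σ₁ : Vec 2 → Alt 2 2) (σ₀₁ : Vec 2 → Alt 2 0)
    (ξ : Vec 2 → Alt 2 2) : ℂ :=
  integralR₁ q δ (fun p => wedge (σ₁ p) (ξ p)) -
    integralBdryR₁ q δ (fun p =>
      ((wedge (del σ₀₁ p) (ξ p) : Alt 2 3) -
          (1 / 2 : ℂ) • del (fun x => val σ₀₁ x • ξ x) p) +
        (-(wedge (delbar σ₀₁ p) (ξ p) : Alt 2 3) +
          (1 / 2 : ℂ) • delbar (fun x => val σ₀₁ x • ξ x) p))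

/-- Open neighborhoods of `C` in `V`, smaller ones being larger in the order. -/
abbrev Nbhd (q : ℂˣ) : Type := {W : Opens (Hopf q 2) // curve q ⊆ W}ᵒᵈ

instance (q : ℂˣ) : DecidableEq (Nbhd q) := Classical.decEq _

/-- `H^{1,1}_A[C]`, the direct limit of `H^{1,1}_A(W)` over the neighborhoods `W` of `C`. -/
abbrev HAGerm (q : ℂˣ) : Type :=
  Module.DirectLimit (fun W : Nbhd q => HA (OrderDual.ofDual W).1)
    (fun _ _ h => HA.res (OrderDual.ofDual_le_ofDual.2 h))

/-- The class in `H^{1,1}_A[C]` of a `∂̄∂`-closed `(1, 1)`-form on a neighborhood of `C`. -/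
def HAGerm.mk {W : Opens (Hopf q 2)} (hW : curve q ⊆ W) (ξ : ZA W) : HAGerm q :=
  Module.DirectLimit.of ℂ (Nbhd q) (fun W : Nbhd q => HA (OrderDual.ofDual W).1)
    (fun _ _ h => HA.res (OrderDual.ofDual_le_ofDual.2 h)) (OrderDual.toDual ⟨W, hW⟩)
    (Coh.mk (BA W) ξ)

/-- `R` is the image of `c` under `Ψ : H^{1,1}_BC({U₀, U₁}, U₀) → H^{1,1}_A[C]^*`. It is computed
by any cocycle representing `c`, any form representing a class in `H^{1,1}_A[C]` and any tube `R₁`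
on which this form is defined. -/
def IsPsi (c : HRel (coordOpen q (1 : Fin 2)) (coordOpen q (0 : Fin 2)))
    (R : Module.Dual ℂ (HAGerm q)) : Prop :=
  ∀ σ : ZRel (coordOpen q (1 : Fin 2)) (coordOpen q (0 : Fin 2)), Coh.mk _ σ = c →
    ∀ (W : Opens (Hopf q 2)) (hW : curve q ⊆ W) (ξ : ZA W) (δ : ℝ), 0 < δ →
      {p : Vec 2 | p 0 ≠ 0 ∧ ‖p 1‖ ≤ δ * ‖p 0‖} ⊆ cover W →
        R (HAGerm.mk hW ξ) = pairing q δ σ.1.1.1 σ.1.2.1 ξ.1.1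

/-! ### Explicit forms -/

/-- `γ = 1 / (2π√-1)`. -/
def γ : ℂ := 1 / (2 * Real.pi * I)

/-- `d log z_i = dz_i / z_i`. -/
def dlog (i : Fin n) (p : Vec n) : Alt n 1 :=
  ofLin ((p i)⁻¹ • (ContinuousLinearMap.proj i : Vec n →L[ℝ] ℂ))

/-- `d log z̄_i = dz̄_i / z̄_i`. -/
def dlogBar (i : Fin n) (p : Vec n) : Alt n 1 :=
  ofLin ((starRingEnd ℂ (p i))⁻¹ •
    (conjCLE : ℂ →L[ℝ] ℂ).comp (ContinuousLinearMap.proj i : Vec n →L[ℝ] ℂ))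

end HopfBC

end

/-!
Forms on an open set of a Hopf manifold are the forms on its inverse image in `ℂⁿ ∖ {0}` which are
invariant under `p ↦ q p`, so all computations take place on `ℂⁿ`. The operators `∂` and `∂̄` are
the cases `ε = -1` and `ε = 1` of one operator `dop ε`, which keeps the Leibniz rules (`dop_smul`,
`dop_wedgeLin`) and the relations `∂² = ∂̄² = ∂∂̄ + ∂̄∂ = 0` (`dop_dop_add`) uniform. The frame `ν`
of `L` is invariant, so a connection of `L` is a global `1`-form `θ`, its curvature is exact, and
the Chern and Atiyah classes vanish. The metric connection of `h` is `∂ log h(ν, ν)`.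

*The connection of the foliation.* Testing the Camacho-Sad condition on the normal field `y ∂/∂z`
against `y ∂/∂y + z ∂/∂z` and `y ∂/∂x` forces the connection form `-dy / y`
(`IsCamachoSadConnection.eq`), and this form does satisfy the condition
(`isCamachoSadConnection_connection`). It is the metric connection of `1 / |y|²`, hence flat.

*The Bott-Chern class.* It is represented by the Chern form of the metric `1 / (|x|² + |y|²)`. If
it vanished, then on the line `y = 1` a harmonic function would differ from `-log (|x|² + 1)` by a
bounded function, because a function on the compact Hopf surface is bounded; the mean value
property excludes this (`bottChern_ne_zero`). Metrics on `{y ≠ 0}` with the connection `-dy / y`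
are constant multiples of `1 / |y|²` (`exists_logN_eq`), and constants do not matter modulo `∂̄∂`,
so the localization is the class of `(0, γ log |x / y|²)` (`isLocalization_localClass`); it maps to
the Bott-Chern class (`jStar_localClass`).

*The residue.* The integrand over the boundary of a tube around `C` is the value of a `3`-form
`residueForm s ξ` with differential `∂̄∂s ∧ ξ` if `∂̄∂ξ = 0` (`d_residueForm`), and it is exact if
`∂̄∂s = 0` and `ξ` is a coboundary of Aeppli cohomology. Stokes' theorem on the tube
(`integral_tube_extDeriv`) and on its boundary (`integralBdryR₁_extDeriv`), proved for parametrized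
cubes whose other faces cancel by periodicity and invariance, shows that the residue depends
neither on the tube, nor on the representative, nor on the Aeppli cocycle (`pairing_eq_neg`,
`residue`, `isPsi_residue`). For the normalized area form the integrand is constant in the
parameters, and the integral is `1` (`residue_areaForm`).

*The Aeppli cohomology of `C`.* Coboundaries are exact, since there are no forms of type `(2, 0)`
and `(0, 2)` in dimension one, so their integrals vanish (`integralC_of_mem_BA`). Conversely every
`2`-form is `f d log x ∧ d log x̄` with an invariant function `f`. Averaging `f` over the flows
`e^{2πit}` and `e^{t log q}` leaves a constant and derivatives along the flows
(`exists_eq_fderiv_add_const`), and the latter give coboundaries (`exists_mem_BA_eq_fderiv`). Hence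
the class of the area form, whose integral is `1`, is a basis (`existsUnique_eq_smul_areaForm`).
-/

noncomputable section

namespace HopfBC

section

/-! ### Exterior products of alternating forms -/

theorem sum_perm_four (G : Fin 4 → Fin 4 → Fin 4 → Fin 4 → ℂ) :
    ∑ σ : Equiv.Perm (Fin 4), (Equiv.Perm.sign σ : ℤ) * G (σ 0) (σ 1) (σ 2) (σ 3) =
      (((G 0 1 2 3 + -G 0 1 3 2) + ((-G 0 2 1 3 + G 0 2 3 1) + (-G 0 3 2 1 + G 0 3 1 2))) +
        (((-G 1 0 2 3 + G 1 0 3 2) + ((G 1 2 0 3 + -G 1 2 3 0) + (G 1 3 2 0 + -G 1 3 0 2))) +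
          (((-G 2 1 0 3 + G 2 1 3 0) + ((G 2 0 1 3 + -G 2 0 3 1) + (G 2 3 0 1 + -G 2 3 1 0))) +
            ((-G 3 1 2 0 + G 3 1 0 2) +
              ((G 3 2 1 0 + -G 3 2 0 1) + (G 3 0 2 1 + -G 3 0 1 2)))))) := by
  rw [← Equiv.sum_comp Equiv.Perm.decomposeFin.symm, Fintype.sum_prod_type]
  simp only [← Equiv.sum_comp (Equiv.Perm.decomposeFin (n := 2)).symm, Fintype.sum_prod_type,
    ← Equiv.sum_comp (Equiv.Perm.decomposeFin (n := 1)).symm]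
  simp [Fin.sum_univ_succ, Equiv.Perm.decomposeFin.symm_sign]
  rfl

theorem sum_perm_three (G : Fin 3 → Fin 3 → Fin 3 → ℂ) :
    ∑ σ : Equiv.Perm (Fin 3), (Equiv.Perm.sign σ : ℤ) * G (σ 0) (σ 1) (σ 2) =
      G 0 1 2 + -G 0 2 1 + (-G 1 0 2 + G 1 2 0 + (-G 2 1 0 + G 2 0 1)) := by
  rw [← Equiv.sum_comp Equiv.Perm.decomposeFin.symm, Fintype.sum_prod_type]
  simp only [← Equiv.sum_comp (Equiv.Perm.decomposeFin (n := 1)).symm, Fintype.sum_prod_type]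
  simp [Fin.sum_univ_succ, Equiv.Perm.decomposeFin.symm_sign]
  rfl

variable {n k : ℕ}

theorem map_swap_two (α : Alt n 2) (a b : Vec n) : α ![b, a] = -α ![a, b] := by
  have h := α.map_swap ![a, b] (show (0 : Fin 2) ≠ 1 by decide)
  refine Eq.trans ?_ h
  change α ![b, a] = α _
  congr 1
  ext i
  fin_cases i <;> rfl

theorem sum_perm_two (G : Fin 2 → Fin 2 → ℂ) :
    ∑ σ : Equiv.Perm (Fin 2), (Equiv.Perm.sign σ : ℤ) * G (σ 0) (σ 1) = G 0 1 + -G 1 0 := by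
  rw [← Equiv.sum_comp Equiv.Perm.decomposeFin.symm, Fintype.sum_prod_type]
  simp [Fin.sum_univ_succ, Equiv.Perm.decomposeFin.symm_sign]

theorem wedge_one_one_apply (α β : Alt n 1) (v : Fin 2 → Vec n) :
    (wedge α β : Alt n 2) v = α ![v 0] * β ![v 1] - α ![v 1] * β ![v 0] := by
  refine (wedge_apply α β v).trans ?_
  have h : ∀ σ : Equiv.Perm (Fin (1 + 1)), (α (fun i => v (σ (Fin.castAdd 1 i))) *
      β (fun j => v (σ (Fin.natAdd 1 j)))) = α ![v (σ 0)] * β ![v (σ 1)] := by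
    intro σ
    congr 2
    all_goals
      ext i
      fin_cases i
      rfl
  simp only [h]
  have := sum_perm_two (fun a b => α ![v a] * β ![v b])
  refine (congrArg _ this).trans ?_
  simp
  ring

theorem wedge_one_two_apply (α : Alt n 1) (β : Alt n 2) (v : Fin 3 → Vec n) :
    (wedge α β : Alt n 3) v = α ![v 0] * β ![v 1, v 2] - α ![v 1] * β ![v 0, v 2] +
      α ![v 2] * β ![v 0, v 1] := by
  refine (wedge_apply α β v).trans ?_
  have h : ∀ σ : Equiv.Perm (Fin (1 + 2)), (α (fun i => v (σ (Fin.castAdd 2 i))) *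
      β (fun j => v (σ (Fin.natAdd 1 j)))) = α ![v (σ 0)] * β ![v (σ 1), v (σ 2)] := by
    intro σ
    congr 2
    all_goals
      ext i
      fin_cases i <;> rfl
  simp only [h]
  have := sum_perm_three (fun a b c => α ![v a] * β ![v b, v c])
  refine (congrArg _ this).trans ?_
  simp only [map_swap_two β (v 0) (v 1), map_swap_two β (v 0) (v 2), map_swap_two β (v 1) (v 2)]
  simp [Nat.factorial]
  ring

theorem wedge_two_two_apply (α β : Alt n 2) (v : Fin 4 → Vec n) :
    (wedge α β : Alt n 4) v = α ![v 0, v 1] * β ![v 2, v 3] - α ![v 0, v 2] * β ![v 1, v 3] +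
      α ![v 0, v 3] * β ![v 1, v 2] + α ![v 1, v 2] * β ![v 0, v 3] -
      α ![v 1, v 3] * β ![v 0, v 2] + α ![v 2, v 3] * β ![v 0, v 1] := by
  refine (wedge_apply α β v).trans ?_
  have h : ∀ σ : Equiv.Perm (Fin (2 + 2)), (α (fun i => v (σ (Fin.castAdd 2 i))) *
      β (fun j => v (σ (Fin.natAdd 2 j)))) = α ![v (σ 0), v (σ 1)] * β ![v (σ 2), v (σ 3)] := by
    intro σ
    congr 2
    all_goals
      ext i
      fin_cases i <;> rfl
  simp only [h]
  have := sum_perm_four (fun a b c d => α ![v a, v b] * β ![v c, v d])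
  refine (congrArg _ this).trans ?_
  simp only [map_swap_two β (v 0) (v 1), map_swap_two β (v 0) (v 2), map_swap_two β (v 1) (v 2),
    map_swap_two β (v 0) (v 3), map_swap_two β (v 1) (v 3), map_swap_two β (v 2) (v 3),
    map_swap_two α (v 0) (v 1), map_swap_two α (v 0) (v 2), map_swap_two α (v 1) (v 2),
    map_swap_two α (v 0) (v 3), map_swap_two α (v 1) (v 3), map_swap_two α (v 2) (v 3)]
  simp [Nat.factorial]
  ring

theorem toLin_apply (α : Alt n 1) (w : Vec n) : toLin α w = α ![w] := by
  rw [toLin]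
  simp
  congr 1
  ext i
  fin_cases i
  rfl

theorem ofLin_apply (D : Vec n →L[ℝ] ℂ) (v : Fin 1 → Vec n) : ofLin D v = D (v 0) := by
  simp [ofLin]

@[simp] theorem toLin_ofLin (D : Vec n →L[ℝ] ℂ) : toLin (ofLin D) = D := by
  simp [toLin, ofLin]

@[simp] theorem ofLin_toLin (α : Alt n 1) : ofLin (toLin α) = α := by
  simp [toLin, ofLin]

/-- The exterior product of a `1`-form, given as a real linear map, with a `k`-form. -/
def wedgeLin (D : Vec n →L[ℝ] ℂ) (ζ : Alt n k) : Alt n (k + 1) :=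
  .alternatizeUncurryFin (D.smulRight ζ)

theorem wedgeLin_apply (D : Vec n →L[ℝ] ℂ) (ζ : Alt n k) (v : Fin (k + 1) → Vec n) :
    wedgeLin D ζ v = ∑ i : Fin (k + 1), (-1 : ℂ) ^ (i : ℕ) * (D (v i) * ζ (i.removeNth v)) := by
  simp [wedgeLin, ContinuousAlternatingMap.alternatizeUncurryFin_apply, zsmul_eq_mul]

theorem wedge_one_two (α : Alt n 1) (ζ : Alt n 2) :
    (wedge α ζ : Alt n 3) = wedgeLin (toLin α) ζ := by
  ext v
  rw [wedge_one_two_apply, wedgeLin_apply, Fin.sum_univ_three]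
  have e0 : (0 : Fin 3).removeNth v = ![v 1, v 2] := by ext i; fin_cases i <;> rfl
  have e1 : (1 : Fin 3).removeNth v = ![v 0, v 2] := by ext i; fin_cases i <;> rfl
  have e2 : (2 : Fin 3).removeNth v = ![v 0, v 1] := by ext i; fin_cases i <;> rfl
  simp [e0, e1, e2, toLin_apply]
  ring

theorem wedgeLin_add_left (D D' : Vec n →L[ℝ] ℂ) (ζ : Alt n k) :
    wedgeLin (D + D') ζ = wedgeLin D ζ + wedgeLin D' ζ := by
  ext v
  simp only [wedgeLin_apply, add_apply, ContinuousAlternatingMap.add_apply,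
    ← Finset.sum_add_distrib]
  exact Finset.sum_congr rfl fun i _ => by ring

theorem wedgeLin_smul_left (c : ℂ) (D : Vec n →L[ℝ] ℂ) (ζ : Alt n k) :
    wedgeLin (c • D) ζ = c • wedgeLin D ζ := by
  ext v
  simp only [wedgeLin_apply, smul_apply, ContinuousAlternatingMap.smul_apply, smul_eq_mul,
    Finset.mul_sum]
  exact Finset.sum_congr rfl fun i _ => by ring

theorem wedgeLin_add_right (D : Vec n →L[ℝ] ℂ) (ζ ζ' : Alt n k) :
    wedgeLin D (ζ + ζ') = wedgeLin D ζ + wedgeLin D ζ' := by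
  ext v
  simp only [wedgeLin_apply, ContinuousAlternatingMap.add_apply, ← Finset.sum_add_distrib]
  exact Finset.sum_congr rfl fun i _ => by ring

theorem wedgeLin_smul_right (c : ℂ) (D : Vec n →L[ℝ] ℂ) (ζ : Alt n k) :
    wedgeLin D (c • ζ) = c • wedgeLin D ζ := by
  ext v
  simp only [wedgeLin_apply, ContinuousAlternatingMap.smul_apply, smul_eq_mul, Finset.mul_sum]
  exact Finset.sum_congr rfl fun i _ => by ring

theorem norm_wedgeLin_le (D : Vec n →L[ℝ] ℂ) (ζ : Alt n k) :
    ‖wedgeLin D ζ‖ ≤ (k + 1) * ‖D‖ * ‖ζ‖ := by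
  refine (ContinuousAlternatingMap.norm_alternatizeUncurryFin_le _).trans ?_
  rw [mul_assoc]
  gcongr
  refine ContinuousLinearMap.opNorm_le_bound _ (by positivity) fun v => ?_
  rw [ContinuousLinearMap.smulRight_apply, norm_smul, mul_right_comm]
  gcongr
  exact D.le_opNorm v

/-- `wedgeLin` as a continuous bilinear map. -/
def wedgeLinL (n k : ℕ) : (Vec n →L[ℝ] ℂ) →L[ℝ] Alt n k →L[ℝ] Alt n (k + 1) :=
  LinearMap.mkContinuous₂
    (LinearMap.mk₂ ℝ wedgeLin wedgeLin_add_left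
      (fun c D ζ => by simpa using wedgeLin_smul_left (c : ℂ) D ζ) wedgeLin_add_right
      (fun c D ζ => by simpa using wedgeLin_smul_right (c : ℂ) D ζ))
    (k + 1) norm_wedgeLin_le

@[simp] theorem wedgeLinL_apply (D : Vec n →L[ℝ] ℂ) (ζ : Alt n k) :
    wedgeLinL n k D ζ = wedgeLin D ζ := rfl

/-- The alternatization of `F` and that of `F` with the two arguments exchanged are opposite. -/
theorem alternatize_alternatize_swap {F F' : Vec n →L[ℝ] Vec n →L[ℝ] Alt n k}
    (h : ∀ v w, F' v w = F w v) :
    ContinuousAlternatingMap.alternatizeUncurryFin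
        ((ContinuousAlternatingMap.alternatizeUncurryFinCLM ℝ (Vec n) ℂ).comp F') =
      -ContinuousAlternatingMap.alternatizeUncurryFin
        ((ContinuousAlternatingMap.alternatizeUncurryFinCLM ℝ (Vec n) ℂ).comp F) := by
  rw [eq_neg_iff_add_eq_zero, ← ContinuousAlternatingMap.alternatizeUncurryFin_add,
    ← ContinuousLinearMap.comp_add]
  refine ContinuousAlternatingMap.alternatizeUncurryFin_alternatizeUncurryFinCLM_comp_of_symmetric
    fun v w => ?_
  simp [h, add_comm]

/-- The derivative part of the Leibniz rule: moving the differentiation past a `1`-form `a` changes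
the sign. -/
theorem alternatize_wedgeLinL (a : Vec n →L[ℝ] ℂ) (D : Vec n →L[ℝ] Alt n k) :
    ContinuousAlternatingMap.alternatizeUncurryFin ((wedgeLinL n k a).comp D) =
      -wedgeLin a (ContinuousAlternatingMap.alternatizeUncurryFin D) := by
  let F' : Vec n →L[ℝ] Vec n →L[ℝ] Alt n k :=
    (ContinuousLinearMap.compL ℝ (Vec n) ℂ (Alt n k)).flip a ∘L
      (ContinuousLinearMap.lsmul ℝ ℂ).flip ∘L D
  let F : Vec n →L[ℝ] Vec n →L[ℝ] Alt n k :=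
    (ContinuousLinearMap.compL ℝ (Vec n) (Alt n k) (Alt n k)).flip D ∘L
      (ContinuousLinearMap.lsmul ℝ ℂ) ∘L a
  have h := alternatize_alternatize_swap (F := F) (F' := F') fun v w => by simp [F, F']
  have e1 : (wedgeLinL n k a).comp D =
      (ContinuousAlternatingMap.alternatizeUncurryFinCLM ℝ (Vec n) ℂ).comp F' := by
    ext1 v
    change wedgeLin a (D v) = ContinuousAlternatingMap.alternatizeUncurryFin (F' v)
    rw [wedgeLin]
    congr 1
  have e2 : wedgeLin a (ContinuousAlternatingMap.alternatizeUncurryFin D) =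
      ContinuousAlternatingMap.alternatizeUncurryFin
        ((ContinuousAlternatingMap.alternatizeUncurryFinCLM ℝ (Vec n) ℂ).comp F) := by
    rw [wedgeLin]
    congr 1
    ext1 v
    change a v • ContinuousAlternatingMap.alternatizeUncurryFin D =
      ContinuousAlternatingMap.alternatizeUncurryFin (F v)
    rw [← ContinuousAlternatingMap.alternatizeUncurryFin_smul]
    congr 1
  rw [e1, e2, h]

/-- The term of the Leibniz rule with the derivative `B` of the `1`-form vanishes if `B` is
symmetric. -/
theorem alternatize_wedgeLinL_flip_of_symmetric {B : Vec n →L[ℝ] Vec n →L[ℝ] ℂ}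
    (hB : ∀ v w, B v w = B w v) (ζ : Alt n k) :
    ContinuousAlternatingMap.alternatizeUncurryFin (((wedgeLinL n k).flip ζ).comp B) = 0 := by
  let F : Vec n →L[ℝ] Vec n →L[ℝ] Alt n k :=
    (ContinuousLinearMap.compL ℝ (Vec n) ℂ (Alt n k) ((ContinuousLinearMap.lsmul ℝ ℂ).flip ζ)) ∘L B
  have h :=
    ContinuousAlternatingMap.alternatizeUncurryFin_alternatizeUncurryFinCLM_comp_of_symmetric
      (f := F) fun v w => by simp [F, hB v w]
  rw [← h]
  congr 1

/-- The alternatization of the derivative `B` of a `1`-form is its differential `α`, which appears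
as a factor in the Leibniz rule. -/
theorem alternatize_wedgeLinL_flip (B : Vec n →L[ℝ] Vec n →L[ℝ] ℂ) (ζ α : Alt n 2)
    (hα : ∀ v w, α ![v, w] = B v w - B w v) :
    ContinuousAlternatingMap.alternatizeUncurryFin (((wedgeLinL n 2).flip ζ).comp B) =
      (wedge α ζ : Alt n 4) := by
  ext v
  let F : Vec n →L[ℝ] Vec n →L[ℝ] Alt n 2 :=
    (ContinuousLinearMap.compL ℝ (Vec n) ℂ (Alt n 2) ((ContinuousLinearMap.lsmul ℝ ℂ).flip ζ)) ∘L B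
  have h := ContinuousAlternatingMap.alternatizeUncurryFin_alternatizeUncurryFinCLM_comp_apply F v
  refine Eq.trans ?_ (h.trans ?_)
  · congr 1
  rw [wedge_two_two_apply]
  have i0 : Finset.Ici (0 : Fin 3) = {0, 1, 2} := by decide
  have i1 : Finset.Ici (1 : Fin 3) = {1, 2} := by decide
  have i2 : Finset.Ici (2 : Fin 3) = {2} := by decide
  refine (Fin.sum_univ_three _).trans ?_
  rw [i0, i1, i2, Finset.sum_insert (by decide), Finset.sum_insert (by decide),
    Finset.sum_singleton, Finset.sum_insert (by decide), Finset.sum_singleton,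
    Finset.sum_singleton]
  have r : ∀ (i j : Fin 3) (w : Fin 2 → Vec n),
      (∀ k, j.removeNth (i.castSucc.removeNth v) k = w k) →
        j.removeNth (i.castSucc.removeNth v) = w := fun i j w h => funext h
  rw [r 0 0 ![v 2, v 3] (by intro k; fin_cases k <;> rfl),
    r 0 1 ![v 1, v 3] (by intro k; fin_cases k <;> rfl),
    r 0 2 ![v 1, v 2] (by intro k; fin_cases k <;> rfl),
    r 1 1 ![v 0, v 3] (by intro k; fin_cases k <;> rfl),
    r 1 2 ![v 0, v 2] (by intro k; fin_cases k <;> rfl),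
    r 2 2 ![v 0, v 1] (by intro k; fin_cases k <;> rfl)]
  simp [hα, F]
  ring

/-! ### Forms of extreme type in complex dimension two -/

/-- The real basis `e_j, i e_j` of `ℂⁿ`. -/
def realBasis (n : ℕ) : Module.Basis (Fin 2 × Fin n) ℝ (Vec n) :=
  Complex.basisOneI.smulTower (Pi.basisFun ℂ (Fin n))

theorem realBasis_one (n : ℕ) (j : Fin n) : realBasis n (1, j) = I • realBasis n (0, j) := by
  simp [realBasis, Module.Basis.smulTower_apply]

theorem map_swap_first (ω : Alt n (k + 2)) (x y : Vec n) (u : Fin k → Vec n) :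
    ω (Matrix.vecCons y (Matrix.vecCons x u)) = -ω (Matrix.vecCons x (Matrix.vecCons y u)) := by
  have h := ω.map_swap (Matrix.vecCons x (Matrix.vecCons y u)) (show (0 : Fin (k + 2)) ≠ 1 by simp)
  refine Eq.trans ?_ h
  change ω _ = ω _
  congr 1
  ext i
  refine Fin.cases ?_ (fun i => ?_) i
  · simp
  · refine Fin.cases ?_ (fun i => ?_) i
    · simp
    · rw [Function.comp_apply, Equiv.swap_apply_of_ne_of_ne] <;> simp [Fin.ext_iff]

theorem map_eq_zero_first (ω : Alt n (k + 2)) (x : Vec n) (u : Fin k → Vec n) :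
    ω (Matrix.vecCons x (Matrix.vecCons x u)) = 0 :=
  self_eq_neg.1 (map_swap_first ω x x u)

theorem map_comp_perm (ω : Alt n k) (v : Fin k → Vec n) (σ : Equiv.Perm (Fin k)) :
    ω (v ∘ σ) = Equiv.Perm.sign σ • ω v :=
  ω.map_perm v σ

theorem map_rotate_three (ω : Alt n 3) (x y z : Vec n) : ω ![z, x, y] = ω ![x, y, z] := by
  have h := map_comp_perm ω ![x, y, z] (finRotate 3).symm
  have e : ![x, y, z] ∘ (finRotate 3).symm = ![z, x, y] := by
    ext i
    fin_cases i <;> rfl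
  rw [e] at h
  have hs : Equiv.Perm.sign (finRotate 3).symm = 1 := by decide
  rw [hs, one_smul] at h
  exact h

/-- A form of type `(3, 0)` or `(0, 3)` vanishes on `(v, iv, w)`: the values of the weight at `c =
i` and at `c = 1 + i` are incompatible with a nonzero value. -/
theorem map_pair_eq_zero_of_type_three {ω : Alt n 3} {a b : ℕ}
    (hab : (a = 3 ∧ b = 0) ∨ (a = 0 ∧ b = 3))
    (h : ∀ (c : ℂ) (v : Fin 3 → Vec n),
      ω (fun i => c • v i) = c ^ a * (starRingEnd ℂ c) ^ b * ω v) (v w : Vec n) :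
    ω ![v, I • v, w] = 0 := by
  have add1 : ∀ x x' y z, ω ![x + x', y, z] = ω ![x, y, z] + ω ![x', y, z] :=
    fun x x' y z => ω.vecCons_add _ _ _
  have add3 : ∀ x y z z', ω ![x, y, z + z'] = ω ![x, y, z] + ω ![x, y, z'] := by
    intro x y z z'
    simp only [← map_rotate_three ω x y, add1]
  have sw : ∀ x y z, ω ![y, x, z] = -ω ![x, y, z] := fun x y z => map_swap_first ω x y ![z]
  have add2 : ∀ x y y' z, ω ![x, y + y', z] = ω ![x, y, z] + ω ![x, y', z] := by
    intro x y y' z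
    rw [sw, add1, sw y, sw y']
    ring
  have neg2 : ∀ x y z, ω ![x, -y, z] = -ω ![x, y, z] := by
    intro x y z
    have h0 := add2 x y (-y) z
    rw [add_neg_cancel] at h0
    have h00 := add2 x 0 0 z
    rw [add_zero] at h00
    linear_combination -h0 - h00
  have h1 := h I ![v, I • v, w]
  have h2 := h (1 + I) ![v, I • v, w]
  have e1 : (fun i => I • ![v, I • v, w] i) = ![I • v, -v, I • w] := by
    ext i j
    fin_cases i <;> simp [← mul_assoc]
  have e2 : (fun i => (1 + I) • ![v, I • v, w] i) = ![v + I • v, I • v + -v, w + I • w] := by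
    ext i j
    fin_cases i <;> simp [← mul_assoc, add_mul]
  rw [e1, neg2, sw v, neg_neg] at h1
  have z : ∀ x y, ω ![x, x, y] = 0 := fun x y => map_eq_zero_first ω x ![y]
  rw [e2, add1, add2, add2, neg2, neg2, z, z, sw v] at h2
  simp only [add3] at h2
  rw [h1] at h2
  rcases hab with ⟨rfl, rfl⟩ | ⟨rfl, rfl⟩
  · simp only [pow_zero, mul_one] at h2
    have e3 : I ^ 3 = -I := by rw [pow_succ, I_sq]; ring
    have e4 : (1 + I) ^ 3 = -2 + 2 * I := by ring_nf; rw [e3, I_sq]; ring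
    rw [e3, e4] at h2
    have : (4 - 4 * I) * ω ![v, I • v, w] = 0 := by linear_combination h2
    refine (mul_eq_zero.1 this).resolve_left fun h0 => ?_
    simpa using congrArg re h0
  · simp only [map_add, map_one, conj_I, pow_zero, one_mul] at h2
    have e3 : I ^ 3 = -I := by rw [pow_succ, I_sq]; ring
    have e5 : (-I) ^ 3 = I := by rw [neg_pow, e3]; ring
    have e4 : (1 + -I) ^ 3 = -2 - 2 * I := by ring_nf; rw [e3, I_sq]; ring
    rw [e5, e4] at h2
    have : (4 + 4 * I) * ω ![v, I • v, w] = 0 := by linear_combination h2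
    refine (mul_eq_zero.1 this).resolve_left fun h0 => ?_
    simpa using congrArg re h0

/-- In complex dimension two there are no forms of type `(3, 0)` or `(0, 3)`. -/
theorem eq_zero_of_type_three {ω : Alt 2 3} {a b : ℕ} (hab : (a = 3 ∧ b = 0) ∨ (a = 0 ∧ b = 3))
    (h : ∀ (c : ℂ) (v : Fin 3 → Vec 2),
      ω (fun i => c • v i) = c ^ a * (starRingEnd ℂ c) ^ b * ω v) : ω = 0 := by
  have hz : ω.toAlternatingMap = 0 := by
    refine Module.Basis.ext_alternating (realBasis 2) fun v hv => ?_
    -- two of the three basis vectors span a complex line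
    obtain ⟨i, j, hij, hf⟩ := Fintype.exists_ne_map_eq_of_card_lt (fun i => (v i).2)
      (by simp : Fintype.card (Fin 2) < Fintype.card (Fin 3))
    have hne : (v i).1 ≠ (v j).1 := fun h1 => hij (hv (Prod.ext h1 hf))
    wlog hi : (v i).1 = 0 generalizing i j
    · refine this j i hij.symm hf.symm hne.symm ?_
      omega
    have hj : (v j).1 = 1 := by omega
    obtain ⟨σ, hσ0, hσ1⟩ : ∃ σ : Equiv.Perm (Fin 3), σ 0 = i ∧ σ 1 = j := by
      clear hf hne hi hj
      revert i j
      decide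
    have hp := map_comp_perm ω (fun i => realBasis 2 (v i)) σ
    have e : (fun i => realBasis 2 (v i)) ∘ σ =
        ![realBasis 2 (v i), I • realBasis 2 (v i), realBasis 2 (v (σ 2))] := by
      ext1 l
      fin_cases l
      · simp [hσ0]
      · simp only [Function.comp_apply, Fin.mk_one, hσ1, Matrix.cons_val_one, Matrix.cons_val_zero]
        rw [← Prod.mk.eta (p := v i), ← Prod.mk.eta (p := v j), hi, hj, realBasis_one, hf]
      · rfl
    rw [e, map_pair_eq_zero_of_type_three hab h] at hp
    rcases Int.units_eq_one_or (Equiv.Perm.sign σ) with hs | hs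
    · rw [hs, one_smul] at hp
      exact hp.symm
    · rw [hs, Units.neg_smul, one_smul] at hp
      exact neg_eq_zero.1 hp.symm
  ext v
  exact congrArg (fun f => f v) hz

/-- In complex dimension two the forms of degree four are of type `(2, 2)`. -/
theorem eq_zero_of_type_four {ω : Alt 2 4} {a b : ℕ} (hab : (a = 3 ∧ b = 1) ∨ (a = 1 ∧ b = 3))
    (h : ∀ (c : ℂ) (v : Fin 4 → Vec 2),
      ω (fun i => c • v i) = c ^ a * (starRingEnd ℂ c) ^ b * ω v) : ω = 0 := by
  have key : ∀ v w : Vec 2, ω ![v, I • v, w, I • w] = 0 := by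
    intro v w
    have h1 := h I ![v, I • v, w, I • w]
    have e1 : (fun i => I • ![v, I • v, w, I • w] i) =
        ![I • v, (-1 : ℝ) • v, I • w, (-1 : ℝ) • w] := by
      ext i j
      fin_cases i <;> simp [← mul_assoc]
    have e2 : I ^ a * (starRingEnd ℂ I) ^ b = -1 := by
      rcases hab with ⟨rfl, rfl⟩ | ⟨rfl, rfl⟩ <;> simp [pow_succ]
    -- multiplication by `I` preserves the orientation and the volume
    have e3 : ω ![I • v, (-1 : ℝ) • v, I • w, (-1 : ℝ) • w] = ω ![v, I • v, w, I • w] := by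
      have hp := map_comp_perm ω ![I • v, v, I • w, w] (Equiv.swap 0 1 * Equiv.swap 2 3)
      have e4 : ![I • v, v, I • w, w] ∘ (Equiv.swap 0 1 * Equiv.swap 2 3 : Equiv.Perm (Fin 4)) =
          ![v, I • v, w, I • w] := by
        ext1 l
        fin_cases l <;> rfl
      have hs : Equiv.Perm.sign (Equiv.swap 0 1 * Equiv.swap 2 3 : Equiv.Perm (Fin 4)) = 1 := by
        decide
      rw [e4, hs, one_smul] at hp
      rw [hp]
      have hm := ω.toMultilinearMap.map_smul_univ (![1, -1, 1, -1] : Fin 4 → ℝ)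
        ![I • v, v, I • w, w]
      have e5 : (fun i => (![1, -1, 1, -1] : Fin 4 → ℝ) i • ![I • v, v, I • w, w] i) =
          ![I • v, (-1 : ℝ) • v, I • w, (-1 : ℝ) • w] := by
        ext1 l
        fin_cases l <;> simp
      rw [e5] at hm
      refine hm.trans ?_
      simp [Fin.prod_univ_four]
    rw [e1, e2, e3] at h1
    linear_combination (1 / 2 : ℂ) * h1
  have hz : ω.toAlternatingMap = 0 := by
    refine Module.Basis.ext_alternating (realBasis 2) fun v hv => ?_
    let s : Fin 4 → Fin 2 × Fin 2 := ![(0, 0), (1, 0), (0, 1), (1, 1)]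
    have hs : Function.Bijective s := by decide
    have hvb : Function.Bijective v :=
      (Fintype.bijective_iff_injective_and_card v).2 ⟨hv, by simp⟩
    let σ : Equiv.Perm (Fin 4) := (Equiv.ofBijective s hs).trans (Equiv.ofBijective v hvb).symm
    have hσ : ∀ i, v (σ i) = s i := fun i => Equiv.ofBijective_apply_symm_apply v hvb (s i)
    have hp := map_comp_perm ω (fun i => realBasis 2 (v i)) σ
    have e : (fun i => realBasis 2 (v i)) ∘ σ =
        ![realBasis 2 (0, 0), I • realBasis 2 (0, 0), realBasis 2 (0, 1),
          I • realBasis 2 (0, 1)] := by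
      ext1 l
      rw [Function.comp_apply, hσ]
      fin_cases l <;> simp [s, realBasis_one]
    rw [e, key] at hp
    rcases Int.units_eq_one_or (Equiv.Perm.sign σ) with hs | hs
    · rw [hs, one_smul] at hp
      exact hp.symm
    · rw [hs, Units.neg_smul, one_smul] at hp
      exact neg_eq_zero.1 hp.symm
  ext v
  exact congrArg (fun f => f v) hz

end

section

variable {q : ℂˣ} {n k : ℕ}

/-! ### The operators `∂` and `∂̄` at a point -/

section Part

variable {F : Type*} [NormedAddCommGroup F] [NormedSpace ℂ F]

/-- The complex linear part of a real linear map for `ε = -1`, the antilinear part for `ε = 1`. -/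
def part (ε : ℂ) (D : Vec n →L[ℝ] F) : Vec n →L[ℝ] F :=
  (1 / 2 : ℂ) • (D + (ε * I) • D.comp (scal n I))

theorem part_apply (ε : ℂ) (D : Vec n →L[ℝ] F) (v : Vec n) :
    part ε D v = (1 / 2 : ℂ) • (D v + (ε * I) • D (I • v)) := rfl

theorem linPart_eq_part (D : Vec n →L[ℝ] F) : linPart D = part (-1) D := by
  ext1 v
  simp only [linPart, part, smul_apply, sub_apply, add_apply]
  module

theorem antiPart_eq_part (D : Vec n →L[ℝ] F) : antiPart D = part 1 D := by
  rw [antiPart, part, one_mul]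

theorem part_add (ε : ℂ) (D D' : Vec n →L[ℝ] F) : part ε (D + D') = part ε D + part ε D' := by
  ext1 v
  simp only [part_apply, add_apply]
  module

theorem part_sub (ε : ℂ) (D D' : Vec n →L[ℝ] F) : part ε (D - D') = part ε D - part ε D' := by
  ext1 v
  simp only [part_apply, sub_apply]
  module

theorem part_smul (ε c : ℂ) (D : Vec n →L[ℝ] F) : part ε (c • D) = c • part ε D := by
  ext1 v
  simp only [part_apply, smul_apply]
  module

theorem contDiffOn_part {ε : ℂ} {D : Vec n → Vec n →L[ℝ] F} {s : Set (Vec n)} {m : WithTop ℕ∞}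
    (h : ContDiffOn ℝ m D s) : ContDiffOn ℝ m (fun p => part ε (D p)) s :=
  (h.add ((h.clm_comp contDiffOn_const).const_smul (ε * I))).const_smul (1 / 2 : ℂ)

theorem hasFDerivAt_part {ε : ℂ} {D : Vec n → Vec n →L[ℝ] F}
    {D' : Vec n →L[ℝ] Vec n →L[ℝ] F} {p : Vec n} (h : HasFDerivAt D D' p) :
    HasFDerivAt (fun p => part ε (D p))
      ((1 / 2 : ℂ) • (D' + (ε * I) •
        ((ContinuousLinearMap.compL ℝ (Vec n) (Vec n) F).flip (scal n I)).comp D')) p := by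
  have h2 : HasFDerivAt (fun p => (D p).comp (scal n I))
      (((ContinuousLinearMap.compL ℝ (Vec n) (Vec n) F).flip (scal n I)).comp D') p :=
    ((ContinuousLinearMap.compL ℝ (Vec n) (Vec n) F).flip (scal n I)).hasFDerivAt.comp p h
  exact (h.add (h2.const_smul (ε * I))).const_smul (1 / 2 : ℂ)

end Part

/-- The operator `∂` for `ε = -1` and the operator `∂̄` for `ε = 1`. -/
def dop (ε : ℂ) (ω : Vec n → Alt n k) (p : Vec n) : Alt n (k + 1) :=
  .alternatizeUncurryFin (part ε (fderiv ℝ ω p))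

theorem del_eq_dop (ω : Vec n → Alt n k) : del ω = dop (-1) ω := by
  funext p
  rw [del, dop, linPart_eq_part]

theorem delbar_eq_dop (ω : Vec n → Alt n k) : delbar ω = dop 1 ω := by
  funext p
  rw [delbar, dop, antiPart_eq_part]

theorem dop_congr {ε : ℂ} {ω ω' : Vec n → Alt n k} {p : Vec n} (h : ω =ᶠ[nhds p] ω') :
    dop ε ω p = dop ε ω' p := by
  rw [dop, dop, h.fderiv_eq]

/-- The Leibniz rule for the product of a function and a form. -/
theorem dop_smul {ε : ℂ} {f : Vec n → ℂ} {ζ : Vec n → Alt n k} {p : Vec n}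
    (hf : DifferentiableAt ℝ f p) (hζ : DifferentiableAt ℝ ζ p) :
    dop ε (fun x => f x • ζ x) p = wedgeLin (part ε (fderiv ℝ f p)) (ζ p) + f p • dop ε ζ p := by
  have h : fderiv ℝ (fun x => f x • ζ x) p = _ := (hf.hasFDerivAt.smul hζ.hasFDerivAt).fderiv
  rw [dop, h, wedgeLin, dop, ← ContinuousAlternatingMap.alternatizeUncurryFin_smul,
    ← ContinuousAlternatingMap.alternatizeUncurryFin_add]
  congr 1
  ext1 v
  simp only [part_apply, add_apply, smul_apply, ContinuousLinearMap.smulRight_apply]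
  module

theorem hasFDerivAt_wedgeLin {a : Vec n → Vec n →L[ℝ] ℂ} {ζ : Vec n → Alt n k} {p : Vec n}
    (ha : DifferentiableAt ℝ a p) (hζ : DifferentiableAt ℝ ζ p) :
    HasFDerivAt (fun x => wedgeLin (a x) (ζ x))
      ((wedgeLinL n k (a p)).comp (fderiv ℝ ζ p) +
        ((wedgeLinL n k).flip (ζ p)).comp (fderiv ℝ a p)) p := by
  refine ((wedgeLinL n k).hasFDerivAt_of_bilinear ha.hasFDerivAt hζ.hasFDerivAt).congr_fderiv ?_
  ext1 v
  simp

/-- The Leibniz rule for the exterior product of a `1`-form and a form. -/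
theorem dop_wedgeLin {ε : ℂ} {a : Vec n → Vec n →L[ℝ] ℂ} {ζ : Vec n → Alt n k} {p : Vec n}
    (ha : DifferentiableAt ℝ a p) (hζ : DifferentiableAt ℝ ζ p) :
    dop ε (fun x => wedgeLin (a x) (ζ x)) p =
      ContinuousAlternatingMap.alternatizeUncurryFin
        (((wedgeLinL n k).flip (ζ p)).comp (part ε (fderiv ℝ a p))) -
      wedgeLin (a p) (dop ε ζ p) := by
  rw [dop, (hasFDerivAt_wedgeLin ha hζ).fderiv, dop, sub_eq_add_neg, ← alternatize_wedgeLinL,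
    ← ContinuousAlternatingMap.alternatizeUncurryFin_add]
  congr 1
  ext1 v
  simp only [part_apply, add_apply, ContinuousLinearMap.comp_apply, wedgeLinL_apply,
    ContinuousLinearMap.flip_apply]
  have e1 : ∀ x y : Alt n k, ∀ c : ℂ, wedgeLin (a p) ((1 / 2 : ℂ) • (x + c • y)) =
      (1 / 2 : ℂ) • (wedgeLin (a p) x + c • wedgeLin (a p) y) := fun x y c => by
    simp only [wedgeLin_add_right, wedgeLin_smul_right]
  have e2 : ∀ x y : Vec n →L[ℝ] ℂ, ∀ c : ℂ, wedgeLin ((1 / 2 : ℂ) • (x + c • y)) (ζ p) =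
      (1 / 2 : ℂ) • (wedgeLin x (ζ p) + c • wedgeLin y (ζ p)) := fun x y c => by
    simp only [wedgeLin_add_left, wedgeLin_smul_left]
  rw [e1, e2]
  module

/-- The operators `∂` and `∂̄` anticommute and have square zero: all these relations are the
symmetry of the second derivative. -/
theorem dop_dop_add {ε ε' : ℂ} {ω : Vec n → Alt n k} {p : Vec n} (hω : ContDiffAt ℝ 2 ω p) :
    dop ε (dop ε' ω) p + dop ε' (dop ε ω) p = 0 := by
  have hd : DifferentiableAt ℝ (fderiv ℝ ω) p :=
    (hω.fderiv_right (m := 1) (by norm_num)).differentiableAt (by norm_num)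
  have hs : IsSymmSndFDerivAt ℝ ω p := hω.isSymmSndFDerivAt (by simp)
  set H := fderiv ℝ (fderiv ℝ ω) p with hH
  let Q : ℂ → Vec n →L[ℝ] Vec n →L[ℝ] Alt n k := fun ε =>
    (1 / 2 : ℂ) • (H + (ε * I) •
        ((ContinuousLinearMap.compL ℝ (Vec n) (Vec n) (Alt n k)).flip (scal n I)).comp H)
  have e : ∀ ε ε' : ℂ, dop ε (dop ε' ω) p = ContinuousAlternatingMap.alternatizeUncurryFin
      ((ContinuousAlternatingMap.alternatizeUncurryFinCLM ℝ (Vec n) ℂ).comp (part ε (Q ε'))) := by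
    intro ε ε'
    have h1 : HasFDerivAt (dop ε' ω)
        ((ContinuousAlternatingMap.alternatizeUncurryFinCLM ℝ (Vec n) ℂ).comp (Q ε')) p :=
      (ContinuousAlternatingMap.alternatizeUncurryFinCLM ℝ (Vec n) ℂ).hasFDerivAt.comp p
        (hasFDerivAt_part hd.hasFDerivAt)
    rw [dop, h1.fderiv]
    congr 1
    ext1 v
    simp only [part_apply, ContinuousLinearMap.comp_apply,
      ContinuousAlternatingMap.alternatizeUncurryFinCLM_apply,
      ContinuousAlternatingMap.alternatizeUncurryFin_smul,
      ContinuousAlternatingMap.alternatizeUncurryFin_add]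
  rw [e, e, ← ContinuousAlternatingMap.alternatizeUncurryFin_add, ← ContinuousLinearMap.comp_add]
  refine ContinuousAlternatingMap.alternatizeUncurryFin_alternatizeUncurryFinCLM_comp_of_symmetric
    fun v w => ?_
  have hs' : ∀ v w, H v w = H w v := fun v w => hs.eq v w
  have hQ : ∀ ε v w, Q ε v w = (1 / 2 : ℂ) • (H v w + (ε * I) • H v (I • w)) := fun _ _ _ => rfl
  simp only [add_apply, part_apply, smul_apply, hQ]
  rw [hs' w v, hs' w (I • v), hs' (I • w) v, hs' (I • w) (I • v)]
  module

theorem dop_dop_self {ε : ℂ} {ω : Vec n → Alt n k} {p : Vec n} (hω : ContDiffAt ℝ 2 ω p) :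
    dop ε (dop ε ω) p = 0 := by
  have h := dop_dop_add (ε := ε) (ε' := ε) hω
  rw [← two_smul ℂ] at h
  exact (smul_eq_zero.1 h).resolve_left two_ne_zero

/-! ### Forms of degree zero and one, and types -/

theorem hasFDerivAt_val {ω : Vec n → Alt n 0} {ω' : Vec n →L[ℝ] Alt n 0} {p : Vec n}
    (h : HasFDerivAt ω ω' p) :
    HasFDerivAt (val ω)
      ((ContinuousAlternatingMap.constOfIsEmptyLIE ℝ (Vec n) ℂ
        (Fin 0)).symm.toContinuousLinearEquiv.toContinuousLinearMap.comp ω') p := by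
  have := (ContinuousAlternatingMap.constOfIsEmptyLIE ℝ (Vec n) ℂ
    (Fin 0)).symm.toContinuousLinearEquiv.toContinuousLinearMap.hasFDerivAt.comp p h
  refine this.congr_of_eventuallyEq (Filter.Eventually.of_forall fun x => ?_)
  change ω x ![] = ω x 0
  congr 1
  exact Subsingleton.elim _ _

/-- On functions, `∂` and `∂̄` are the complex linear and the antilinear part of the derivative. -/
theorem toLin_dop {ε : ℂ} {ω : Vec n → Alt n 0} {p : Vec n} (h : DifferentiableAt ℝ ω p) :
    toLin (dop ε ω p) = part ε (fderiv ℝ (val ω) p) := by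
  ext1 v
  rw [(hasFDerivAt_val h.hasFDerivAt).fderiv, toLin_apply, dop,
    ContinuousAlternatingMap.alternatizeUncurryFin_apply]
  simp only [part_apply]
  simp
  ring

/-- `α` is of type `(a, b)`. -/
def IsType (a b : ℕ) (α : Alt n k) : Prop :=
  ∀ (c : ℂ) (v : Fin k → Vec n), α (fun i => c • v i) = c ^ a * (starRingEnd ℂ c) ^ b * α v

theorem isType_wedgeLin {a b a' b' : ℕ} {α : Alt n 1} {ζ : Alt n k} (hα : IsType a b α)
    (hζ : IsType a' b' ζ) : IsType (a + a') (b + b') (wedgeLin (toLin α) ζ) := by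
  intro c v
  rw [wedgeLin_apply, wedgeLin_apply, Finset.mul_sum]
  refine Finset.sum_congr rfl fun i _ => ?_
  have h1 : toLin α (c • v i) = c ^ a * (starRingEnd ℂ c) ^ b * toLin α (v i) := by
    rw [toLin_apply, toLin_apply, ← hα c ![v i]]
    congr 1
    ext j
    fin_cases j
    rfl
  have h2 := hζ c (i.removeNth v)
  have e : i.removeNth (fun j => c • v j) = fun j => c • i.removeNth v j := rfl
  rw [h1, e, h2]
  ring

theorem IsType.smul {a b : ℕ} {ζ : Alt n k} (hζ : IsType a b ζ) (r : ℂ) : IsType a b (r • ζ) := by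
  intro c v
  simp only [ContinuousAlternatingMap.smul_apply, hζ c v, smul_eq_mul]
  ring

section PartSmul
variable {F : Type*} [NormedAddCommGroup F] [NormedSpace ℂ F]

theorem part_neg_one_smul (D : Vec n →L[ℝ] F) (c : ℂ) (v : Vec n) :
    part (-1) D (c • v) = c • part (-1) D v := by
  have h : ∀ w : Vec n, D (c • w) = c.re • D w + c.im • D (I • w) := by
    intro w
    rw [← map_smul, ← map_smul, ← map_add]
    congr 1
    rw [← coe_smul, ← coe_smul, smul_smul, ← add_smul, re_add_im]
  have e : I • I • v = -v := by rw [smul_smul, I_mul_I, neg_one_smul]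
  simp only [part_apply]
  rw [smul_comm I c, h, h, e, map_neg]
  nth_rewrite 5 [← re_add_im c]
  simp only [← coe_smul]
  match_scalars
  · ring
  · linear_combination (1 / 2 * c.im : ℂ) * I_sq

theorem part_one_smul (D : Vec n →L[ℝ] F) (c : ℂ) (v : Vec n) :
    part 1 D (c • v) = starRingEnd ℂ c • part 1 D v := by
  have h : ∀ w : Vec n, D (c • w) = c.re • D w + c.im • D (I • w) := by
    intro w
    rw [← map_smul, ← map_smul, ← map_add]
    congr 1
    rw [← coe_smul, ← coe_smul, smul_smul, ← add_smul, re_add_im]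
  have e : I • I • v = -v := by rw [smul_smul, I_mul_I, neg_one_smul]
  have hc : starRingEnd ℂ c = c.re - c.im * I := by
    apply Complex.ext <;> simp
  simp only [part_apply]
  rw [smul_comm I c, h, h, e, map_neg, hc]
  simp only [← coe_smul]
  match_scalars
  · ring
  · linear_combination (1 / 2 * c.im : ℂ) * I_sq

end PartSmul

theorem isType_fderiv {a b : ℕ} {ω : Vec n → Alt n k} {p : Vec n} (hd : DifferentiableAt ℝ ω p)
    (h : ∀ x, IsType a b (ω x)) (w : Vec n) : IsType a b (fderiv ℝ ω p w) := by
  intro c v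
  have e : ∀ u : Fin k → Vec n, fderiv ℝ ω p w u = fderiv ℝ (fun x => ω x u) p w := fun u => by
    rw [fderiv_continuousAlternatingMap_apply_const_apply hd]
  rw [e, e]
  simp only [h _ c v]
  rw [fderiv_const_mul]
  · rfl
  · exact hd.continuousAlternatingMap_apply fun i => differentiableAt_const _

theorem isType_dop_neg_one {a b : ℕ} {ω : Vec n → Alt n k} {p : Vec n}
    (hd : DifferentiableAt ℝ ω p) (h : ∀ x, IsType a b (ω x)) :
    IsType (a + 1) b (dop (-1) ω p) := by
  intro c v
  rw [dop, ContinuousAlternatingMap.alternatizeUncurryFin_apply,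
    ContinuousAlternatingMap.alternatizeUncurryFin_apply, Finset.mul_sum]
  refine Finset.sum_congr rfl fun i _ => ?_
  have e : i.removeNth (fun j => c • v j) = fun j => c • i.removeNth v j := rfl
  have h2 : ∀ u, IsType a b (part (-1) (fderiv ℝ ω p) u) := by
    intro u c v
    have h3 := isType_fderiv hd h u c v
    have h4 := isType_fderiv hd h (I • u) c v
    simp only [part_apply, ContinuousAlternatingMap.smul_apply,
      ContinuousAlternatingMap.add_apply, h3, h4, smul_eq_mul]
    ring
  rw [part_neg_one_smul, ContinuousAlternatingMap.smul_apply, e, h2, smul_eq_mul, zsmul_eq_mul,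
    zsmul_eq_mul]
  ring

theorem isType_dop_one {a b : ℕ} {ω : Vec n → Alt n k} {p : Vec n}
    (hd : DifferentiableAt ℝ ω p) (h : ∀ x, IsType a b (ω x)) :
    IsType a (b + 1) (dop 1 ω p) := by
  intro c v
  rw [dop, ContinuousAlternatingMap.alternatizeUncurryFin_apply,
    ContinuousAlternatingMap.alternatizeUncurryFin_apply, Finset.mul_sum]
  refine Finset.sum_congr rfl fun i _ => ?_
  have e : i.removeNth (fun j => c • v j) = fun j => c • i.removeNth v j := rfl
  have h2 : ∀ u, IsType a b (part 1 (fderiv ℝ ω p) u) := by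
    intro u c v
    have h3 := isType_fderiv hd h u c v
    have h4 := isType_fderiv hd h (I • u) c v
    simp only [part_apply, ContinuousAlternatingMap.smul_apply,
      ContinuousAlternatingMap.add_apply, h3, h4, smul_eq_mul]
    ring
  rw [part_one_smul, ContinuousAlternatingMap.smul_apply, e, h2, smul_eq_mul, zsmul_eq_mul,
    zsmul_eq_mul]
  ring

/-- `toLin` as a continuous linear map. -/
def toLinL (n : ℕ) : Alt n 1 →L[ℝ] Vec n →L[ℝ] ℂ :=
  (ContinuousAlternatingMap.ofSubsingletonLIE (𝕜 := ℝ) (E := Vec n) (F := ℂ)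
    (0 : Fin 1)).symm.toContinuousLinearEquiv.toContinuousLinearMap

@[simp] theorem toLinL_apply (α : Alt n 1) : toLinL n α = toLin α := rfl

/-- `ofLin` as a continuous linear map. -/
def ofLinL (n : ℕ) : (Vec n →L[ℝ] ℂ) →L[ℝ] Alt n 1 :=
  (ContinuousAlternatingMap.ofSubsingletonLIE (𝕜 := ℝ) (E := Vec n) (F := ℂ)
    (0 : Fin 1)).toContinuousLinearEquiv.toContinuousLinearMap

end

section

variable {q : ℂˣ} {n k : ℕ} {U : Opens (Hopf q n)}

/-! ### The calculus of forms on open sets of a Hopf manifold -/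

theorem Form.del_apply (ω : Form U k) {p : Vec n} (hp : p ∈ cover U) :
    (Form.del U k ω).1 p = dop (-1) ω.1 p := by
  simp [Form.del, hp, del_eq_dop]

theorem Form.delbar_apply (ω : Form U k) {p : Vec n} (hp : p ∈ cover U) :
    (Form.delbar U k ω).1 p = dop 1 ω.1 p := by
  simp [Form.delbar, hp, delbar_eq_dop]

theorem Form.d_apply (ω : Form U k) {p : Vec n} (hp : p ∈ cover U) :
    (Form.d U k ω).1 p = extDeriv ω.1 p := by
  simp [Form.d, hp]

theorem Form.ext_on {ω ω' : Form U k} (h : ∀ p ∈ cover U, ω.1 p = ω'.1 p) : ω = ω' := by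
  ext1
  funext p
  by_cases hp : p ∈ cover U
  · exact h p hp
  · rw [ω.2.2.2 p hp, ω'.2.2.2 p hp]

theorem Form.eventuallyEq {ω : Vec n → Alt n k} {ω' : Vec n → Alt n k}
    (h : ∀ p ∈ cover U, ω p = ω' p) {p : Vec n} (hp : p ∈ cover U) : ω =ᶠ[nhds p] ω' := by
  filter_upwards [(isOpen_cover U).mem_nhds hp] with x hx using h x hx

theorem Form.contDiffAt (ω : Form U k) {p : Vec n} (hp : p ∈ cover U) :
    ContDiffAt ℝ 2 ω.1 p :=
  (ω.2.1.contDiffAt ((isOpen_cover U).mem_nhds hp)).of_le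
    (WithTop.coe_le_coe.2 (le_top : (2 : ℕ∞) ≤ ⊤))

theorem Form.d_eq (ω : Form U k) : Form.d U k ω = Form.del U k ω + Form.delbar U k ω := by
  refine Form.ext_on fun p hp => ?_
  rw [Form.d_apply _ hp, Submodule.coe_add, Pi.add_apply, Form.del_apply _ hp,
    Form.delbar_apply _ hp, extDeriv_eq_del_add_delbar, del_eq_dop, delbar_eq_dop]

theorem Form.del_del (ω : Form U k) : Form.del U (k + 1) (Form.del U k ω) = 0 := by
  refine Form.ext_on fun p hp => ?_
  rw [Form.del_apply _ hp, dop_congr (Form.eventuallyEq (fun x => Form.del_apply ω) hp),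
    dop_dop_self (Form.contDiffAt ω hp)]
  rfl

theorem Form.delbar_delbar (ω : Form U k) : Form.delbar U (k + 1) (Form.delbar U k ω) = 0 := by
  refine Form.ext_on fun p hp => ?_
  rw [Form.delbar_apply _ hp, dop_congr (Form.eventuallyEq (fun x => Form.delbar_apply ω) hp),
    dop_dop_self (Form.contDiffAt ω hp)]
  rfl

theorem Form.del_delbar (ω : Form U k) :
    Form.del U (k + 1) (Form.delbar U k ω) = -Form.delbar U (k + 1) (Form.del U k ω) := by
  rw [eq_neg_iff_add_eq_zero]
  refine Form.ext_on fun p hp => ?_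
  rw [Submodule.coe_add, Pi.add_apply, Form.delbar_apply _ hp, Form.del_apply _ hp,
    dop_congr (Form.eventuallyEq (fun x => Form.delbar_apply ω) hp),
    dop_congr (Form.eventuallyEq (fun x => Form.del_apply ω) hp),
    dop_dop_add (Form.contDiffAt ω hp)]
  rfl

theorem Form.d_d (ω : Form U k) : Form.d U (k + 1) (Form.d U k ω) = 0 := by
  simp only [Form.d_eq, map_add, Form.del_del, Form.delbar_delbar, Form.del_delbar]
  abel

theorem contDiffOn_val {ω : Vec n → Alt n 0} {s : Set (Vec n)} {m : WithTop ℕ∞}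
    (h : ContDiffOn ℝ m ω s) : ContDiffOn ℝ m (val ω) s := by
  refine ((ContinuousAlternatingMap.constOfIsEmptyLIE ℝ (Vec n) ℂ
    (Fin 0)).symm.contDiff.comp_contDiffOn h).congr fun x _ => ?_
  change ω x ![] = ω x 0
  congr 1
  exact Subsingleton.elim _ _

theorem Form.contDiffOn_val (s : Form U 0) : ContDiffOn ℝ (⊤ : ℕ∞) (val s.1) (cover U) :=
  HopfBC.contDiffOn_val s.2.1

theorem Form.differentiableAt_val (s : Form U 0) {p : Vec n} (hp : p ∈ cover U) :
    DifferentiableAt ℝ (val s.1) p :=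
  ((Form.contDiffOn_val s).contDiffAt ((isOpen_cover U).mem_nhds hp)).differentiableAt (by simp)

theorem Form.val_smul (s : Form U 0) {p : Vec n} (hp : p ∈ cover U) :
    val s.1 ((q : ℂ) • p) = val s.1 p := by
  have h := s.2.2.1 p hp ![]
  rw [val, val, ← h]
  congr 1
  exact Subsingleton.elim _ _

theorem toLin_smul_smul {ω : Form U 1} {p : Vec n} (hp : p ∈ cover U) (w : Vec n) :
    toLin (ω.1 ((q : ℂ) • p)) ((q : ℂ) • w) = toLin (ω.1 p) w := by
  rw [toLin_apply, toLin_apply, ← ω.2.2.1 p hp]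
  congr 1
  ext i
  fin_cases i
  rfl

/-- The product of a function and a form. -/
def Form.mul (s : Form U 0) (ζ : Form U k) : Form U k :=
  ⟨fun p => val s.1 p • ζ.1 p, (Form.contDiffOn_val s).smul ζ.2.1,
    fun p hp v => by
      rw [ContinuousAlternatingMap.smul_apply, ζ.2.2.1 p hp, Form.val_smul s hp]
      rfl,
    fun p hp => by simp only [ζ.2.2.2 p hp, smul_zero]⟩

/-- The exterior product of a `1`-form and a form. -/
def Form.wedge (α : Form U 1) (ζ : Form U k) : Form U (k + 1) :=
  ⟨fun p => wedgeLin (toLin (α.1 p)) (ζ.1 p), by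
      have h1 : ContDiffOn ℝ (⊤ : ℕ∞) (fun p => toLin (α.1 p)) (cover U) :=
        (toLinL n).contDiff.comp_contDiffOn α.2.1
      have h2 : ContDiffOn ℝ (⊤ : ℕ∞) (fun p => wedgeLinL n k (toLin (α.1 p))) (cover U) :=
        (wedgeLinL n k).contDiff.comp_contDiffOn h1
      exact h2.clm_apply ζ.2.1,
    fun p hp v => by
      rw [wedgeLin_apply, wedgeLin_apply]
      refine Finset.sum_congr rfl fun i _ => ?_
      rw [toLin_smul_smul hp, ← ζ.2.2.1 p hp]
      rfl,
    fun p hp => by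
      simp only [ζ.2.2.2 p hp]
      exact map_zero (wedgeLinL n k _)⟩

theorem Form.mul_apply (s : Form U 0) (ζ : Form U k) (p : Vec n) :
    (Form.mul s ζ).1 p = val s.1 p • ζ.1 p := rfl

theorem Form.wedge_apply (α : Form U 1) (ζ : Form U k) (p : Vec n) :
    (Form.wedge α ζ).1 p = wedgeLin (toLin (α.1 p)) (ζ.1 p) := rfl

@[simp] theorem Form.mul_zero (s : Form U 0) : Form.mul s (0 : Form U k) = 0 := by
  refine Form.ext_on fun p hp => ?_
  rw [Form.mul_apply]
  exact smul_zero _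

theorem Form.mul_neg (s : Form U 0) (ζ : Form U k) : Form.mul s (-ζ) = -Form.mul s ζ := by
  refine Form.ext_on fun p hp => ?_
  rw [Form.mul_apply]
  exact smul_neg _ _

@[simp] theorem Form.wedge_zero (α : Form U 1) : Form.wedge α (0 : Form U k) = 0 := by
  refine Form.ext_on fun p hp => ?_
  rw [Form.wedge_apply]
  exact map_zero (wedgeLinL n k _)

theorem Form.del_mul (s : Form U 0) (ζ : Form U k) :
    Form.del U k (Form.mul s ζ) =
      Form.wedge (Form.del U 0 s) ζ + Form.mul s (Form.del U k ζ) := by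
  refine Form.ext_on fun p hp => ?_
  rw [Form.del_apply _ hp, Submodule.coe_add, Pi.add_apply, Form.wedge_apply, Form.mul_apply,
    Form.del_apply _ hp, Form.del_apply _ hp, toLin_dop (Form.differentiableAt s hp)]
  exact dop_smul (Form.differentiableAt_val s hp) (Form.differentiableAt ζ hp)

theorem Form.delbar_mul (s : Form U 0) (ζ : Form U k) :
    Form.delbar U k (Form.mul s ζ) =
      Form.wedge (Form.delbar U 0 s) ζ + Form.mul s (Form.delbar U k ζ) := by
  refine Form.ext_on fun p hp => ?_
  rw [Form.delbar_apply _ hp, Submodule.coe_add, Pi.add_apply, Form.wedge_apply, Form.mul_apply,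
    Form.delbar_apply _ hp, Form.delbar_apply _ hp, toLin_dop (Form.differentiableAt s hp)]
  exact dop_smul (Form.differentiableAt_val s hp) (Form.differentiableAt ζ hp)

theorem differentiableAt_toLin {α : Vec n → Alt n 1} {p : Vec n} (h : DifferentiableAt ℝ α p) :
    DifferentiableAt ℝ (fun x => toLin (α x)) p :=
  (toLinL n).differentiableAt.comp p h

/-- The operator `∂` or `∂̄` on `1`-forms in terms of bilinear forms. -/
theorem dop_apply_two {ε : ℂ} {α : Vec n → Alt n 1} {p : Vec n} (h : DifferentiableAt ℝ α p)
    (v w : Vec n) :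
    dop ε α p ![v, w] = part ε (fderiv ℝ (fun x => toLin (α x)) p) v w -
      part ε (fderiv ℝ (fun x => toLin (α x)) p) w v := by
  have e : fderiv ℝ (fun x => toLin (α x)) p = (toLinL n).comp (fderiv ℝ α p) :=
    ((toLinL n).hasFDerivAt.comp p h.hasFDerivAt).fderiv
  rw [e, dop, ContinuousAlternatingMap.alternatizeUncurryFin_apply, Fin.sum_univ_two]
  have e0 : (0 : Fin 2).removeNth ![v, w] = ![w] := by ext i; fin_cases i; rfl
  have e1 : (1 : Fin 2).removeNth ![v, w] = ![v] := by ext i; fin_cases i; rfl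
  simp [e0, e1, part_apply, toLin_apply]
  ring

/-- The Leibniz rule for a `1`-form annihilated by the operator. -/
theorem dop_wedgeLin_of_eq_zero {ε : ℂ} {α : Vec n → Alt n 1} {ζ : Vec n → Alt n k} {p : Vec n}
    (hα : DifferentiableAt ℝ α p) (hζ : DifferentiableAt ℝ ζ p) (h : dop ε α p = 0) :
    dop ε (fun x => wedgeLin (toLin (α x)) (ζ x)) p = -wedgeLin (toLin (α p)) (dop ε ζ p) := by
  rw [dop_wedgeLin (differentiableAt_toLin hα) hζ, alternatize_wedgeLinL_flip_of_symmetric,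
    zero_sub]
  intro v w
  have h1 := dop_apply_two (ε := ε) hα v w
  rw [h] at h1
  exact (sub_eq_zero.1 h1.symm)

/-- The Leibniz rule for a `1`-form and a `2`-form. -/
theorem dop_wedgeLin_two {ε : ℂ} {α : Vec n → Alt n 1} {ζ : Vec n → Alt n 2} {p : Vec n}
    (hα : DifferentiableAt ℝ α p) (hζ : DifferentiableAt ℝ ζ p) :
    dop ε (fun x => wedgeLin (toLin (α x)) (ζ x)) p =
      (HopfBC.wedge (dop ε α p : Alt n 2) (ζ p) : Alt n 4) -
        wedgeLin (toLin (α p)) (dop ε ζ p) := by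
  rw [dop_wedgeLin (differentiableAt_toLin hα) hζ,
    alternatize_wedgeLinL_flip _ _ _ fun v w => dop_apply_two hα v w]

theorem Form.del_wedge_of_eq_zero (α : Form U 1) (ζ : Form U k) (h : Form.del U 1 α = 0) :
    Form.del U (k + 1) (Form.wedge α ζ) = -Form.wedge α (Form.del U k ζ) := by
  refine Form.ext_on fun p hp => ?_
  have h0 : dop (-1) α.1 p = 0 := by rw [← Form.del_apply _ hp, h]; rfl
  rw [Form.del_apply _ hp]
  refine (dop_wedgeLin_of_eq_zero (Form.differentiableAt α hp) (Form.differentiableAt ζ hp)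
    h0).trans ?_
  rw [← Form.del_apply _ hp]
  rfl

theorem Form.delbar_wedge_of_eq_zero (α : Form U 1) (ζ : Form U k) (h : Form.delbar U 1 α = 0) :
    Form.delbar U (k + 1) (Form.wedge α ζ) = -Form.wedge α (Form.delbar U k ζ) := by
  refine Form.ext_on fun p hp => ?_
  have h0 : dop 1 α.1 p = 0 := by rw [← Form.delbar_apply _ hp, h]; rfl
  rw [Form.delbar_apply _ hp]
  refine (dop_wedgeLin_of_eq_zero (Form.differentiableAt α hp) (Form.differentiableAt ζ hp)
    h0).trans ?_
  rw [← Form.delbar_apply _ hp]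
  rfl

theorem Form.del_wedge_two {α : Form U 1} {ζ : Form U 2} {p : Vec n} (hp : p ∈ cover U) :
    (Form.del U 3 (Form.wedge α ζ)).1 p =
      (HopfBC.wedge ((Form.del U 1 α).1 p) (ζ.1 p) : Alt n 4) -
        (Form.wedge α (Form.del U 2 ζ)).1 p := by
  rw [Form.del_apply _ hp, Form.del_apply _ hp, Form.wedge_apply, Form.del_apply _ hp]
  exact dop_wedgeLin_two (Form.differentiableAt α hp) (Form.differentiableAt ζ hp)

theorem Form.delbar_wedge_two {α : Form U 1} {ζ : Form U 2} {p : Vec n} (hp : p ∈ cover U) :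
    (Form.delbar U 3 (Form.wedge α ζ)).1 p =
      (HopfBC.wedge ((Form.delbar U 1 α).1 p) (ζ.1 p) : Alt n 4) -
        (Form.wedge α (Form.delbar U 2 ζ)).1 p := by
  rw [Form.delbar_apply _ hp, Form.delbar_apply _ hp, Form.wedge_apply, Form.delbar_apply _ hp]
  exact dop_wedgeLin_two (Form.differentiableAt α hp) (Form.differentiableAt ζ hp)

/-! ### Types -/

theorem Form.isType_zero_of_notMem (ω : Form U k) {p : Vec n} (hp : p ∉ cover U) (a b : ℕ) :
    IsType a b (ω.1 p) := by
  intro c v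
  rw [ω.2.2.2 p hp]
  simp

theorem Form.del_mem_type {a b : ℕ} {ω : Form U k} (h : ω ∈ Form.type U k a b) :
    Form.del U k ω ∈ Form.type U (k + 1) (a + 1) b := by
  intro p
  by_cases hp : p ∈ cover U
  · rw [Form.del_apply _ hp]
    exact fun v c => isType_dop_neg_one (Form.differentiableAt ω hp) (fun x c v => h x v c) c v
  · exact fun v c => Form.isType_zero_of_notMem _ hp _ _ c v

theorem Form.delbar_mem_type {a b : ℕ} {ω : Form U k} (h : ω ∈ Form.type U k a b) :
    Form.delbar U k ω ∈ Form.type U (k + 1) a (b + 1) := by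
  intro p
  by_cases hp : p ∈ cover U
  · rw [Form.delbar_apply _ hp]
    exact fun v c => isType_dop_one (Form.differentiableAt ω hp) (fun x c v => h x v c) c v
  · exact fun v c => Form.isType_zero_of_notMem _ hp _ _ c v

theorem Form.mem_type_zero (s : Form U 0) : s ∈ Form.type U 0 0 0 := by
  intro p v c
  rw [pow_zero, pow_zero, one_mul, one_mul]
  congr 1
  exact Subsingleton.elim _ _

theorem Form.wedge_mem_type {a b a' b' : ℕ} {α : Form U 1} {ζ : Form U k}
    (hα : α ∈ Form.type U 1 a b) (hζ : ζ ∈ Form.type U k a' b') :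
    Form.wedge α ζ ∈ Form.type U (k + 1) (a + a') (b + b') := fun p v c =>
  isType_wedgeLin (fun c v => hα p v c) (fun c v => hζ p v c) c v

theorem Form.mul_mem_type {a b : ℕ} {s : Form U 0} {ζ : Form U k}
    (hζ : ζ ∈ Form.type U k a b) : Form.mul s ζ ∈ Form.type U k a b := fun p v c =>
  IsType.smul (fun c v => hζ p v c) (val s.1 p) c v

theorem Form.eq_zero_of_type_three {U : Opens (Hopf q 2)} {a b : ℕ} {ω : Form U 3}
    (hab : (a = 3 ∧ b = 0) ∨ (a = 0 ∧ b = 3)) (h : ω ∈ Form.type U 3 a b) : ω = 0 :=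
  Form.ext_on fun p _ => HopfBC.eq_zero_of_type_three hab fun c v => h p v c

theorem Form.eq_zero_of_type_four {U : Opens (Hopf q 2)} {a b : ℕ} {ω : Form U 4}
    (hab : (a = 3 ∧ b = 1) ∨ (a = 1 ∧ b = 3)) (h : ω ∈ Form.type U 4 a b) : ω = 0 :=
  Form.ext_on fun p _ => HopfBC.eq_zero_of_type_four hab fun c v => h p v c

/-! ### The residue form -/

/-- The `3`-form `∂s ∧ ξ - ½ ∂(s ξ) - ∂̄s ∧ ξ + ½ ∂̄(s ξ)`, with the products expanded. -/
def residueForm (s : Form U 0) (ξ : Form U 2) : Form U 3 :=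
  (1 / 2 : ℂ) • (Form.wedge (Form.del U 0 s) ξ - Form.mul s (Form.del U 2 ξ) -
    Form.wedge (Form.delbar U 0 s) ξ + Form.mul s (Form.delbar U 2 ξ))

/-- The differential of the residue form is `∂̄∂s ∧ ξ`. The terms with two derivatives on `ξ` cancel
because `∂̄∂ξ = 0`, and `∂s ∧ ∂ξ`, `∂̄s ∧ ∂̄ξ` vanish because they are of type `(3, 1)` and `(1,
3)`. -/
theorem d_residueForm {U : Opens (Hopf q 2)} (s : Form U 0) {ξ : Form U 2} (hξ : ξ ∈ ZA U)
    {p : Vec 2} (hp : p ∈ cover U) :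
    (Form.d U 3 (residueForm s ξ)).1 p =
      (HopfBC.wedge ((Form.ddbar U s).1 p) (ξ.1 p) : Alt 2 4) := by
  have h1 : Form.delbar U 3 (Form.del U 2 ξ) = 0 := hξ.2
  have h2 : Form.del U 3 (Form.delbar U 2 ξ) = 0 := by rw [Form.del_delbar, h1, neg_zero]
  have t1 : Form.wedge (Form.del U 0 s) (Form.del U 2 ξ) = 0 :=
    Form.eq_zero_of_type_four (a := 3) (b := 1) (Or.inl ⟨rfl, rfl⟩)
      (Form.wedge_mem_type (a := 1) (b := 0) (a' := 2) (b' := 1)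
        (Form.del_mem_type (a := 0) (b := 0) (Form.mem_type_zero s))
        (Form.del_mem_type (a := 1) (b := 1) hξ.1))
  have t2 : Form.wedge (Form.delbar U 0 s) (Form.delbar U 2 ξ) = 0 :=
    Form.eq_zero_of_type_four (a := 1) (b := 3) (Or.inr ⟨rfl, rfl⟩)
      (Form.wedge_mem_type (a := 0) (b := 1) (a' := 1) (b' := 2)
        (Form.delbar_mem_type (a := 0) (b := 0) (Form.mem_type_zero s))
        (Form.delbar_mem_type (a := 1) (b := 1) hξ.1))
  have key : Form.d U 3 (residueForm s ξ) = (1 / 2 : ℂ) •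
      (Form.delbar U 3 (Form.wedge (Form.del U 0 s) ξ) +
        Form.wedge (Form.del U 0 s) (Form.delbar U 2 ξ) -
        (Form.del U 3 (Form.wedge (Form.delbar U 0 s) ξ) +
          Form.wedge (Form.delbar U 0 s) (Form.del U 2 ξ))) := by
    rw [Form.d_eq, residueForm, map_smul, map_smul, ← smul_add]
    congr 1
    simp only [map_add, map_sub, Form.del_mul, Form.delbar_mul, h1, h2, Form.del_del,
      Form.delbar_delbar, Form.mul_zero, t1, t2,
      Form.del_wedge_of_eq_zero _ _ (Form.del_del s),
      Form.delbar_wedge_of_eq_zero _ _ (Form.delbar_delbar s)]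
    abel
  rw [key]
  simp only [Submodule.coe_smul, Pi.smul_apply, Submodule.coe_add, Submodule.coe_sub,
    Pi.add_apply, Pi.sub_apply, Form.del_wedge_two hp, Form.delbar_wedge_two hp, Form.del_delbar]
  have e : (Form.ddbar U s).1 p = (Form.delbar U 1 (Form.del U 0 s)).1 p := rfl
  rw [e]
  have e2 : (HopfBC.wedge ((-Form.delbar U 1 (Form.del U 0 s)).1 p) (ξ.1 p) : Alt 2 4) =
      -HopfBC.wedge ((Form.delbar U 1 (Form.del U 0 s)).1 p) (ξ.1 p) := by
    ext v
    change _ = -(HopfBC.wedge ((Form.delbar U 1 (Form.del U 0 s)).1 p) (ξ.1 p)) v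
    rw [wedge_two_two_apply, wedge_two_two_apply]
    simp
    ring
  rw [e2]
  module

/-- If `∂̄∂s = 0` and `ξ = ∂̄α` is a coboundary of Aeppli cohomology, then the residue form is
exact. -/
theorem residueForm_delbar {U : Opens (Hopf q 2)} {s : Form U 0} (hs : Form.ddbar U s = 0)
    {α : Form U 1} (hα : α ∈ Form.type U 1 1 0) :
    residueForm s (Form.delbar U 1 α) = Form.d U 2 ((1 / 2 : ℂ) •
      (Form.wedge (Form.delbar U 0 s) α - Form.wedge (Form.del U 0 s) α +
        Form.mul s (Form.del U 1 α))) := by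
  have h1 : Form.delbar U 1 (Form.del U 0 s) = 0 := hs
  have h2 : Form.del U 1 (Form.delbar U 0 s) = 0 := by rw [Form.del_delbar, h1, neg_zero]
  have t1 : Form.wedge (Form.del U 0 s) (Form.del U 1 α) = 0 :=
    Form.eq_zero_of_type_three (a := 3) (b := 0) (Or.inl ⟨rfl, rfl⟩)
      (Form.wedge_mem_type (a := 1) (b := 0) (a' := 2) (b' := 0)
        (Form.del_mem_type (a := 0) (b := 0) (Form.mem_type_zero s))
        (Form.del_mem_type (a := 1) (b := 0) hα))
  rw [residueForm, map_smul]
  congr 1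
  simp only [Form.d_eq, map_add, map_sub, Form.del_mul, Form.delbar_mul, Form.del_del,
    Form.delbar_delbar, Form.mul_zero, t1, Form.del_wedge_of_eq_zero _ _ (Form.del_del s),
    Form.delbar_wedge_of_eq_zero _ _ (Form.delbar_delbar s), Form.del_wedge_of_eq_zero _ _ h2,
    Form.delbar_wedge_of_eq_zero _ _ h1, Form.del_delbar, Form.mul_neg]
  abel

/-- If `∂̄∂s = 0` and `ξ = ∂β` is a coboundary of Aeppli cohomology, then the residue form is exact.
-/
theorem residueForm_del {U : Opens (Hopf q 2)} {s : Form U 0} (hs : Form.ddbar U s = 0)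
    {β : Form U 1} (hβ : β ∈ Form.type U 1 0 1) :
    residueForm s (Form.del U 1 β) = Form.d U 2 ((1 / 2 : ℂ) •
      (Form.wedge (Form.delbar U 0 s) β - Form.wedge (Form.del U 0 s) β -
        Form.mul s (Form.delbar U 1 β))) := by
  have h1 : Form.delbar U 1 (Form.del U 0 s) = 0 := hs
  have h2 : Form.del U 1 (Form.delbar U 0 s) = 0 := by rw [Form.del_delbar, h1, neg_zero]
  have t1 : Form.wedge (Form.delbar U 0 s) (Form.delbar U 1 β) = 0 :=
    Form.eq_zero_of_type_three (a := 0) (b := 3) (Or.inr ⟨rfl, rfl⟩)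
      (Form.wedge_mem_type (a := 0) (b := 1) (a' := 0) (b' := 2)
        (Form.delbar_mem_type (a := 0) (b := 0) (Form.mem_type_zero s))
        (Form.delbar_mem_type (a := 0) (b := 1) hβ))
  rw [residueForm, map_smul]
  congr 1
  simp only [Form.d_eq, map_sub, Form.del_mul, Form.delbar_mul, Form.del_del,
    Form.delbar_delbar, Form.mul_zero, t1, Form.del_wedge_of_eq_zero _ _ (Form.del_del s),
    Form.delbar_wedge_of_eq_zero _ _ (Form.delbar_delbar s), Form.del_wedge_of_eq_zero _ _ h2,
    Form.delbar_wedge_of_eq_zero _ _ h1, Form.del_delbar, Form.mul_neg]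
  abel

/-- The value of `residueForm` is the integrand of the residue. -/
theorem residueForm_apply {U : Opens (Hopf q 2)} (s : Form U 0) (ξ : Form U 2) {p : Vec 2}
    (hp : p ∈ cover U) :
    (residueForm s ξ).1 p =
      ((HopfBC.wedge (HopfBC.del s.1 p) (ξ.1 p) : Alt 2 3) -
          (1 / 2 : ℂ) • HopfBC.del (fun x => val s.1 x • ξ.1 x) p) +
        (-(HopfBC.wedge (HopfBC.delbar s.1 p) (ξ.1 p) : Alt 2 3) +
          (1 / 2 : ℂ) • HopfBC.delbar (fun x => val s.1 x • ξ.1 x) p) := by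
  rw [del_eq_dop, delbar_eq_dop, del_eq_dop, delbar_eq_dop, wedge_one_two, wedge_one_two]
  have e1 : dop (-1) (fun x => val s.1 x • ξ.1 x) p = (Form.del U 2 (Form.mul s ξ)).1 p :=
    (Form.del_apply (Form.mul s ξ) hp).symm
  have e2 : dop 1 (fun x => val s.1 x • ξ.1 x) p = (Form.delbar U 2 (Form.mul s ξ)).1 p :=
    (Form.delbar_apply (Form.mul s ξ) hp).symm
  rw [e1, e2, Form.del_mul, Form.delbar_mul, ← Form.del_apply _ hp, ← Form.delbar_apply _ hp,
    ← Form.wedge_apply, ← Form.wedge_apply, residueForm]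
  simp only [Submodule.coe_smul, Pi.smul_apply, Submodule.coe_add, Submodule.coe_sub,
    Pi.add_apply, Pi.sub_apply]
  module

end

section

variable {q : ℂˣ} {n k m : ℕ}

/-! ### Stokes' theorem for singular cubes -/

open MeasureTheory

/-- Fubini's theorem for a box, one coordinate being split off. -/
theorem integral_Icc_insertNth (i : Fin (m + 1)) (a b : Fin (m + 1) → ℝ)
    {g : (Fin (m + 1) → ℝ) → ℂ} (hg : ContinuousOn g (Set.Icc a b)) :
    ∫ x in Set.Icc a b, g x =
      ∫ y in Set.Icc (fun j => a (i.succAbove j)) (fun j => b (i.succAbove j)),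
        ∫ t in Set.Icc (a i) (b i), g (i.insertNth t y) := by
  let e := MeasurableEquiv.piFinSuccAbove (fun _ : Fin (m + 1) => ℝ) i
  have he : MeasurePreserving e.symm :=
    (volume_preserving_piFinSuccAbove (fun _ : Fin (m + 1) => ℝ) i).symm e
  have hs : e.symm ⁻¹' (Set.Icc a b) = Set.Icc (a i) (b i) ×ˢ
      Set.Icc (fun j => a (i.succAbove j)) (fun j => b (i.succAbove j)) := by
    ext ⟨t, y⟩
    change i.insertNth t y ∈ Set.Icc a b ↔ _
    rw [Fin.insertNth_mem_Icc]
    rfl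
  have hi : IntegrableOn g (Set.Icc a b) := hg.integrableOn_compact isCompact_Icc
  have hi2 := (he.integrableOn_comp_preimage e.symm.measurableEmbedding).2 hi
  rw [← he.setIntegral_preimage_emb e.symm.measurableEmbedding, hs, Measure.volume_eq_prod,
    ← setIntegral_prod_swap, setIntegral_prod]
  · rfl
  · rw [hs] at hi2
    rw [IntegrableOn, Measure.volume_eq_prod, ← Measure.prod_restrict] at hi2
    rw [IntegrableOn, ← Measure.prod_restrict]
    exact hi2.swap

/-- Translating a periodic coordinate does not change the integral over a box whose side is a
period. -/
theorem integral_Icc_shift_of_periodic (i : Fin (m + 1)) {a b : Fin (m + 1) → ℝ} (hi : a i ≤ b i)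
    {g : (Fin (m + 1) → ℝ) → ℂ} (c : ℝ)
    (hg : ContinuousOn g
      {x | ∀ j, x (i.succAbove j) ∈ Set.Icc (a (i.succAbove j)) (b (i.succAbove j))})
    (hp : ∀ x t, g (i.insertNth (t + (b i - a i)) x) = g (i.insertNth t x)) :
    ∫ x in Set.Icc a b, g (x + Pi.single i c) = ∫ x in Set.Icc a b, g x := by
  have hsub : Set.Icc a b ⊆
      {x | ∀ j, x (i.succAbove j) ∈ Set.Icc (a (i.succAbove j)) (b (i.succAbove j))} :=
    fun x hx j => ⟨hx.1 _, hx.2 _⟩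
  rw [integral_Icc_insertNth i a b (hg.mono hsub), integral_Icc_insertNth i a b]
  · refine integral_congr_ae (Filter.Eventually.of_forall fun y => ?_)
    have h : ∀ t, g (i.insertNth t y + Pi.single i c) = g (i.insertNth (t + c) y) := fun t => by
      congr 1
      ext j
      refine Fin.succAboveCases i ?_ (fun j => ?_) j <;> simp
    simp only [h]
    rw [integral_Icc_eq_integral_Ioc, integral_Icc_eq_integral_Ioc,
      ← intervalIntegral.integral_of_le hi, ← intervalIntegral.integral_of_le hi,
      intervalIntegral.integral_comp_add_right (fun t => g (i.insertNth t y))]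
    have hper : Function.Periodic (fun t => g (i.insertNth t y)) (b i - a i) := hp y
    have h2 := hper.intervalIntegral_add_eq (a i + c) (a i)
    rw [add_sub_cancel] at h2
    rw [← h2]
    congr 1
    ring
  · refine hg.comp (by fun_prop) fun x hx j => ?_
    simpa using hsub hx j

/-- Stokes' theorem for a box. -/
theorem integral_extDeriv_box {a b : Fin (m + 1) → ℝ} (hab : a ≤ b)
    {μ : (Fin (m + 1) → ℝ) → (Fin (m + 1) → ℝ) [⋀^Fin m]→L[ℝ] ℂ}
    (hμ : ∀ x ∈ Set.Icc a b, DifferentiableAt ℝ μ x)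
    (hμ' : ContinuousOn (fun x => extDeriv μ x (fun i => Pi.single i 1)) (Set.Icc a b)) :
    ∫ x in Set.Icc a b, extDeriv μ x (fun i => Pi.single i 1) =
      ∑ i : Fin (m + 1), (-1) ^ (i : ℕ) *
        ((∫ y in Set.Icc (fun j => a (i.succAbove j)) (fun j => b (i.succAbove j)),
            μ (i.insertNth (b i) y) (fun j => Pi.single (i.succAbove j) 1)) -
          ∫ y in Set.Icc (fun j => a (i.succAbove j)) (fun j => b (i.succAbove j)),
            μ (i.insertNth (a i) y) (fun j => Pi.single (i.succAbove j) 1)) := by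
  let e : (i : Fin (m + 1)) → Fin m → Fin (m + 1) → ℝ := fun i j => Pi.single (i.succAbove j) 1
  let f : Fin (m + 1) → (Fin (m + 1) → ℝ) → ℂ := fun i x => (-1) ^ (i : ℕ) * μ x (e i)
  have hfd : ∀ i, ∀ x ∈ Set.Icc a b, DifferentiableAt ℝ (fun x => μ x (e i)) x := fun i x hx =>
    (hμ x hx).continuousAlternatingMap_apply fun i => differentiableAt_const _
  have hf : ∀ i, ∀ x ∈ Set.Icc a b, DifferentiableAt ℝ (f i) x := fun i x hx =>
    (hfd i x hx).const_mul _
  have key : ∀ x ∈ Set.Icc a b, extDeriv μ x (fun i => Pi.single i 1) =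
      ∑ i, fderiv ℝ (f i) x (Pi.single i 1) := by
    intro x hx
    rw [extDeriv_apply (hμ x hx)]
    refine Finset.sum_congr rfl fun i _ => ?_
    rw [fderiv_const_mul (hfd i x hx)]
    simp [e]
    rfl
  rw [setIntegral_congr_fun measurableSet_Icc key,
    integral_divergence_of_hasFDerivAt_off_countable' a b hab f (fun i => fderiv ℝ (f i)) ∅
      Set.countable_empty]
  · refine Finset.sum_congr rfl fun i _ => ?_
    simp only [f]
    rw [integral_const_mul, integral_const_mul, mul_sub]
    rfl
  · exact fun i x hx => (hf i x hx).continuousAt.continuousWithinAt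
  · intro x hx i
    refine (hf i x ?_).hasFDerivAt
    exact Set.pi_univ_Icc a b ▸ (fun i _ => Set.Ioo_subset_Icc_self (hx.1 i trivial))
  · exact (hμ'.congr fun x hx => (key x hx).symm).integrableOn_compact isCompact_Icc

theorem hasFDerivAt_insertNth (i : Fin (m + 1)) (t : ℝ) (y : Fin m → ℝ) :
    HasFDerivAt (fun y : Fin m → ℝ => (i.insertNth t y : Fin (m + 1) → ℝ))
      (ContinuousLinearMap.pi fun l => i.succAboveCases (α := fun _ => (Fin m → ℝ) →L[ℝ] ℝ) 0
        (fun j => ContinuousLinearMap.proj j) l) y := by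
  rw [hasFDerivAt_pi]
  intro l
  refine Fin.succAboveCases i ?_ (fun j => ?_) l
  · simpa using hasFDerivAt_const t y
  · simpa using hasFDerivAt_apply j y

/-- Stokes' theorem for singular cubes. -/
theorem cubeIntegral_extDeriv {c : (Fin (m + 1) → ℝ) → Vec n} (hc : ContDiff ℝ (⊤ : ℕ∞) c)
    {a b : Fin (m + 1) → ℝ} (hab : a ≤ b) {ω : Vec n → Alt n m}
    (hω : ∀ x ∈ Set.Icc a b, ContDiffAt ℝ 2 ω (c x)) :
    cubeIntegral c a b (extDeriv ω) =
      ∑ i : Fin (m + 1), (-1) ^ (i : ℕ) *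
        (cubeIntegral (fun y => c (i.insertNth (b i) y)) (fun j => a (i.succAbove j))
            (fun j => b (i.succAbove j)) ω -
          cubeIntegral (fun y => c (i.insertNth (a i) y)) (fun j => a (i.succAbove j))
            (fun j => b (i.succAbove j)) ω) := by
  let μ : (Fin (m + 1) → ℝ) → (Fin (m + 1) → ℝ) [⋀^Fin m]→L[ℝ] ℂ :=
    fun x => (ω (c x)).compContinuousLinearMap (fderiv ℝ c x)
  have hc2 : ContDiff ℝ 2 c := hc.of_le (WithTop.coe_le_coe.2 (le_top : (2 : ℕ∞) ≤ ⊤))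
  have hμ : ∀ x ∈ Set.Icc a b, DifferentiableAt ℝ μ x := by
    intro x hx
    have h1 : DifferentiableAt ℝ (fun x => ω (c x)) x :=
      ((hω x hx).differentiableAt (by norm_num)).comp x
        (hc2.contDiffAt.differentiableAt (by norm_num))
    have h2 : DifferentiableAt ℝ (fderiv ℝ c) x :=
      ((hc2.contDiffAt).fderiv_right (m := 1) (by norm_num)).differentiableAt (by norm_num)
    exact h1.continuousAlternatingMapCompContinuousLinearMap h2
  have hext : ∀ x ∈ Set.Icc a b, extDeriv μ x (fun i => Pi.single i 1) =
      extDeriv ω (c x) (fun i => fderiv ℝ c x (Pi.single i 1)) := by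
    intro x hx
    simp only [μ]
    rw [extDeriv_pullback ((hω x hx).differentiableAt (by norm_num)) hc2.contDiffAt (by simp)]
    rfl
  have hcont : ContinuousOn (fun x => extDeriv μ x (fun i => Pi.single i 1)) (Set.Icc a b) := by
    refine ContinuousOn.congr (fun x hx => ContinuousAt.continuousWithinAt ?_) hext
    have h1 : ContinuousAt (extDeriv ω) (c x) := by
      have h := ((hω x hx).fderiv_right (m := 0) (by norm_num)).continuousAt
      exact (ContinuousAlternatingMap.alternatizeUncurryFinCLM ℝ (Vec n)
        ℂ).continuous.continuousAt.comp h
    have h2 : ContinuousAt (fun x => extDeriv ω (c x)) x := h1.comp hc.continuous.continuousAt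
    have h3 : Continuous (fderiv ℝ c) := hc.continuous_fderiv (by simp)
    exact h2.eval (by fun_prop)
  have hface : ∀ (i : Fin (m + 1)) (t : ℝ),
      cubeIntegral (fun y => c (i.insertNth t y)) (fun j => a (i.succAbove j))
            (fun j => b (i.succAbove j)) ω =
        ∫ y in Set.Icc (fun j => a (i.succAbove j)) (fun j => b (i.succAbove j)),
            μ (i.insertNth t y) (fun j => Pi.single (i.succAbove j) 1) := by
    intro i t
    refine integral_congr_ae (Filter.Eventually.of_forall fun y => ?_)
    have h1 : HasFDerivAt (fun y => c (i.insertNth t y)) _ y :=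
      ((hc2.differentiable (by norm_num)).differentiableAt.hasFDerivAt
        (x := (i.insertNth t y : Fin (m + 1) → ℝ))).comp y (hasFDerivAt_insertNth i t y)
    simp only [h1.fderiv]
    change _ = ω _ _
    congr 1
    funext j
    change fderiv ℝ c _ _ = fderiv ℝ c _ _
    refine congrArg _ (funext fun l => ?_)
    refine Fin.succAboveCases i ?_ (fun l => ?_) l
    · simp
    · simp [Pi.single_apply]
  simp only [hface]
  rw [← integral_extDeriv_box hab hμ hcont]
  exact setIntegral_congr_fun measurableSet_Icc fun x hx => (hext x hx).symm

/-- Integrals over singular cubes whose parametrizations differ by the deck transformation and a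
shift of a periodic parameter. -/
theorem cubeIntegral_shift {X : Opens (Hopf q n)} (ω : Form X (m + 1)) (i : Fin (m + 1))
    {c c' : (Fin (m + 1) → ℝ) → Vec n} (hc : ContDiff ℝ (⊤ : ℕ∞) c) {a b : Fin (m + 1) → ℝ}
    (hi : a i ≤ b i) (t : ℝ)
    (hX : ∀ x : Fin (m + 1) → ℝ,
      (∀ j, x (i.succAbove j) ∈ Set.Icc (a (i.succAbove j)) (b (i.succAbove j))) → c x ∈ cover X)
    (hp : ∀ x, c (x + Pi.single i (b i - a i)) = c x)
    (hc' : ∀ x, c' x = (q : ℂ) • c (x + Pi.single i t)) :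
    cubeIntegral c' a b ω.1 = cubeIntegral c a b ω.1 := by
  have hd : ∀ x, DifferentiableAt ℝ c x := fun x => (hc.differentiable (by simp)).differentiableAt
  have hshift : ∀ x s, fderiv ℝ (fun x => c (x + Pi.single i s)) x =
      fderiv ℝ c (x + Pi.single i s) := fun x s => fderiv_comp_add_right _
  have hc'd : ∀ x v, fderiv ℝ c' x v = (q : ℂ) • fderiv ℝ c (x + Pi.single i t) v := by
    intro x v
    have : c' = fun x => (q : ℂ) • c (x + Pi.single i t) := funext hc'
    rw [this, fderiv_fun_const_smul, smul_apply, hshift]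
    exact (hd _).comp x (by fun_prop)
  let g : (Fin (m + 1) → ℝ) → ℂ := fun x => ω.1 (c x) (fun j => fderiv ℝ c x (Pi.single j 1))
  have hgc : ContinuousOn g
      {x | ∀ j, x (i.succAbove j) ∈ Set.Icc (a (i.succAbove j)) (b (i.succAbove j))} := by
    have h1 : ContinuousOn (fun x => ω.1 (c x)) {x | ∀ j, x (i.succAbove j) ∈
        Set.Icc (a (i.succAbove j)) (b (i.succAbove j))} :=
      ω.2.1.continuousOn.comp hc.continuous.continuousOn fun x hx => hX x hx
    have h2 : Continuous (fderiv ℝ c) := hc.continuous_fderiv (by simp)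
    exact h1.eval (by fun_prop)
  rw [cubeIntegral, cubeIntegral, ← integral_Icc_shift_of_periodic i hi t hgc]
  · refine setIntegral_congr_fun measurableSet_Icc fun x hx => ?_
    simp only [hc', hc'd, g]
    refine ω.2.2.1 _ (hX _ fun j => ?_) _
    simpa using ⟨hx.1 (i.succAbove j), hx.2 (i.succAbove j)⟩
  · intro x s
    have e : (i.insertNth (s + (b i - a i)) x : Fin (m + 1) → ℝ) =
        i.insertNth s x + Pi.single i (b i - a i) := by
      ext j
      refine Fin.succAboveCases i ?_ (fun j => ?_) j <;> simp
    simp only [g]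
    rw [e, hp, ← hshift]
    simp only [hp]

end

section

variable {q : ℂˣ} {n k m : ℕ}

/-! ### Integrals over the tube and the elliptic curve -/

theorem log_norm_neg (hq : ‖(q : ℂ)‖ < 1) : Real.log ‖(q : ℂ)‖ < 0 :=
  Real.log_neg (norm_pos_iff.2 q.ne_zero) hq

theorem exp_log_norm_add_arg (q : ℂˣ) :
    exp (Real.log ‖(q : ℂ)‖ + arg q * I) = q := by
  conv_rhs => rw [← exp_log q.ne_zero]
  rw [Complex.log]

theorem exp_shift (q : ℂˣ) (ψ : ℝ) :
    exp ((Real.log ‖(q : ℂ)‖ : ℝ) + ψ * I) = q * exp ((0 : ℝ) + (ψ + -arg q : ℝ) * I) := by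
  nth_rewrite 2 [← exp_log_norm_add_arg q]
  rw [← exp_add]
  congr 1
  push_cast
  ring

theorem exp_add_two_pi (u ψ : ℝ) :
    exp (u + (ψ + 2 * Real.pi : ℝ) * I) = exp (u + ψ * I) := by
  have : (u + (ψ + 2 * Real.pi : ℝ) * I : ℂ) = (u + ψ * I) + 2 * Real.pi * I := by
    push_cast
    ring
  rw [this, exp_periodic]

theorem exp_two_pi (u : ℝ) :
    exp (u + (2 * Real.pi : ℝ) * I) = exp (u + (0 : ℝ) * I) := by
  have h := exp_add_two_pi u 0
  rw [zero_add] at h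
  exact h

theorem tubePoint_shift (q : ℂˣ) (r φ ψ : ℝ) :
    tubePoint r φ (Real.log ‖(q : ℂ)‖) ψ = (q : ℂ) • tubePoint r φ 0 (ψ + -arg q) := by
  rw [tubePoint, tubePoint, exp_shift]
  ext i
  fin_cases i
  · simp
  · simp
    ring

theorem tubePoint_add_two_pi (r φ u ψ : ℝ) :
    tubePoint r φ u (ψ + 2 * Real.pi) = tubePoint r φ u ψ := by
  rw [tubePoint, tubePoint, exp_add_two_pi]

theorem tubePoint_angle_two_pi (r u ψ : ℝ) :
    tubePoint r (2 * Real.pi) u ψ = tubePoint r 0 u ψ := by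
  simp [tubePoint]

theorem contDiff_ofReal_coord (i : Fin m) :
    ContDiff ℝ (⊤ : ℕ∞) fun s : Fin m → ℝ => ((s i : ℝ) : ℂ) :=
  ofRealCLM.contDiff.comp (contDiff_apply ℝ ℝ i)

theorem contDiff_tube :
    ContDiff ℝ (⊤ : ℕ∞) fun s : Fin 4 → ℝ => tubePoint (s 0) (s 1) (s 2) (s 3) := by
  have h := fun i : Fin 4 => contDiff_ofReal_coord i
  have hx : ContDiff ℝ (⊤ : ℕ∞) fun s : Fin 4 → ℝ => exp ((s 2 : ℝ) + (s 3 : ℝ) * I) :=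
    ((h 2).add ((h 3).mul contDiff_const)).cexp
  rw [contDiff_pi]
  intro i
  fin_cases i
  · exact hx
  · exact ((h 0).mul ((h 1).mul contDiff_const).cexp).mul hx

theorem contDiff_tube_bdry (δ : ℝ) :
    ContDiff ℝ (⊤ : ℕ∞) fun s : Fin 3 → ℝ => tubePoint δ (s 0) (s 1) (s 2) := by
  refine contDiff_tube.comp (g := fun s : Fin 4 → ℝ => tubePoint (s 0) (s 1) (s 2) (s 3))
    (f := fun s : Fin 3 → ℝ => ![δ, s 0, s 1, s 2]) ?_
  rw [contDiff_pi]
  intro j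
  fin_cases j
  · exact contDiff_const
  · exact contDiff_apply ℝ ℝ 0
  · exact contDiff_apply ℝ ℝ 1
  · exact contDiff_apply ℝ ℝ 2

theorem tubePoint_zero (r φ u ψ : ℝ) : tubePoint r φ u ψ 0 = exp (u + ψ * I) := rfl

theorem tubePoint_one (r φ u ψ : ℝ) :
    tubePoint r φ u ψ 1 = r * exp (φ * I) * tubePoint r φ u ψ 0 := rfl

/-- The points `[x, y]` with `x ≠ 0` and `δ' ≤ |y / x| ≤ δ`. -/
def tubeSet (δ' δ : ℝ) : Set (Vec 2) :=
  {p | p 0 ≠ 0 ∧ δ' * ‖p 0‖ ≤ ‖p 1‖ ∧ ‖p 1‖ ≤ δ * ‖p 0‖}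

theorem tubePoint_mem_tubeSet {δ' δ r : ℝ} (h0 : 0 ≤ δ') (hr : r ∈ Set.Icc δ' δ) (φ u ψ : ℝ) :
    tubePoint r φ u ψ ∈ tubeSet δ' δ := by
  have h : ‖tubePoint r φ u ψ 1‖ = r * ‖tubePoint r φ u ψ 0‖ := by
    rw [tubePoint_one, norm_mul, norm_mul, norm_exp_ofReal_mul_I, mul_one, norm_real,
      Real.norm_of_nonneg (h0.trans hr.1)]
  refine ⟨exp_ne_zero _, ?_, ?_⟩ <;> rw [h]
  · exact mul_le_mul_of_nonneg_right hr.1 (norm_nonneg _)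
  · exact mul_le_mul_of_nonneg_right hr.2 (norm_nonneg _)

/-- Stokes' theorem for the tube `δ' ≤ |y / x| ≤ δ`, whose other faces cancel. -/
theorem integral_tube_extDeriv (hq : ‖(q : ℂ)‖ < 1) {X : Opens (Hopf q 2)} (ω : Form X 3)
    {δ' δ : ℝ} (h0 : 0 ≤ δ') (hδ : δ' ≤ δ) (hX : tubeSet δ' δ ⊆ cover X) :
    cubeIntegral (fun s : Fin 4 → ℝ => tubePoint (s 0) (s 1) (s 2) (s 3))
        ![δ', 0, Real.log ‖(q : ℂ)‖, 0] ![δ, 2 * Real.pi, 0, 2 * Real.pi] (extDeriv ω.1) =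
      integralBdryR₁ q δ ω.1 - integralBdryR₁ q δ' ω.1 := by
  have hab : (![δ', 0, Real.log ‖(q : ℂ)‖, 0] : Fin 4 → ℝ) ≤ ![δ, 2 * Real.pi, 0, 2 * Real.pi] := by
    intro i
    fin_cases i
    · exact hδ
    · exact Real.two_pi_pos.le
    · exact (log_norm_neg hq).le
    · exact Real.two_pi_pos.le
  rw [cubeIntegral_extDeriv contDiff_tube hab, Fin.sum_univ_four]
  · have e0 : ∀ t, cubeIntegral (fun y : Fin 3 → ℝ =>
        (fun s : Fin 4 → ℝ => tubePoint (s 0) (s 1) (s 2) (s 3)) ((0 : Fin 4).insertNth t y))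
        (fun j => (![δ', 0, Real.log ‖(q : ℂ)‖, 0] : Fin 4 → ℝ) ((0 : Fin 4).succAbove j))
        (fun j => (![δ, 2 * Real.pi, 0, 2 * Real.pi] : Fin 4 → ℝ) ((0 : Fin 4).succAbove j)) ω.1 =
        integralBdryR₁ q t ω.1 := by
      intro t
      rw [integralBdryR₁]
      congr 1
    have e1 : (fun y : Fin 3 → ℝ => (fun s : Fin 4 → ℝ => tubePoint (s 0) (s 1) (s 2) (s 3))
        ((1 : Fin 4).insertNth ((![δ, 2 * Real.pi, 0, 2 * Real.pi] : Fin 4 → ℝ) 1) y)) =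
        fun y : Fin 3 → ℝ => (fun s : Fin 4 → ℝ => tubePoint (s 0) (s 1) (s 2) (s 3))
        ((1 : Fin 4).insertNth ((![δ', 0, Real.log ‖(q : ℂ)‖, 0] : Fin 4 → ℝ) 1) y) := by
      funext y
      exact tubePoint_angle_two_pi (y 0) (y 1) (y 2)
    have e3 : (fun y : Fin 3 → ℝ => (fun s : Fin 4 → ℝ => tubePoint (s 0) (s 1) (s 2) (s 3))
        ((3 : Fin 4).insertNth ((![δ, 2 * Real.pi, 0, 2 * Real.pi] : Fin 4 → ℝ) 3) y)) =
        fun y : Fin 3 → ℝ => (fun s : Fin 4 → ℝ => tubePoint (s 0) (s 1) (s 2) (s 3))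
        ((3 : Fin 4).insertNth ((![δ', 0, Real.log ‖(q : ℂ)‖, 0] : Fin 4 → ℝ) 3) y) := by
      funext y
      have h := tubePoint_add_two_pi (y 0) (y 1) (y 2) 0
      rw [zero_add] at h
      exact h
    have e2 := cubeIntegral_shift ω 2
      (c := fun y : Fin 3 → ℝ => (fun s : Fin 4 → ℝ => tubePoint (s 0) (s 1) (s 2) (s 3))
        ((2 : Fin 4).insertNth ((![δ, 2 * Real.pi, 0, 2 * Real.pi] : Fin 4 → ℝ) 2) y))
      (c' := fun y : Fin 3 → ℝ => (fun s : Fin 4 → ℝ => tubePoint (s 0) (s 1) (s 2) (s 3))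
        ((2 : Fin 4).insertNth ((![δ', 0, Real.log ‖(q : ℂ)‖, 0] : Fin 4 → ℝ) 2) y))
      (a := (fun j => (![δ', 0, Real.log ‖(q : ℂ)‖, 0] : Fin 4 → ℝ) ((2 : Fin 4).succAbove j)))
      (b := (fun j => (![δ, 2 * Real.pi, 0, 2 * Real.pi] : Fin 4 → ℝ) ((2 : Fin 4).succAbove j)))
      (contDiff_tube.comp (by
        rw [contDiff_pi]
        intro j
        refine Fin.succAboveCases (2 : Fin 4) ?_ (fun j => ?_) j
        · simpa using contDiff_const
        · simpa using contDiff_apply ℝ ℝ j)) Real.two_pi_pos.le (-arg q)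
      (fun x hx => hX (tubePoint_mem_tubeSet h0 (hx 0) _ _ _))
      (fun x => by
        have h := tubePoint_add_two_pi (x 0) (x 1) 0 (x 2)
        refine Eq.trans ?_ h
        change tubePoint (x 0 + _) (x 1 + _) 0 (x 2 + (2 * Real.pi - 0)) = _
        simp)
      (fun x => by
        refine (tubePoint_shift q (x 0) (x 1) (x 2)).trans ?_
        congr 1
        change _ = tubePoint (x 0 + _) (x 1 + _) 0 (x 2 + (-arg q))
        simp)
    rw [e0, e0, e1, e2, e3]
    simp
  · intro x hx
    refine Form.contDiffAt ω (hX (tubePoint_mem_tubeSet h0 ⟨hx.1 0, hx.2 0⟩ _ _ _))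

theorem integralBdryR₁_zero (q : ℂˣ) (ω : Vec 2 → Alt 2 3) : integralBdryR₁ q 0 ω = 0 := by
  rw [integralBdryR₁, cubeIntegral]
  refine MeasureTheory.integral_eq_zero_of_ae (Filter.Eventually.of_forall fun s => ?_)
  refine (ω _).map_coord_zero 0 ?_
  -- the parametrization does not depend on the angle when the radius is zero
  have hd : DifferentiableAt ℝ (fun s : Fin 3 → ℝ => tubePoint 0 (s 0) (s 1) (s 2)) s :=
    ((contDiff_tube_bdry 0).differentiable (by simp)).differentiableAt
  have hl := hd.hasFDerivAt.comp_hasDerivAt_of_eq (0 : ℝ)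
    (((hasDerivAt_id (0 : ℝ)).smul_const (Pi.single 0 1 : Fin 3 → ℝ)).const_add s) (by simp)
  rw [one_smul] at hl
  refine hl.unique ?_
  refine (hasDerivAt_const (0 : ℝ) (tubePoint 0 (s 0) (s 1) (s 2))).congr_of_eventuallyEq
    (Filter.Eventually.of_forall fun t => ?_)
  simp [tubePoint]

/-- The integral of an exact form over the closed manifold `|y / x| = δ` vanishes. -/
theorem integralBdryR₁_extDeriv (hq : ‖(q : ℂ)‖ < 1) {X : Opens (Hopf q 2)} (ω : Form X 2)
    {δ : ℝ} (h0 : 0 ≤ δ) (hX : tubeSet δ δ ⊆ cover X) :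
    integralBdryR₁ q δ (extDeriv ω.1) = 0 := by
  have hab : (![0, Real.log ‖(q : ℂ)‖, 0] : Fin 3 → ℝ) ≤ ![2 * Real.pi, 0, 2 * Real.pi] := by
    intro i
    fin_cases i
    · exact Real.two_pi_pos.le
    · exact (log_norm_neg hq).le
    · exact Real.two_pi_pos.le
  have hc := contDiff_tube_bdry δ
  rw [integralBdryR₁, cubeIntegral_extDeriv hc hab, Fin.sum_univ_three]
  · have e0 : (fun y : Fin 2 → ℝ => (fun s : Fin 3 → ℝ => tubePoint δ (s 0) (s 1) (s 2))
        ((0 : Fin 3).insertNth ((![2 * Real.pi, 0, 2 * Real.pi] : Fin 3 → ℝ) 0) y)) =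
        fun y : Fin 2 → ℝ => (fun s : Fin 3 → ℝ => tubePoint δ (s 0) (s 1) (s 2))
        ((0 : Fin 3).insertNth ((![0, Real.log ‖(q : ℂ)‖, 0] : Fin 3 → ℝ) 0) y) := by
      funext y
      exact tubePoint_angle_two_pi δ (y 0) (y 1)
    have e2 : (fun y : Fin 2 → ℝ => (fun s : Fin 3 → ℝ => tubePoint δ (s 0) (s 1) (s 2))
        ((2 : Fin 3).insertNth ((![2 * Real.pi, 0, 2 * Real.pi] : Fin 3 → ℝ) 2) y)) =
        fun y : Fin 2 → ℝ => (fun s : Fin 3 → ℝ => tubePoint δ (s 0) (s 1) (s 2))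
        ((2 : Fin 3).insertNth ((![0, Real.log ‖(q : ℂ)‖, 0] : Fin 3 → ℝ) 2) y) := by
      funext y
      have h := tubePoint_add_two_pi δ (y 0) (y 1) 0
      rw [zero_add] at h
      exact h
    have e1 := cubeIntegral_shift ω 1
      (c := fun y : Fin 2 → ℝ => (fun s : Fin 3 → ℝ => tubePoint δ (s 0) (s 1) (s 2))
        ((1 : Fin 3).insertNth ((![2 * Real.pi, 0, 2 * Real.pi] : Fin 3 → ℝ) 1) y))
      (c' := fun y : Fin 2 → ℝ => (fun s : Fin 3 → ℝ => tubePoint δ (s 0) (s 1) (s 2))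
        ((1 : Fin 3).insertNth ((![0, Real.log ‖(q : ℂ)‖, 0] : Fin 3 → ℝ) 1) y))
      (a := (fun j => (![0, Real.log ‖(q : ℂ)‖, 0] : Fin 3 → ℝ) ((1 : Fin 3).succAbove j)))
      (b := (fun j => (![2 * Real.pi, 0, 2 * Real.pi] : Fin 3 → ℝ) ((1 : Fin 3).succAbove j)))
      (hc.comp (by
        rw [contDiff_pi]
        intro j
        refine Fin.succAboveCases (1 : Fin 3) ?_ (fun j => ?_) j
        · simpa using contDiff_const
        · simpa using contDiff_apply ℝ ℝ j)) Real.two_pi_pos.le (-arg q)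
      (fun x hx => hX (tubePoint_mem_tubeSet h0 ⟨le_rfl, le_rfl⟩ _ _ _))
      (fun x => by
        have h := tubePoint_add_two_pi δ (x 0) 0 (x 1)
        refine Eq.trans ?_ h
        change tubePoint δ (x 0 + _) 0 (x 1 + (2 * Real.pi - 0)) = _
        simp)
      (fun x => by
        refine (tubePoint_shift q δ (x 0) (x 1)).trans ?_
        congr 1
        change _ = tubePoint δ (x 0 + _) 0 (x 1 + (-arg q))
        simp)
    rw [e0, e1, e2]
    simp
  · intro x hx
    refine Form.contDiffAt ω (hX (tubePoint_mem_tubeSet h0 ⟨le_rfl, le_rfl⟩ _ _ _))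

/-- The integral of an exact form over the elliptic curve vanishes. -/
theorem integralC_extDeriv (hq : ‖(q : ℂ)‖ < 1) (ω : Form (⊤ : Opens (Hopf q 1)) 1) :
    integralC q (extDeriv ω.1) = 0 := by
  have hab : (![Real.log ‖(q : ℂ)‖, 0] : Fin 2 → ℝ) ≤ ![0, 2 * Real.pi] := by
    intro i
    fin_cases i
    · exact (log_norm_neg hq).le
    · exact Real.two_pi_pos.le
  have hc : ContDiff ℝ (⊤ : ℕ∞) fun s : Fin 2 → ℝ => (![exp (s 0 + s 1 * I)] : Vec 1) := by
    rw [contDiff_pi]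
    intro i
    fin_cases i
    exact ((contDiff_ofReal_coord 0).add ((contDiff_ofReal_coord 1).mul contDiff_const)).cexp
  have hmem : ∀ z : ℂ, (![exp z] : Vec 1) ∈ cover (⊤ : Opens (Hopf q 1)) := by
    intro z
    refine ⟨fun h => exp_ne_zero z ?_, trivial⟩
    exact congrFun h 0
  rw [integralC, cubeIntegral_extDeriv hc hab, Fin.sum_univ_two]
  · have e1 : (fun y : Fin 1 → ℝ => (fun s : Fin 2 → ℝ => (![exp (s 0 + s 1 * I)] : Vec 1))
        ((1 : Fin 2).insertNth ((![0, 2 * Real.pi] : Fin 2 → ℝ) 1) y)) =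
        fun y : Fin 1 → ℝ => (fun s : Fin 2 → ℝ => (![exp (s 0 + s 1 * I)] : Vec 1))
        ((1 : Fin 2).insertNth ((![Real.log ‖(q : ℂ)‖, 0] : Fin 2 → ℝ) 1) y) := by
      funext y
      exact congrArg (fun z => (![z] : Vec 1)) (exp_two_pi (y 0))
    have e0 := cubeIntegral_shift ω 0
      (c := fun y : Fin 1 → ℝ => (fun s : Fin 2 → ℝ => (![exp (s 0 + s 1 * I)] : Vec 1))
        ((0 : Fin 2).insertNth ((![0, 2 * Real.pi] : Fin 2 → ℝ) 0) y))
      (c' := fun y : Fin 1 → ℝ => (fun s : Fin 2 → ℝ => (![exp (s 0 + s 1 * I)] : Vec 1))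
        ((0 : Fin 2).insertNth ((![Real.log ‖(q : ℂ)‖, 0] : Fin 2 → ℝ) 0) y))
      (a := (fun j => (![Real.log ‖(q : ℂ)‖, 0] : Fin 2 → ℝ) ((0 : Fin 2).succAbove j)))
      (b := (fun j => (![0, 2 * Real.pi] : Fin 2 → ℝ) ((0 : Fin 2).succAbove j)))
      (hc.comp (by
        rw [contDiff_pi]
        intro j
        refine Fin.succAboveCases (0 : Fin 2) ?_ (fun j => ?_) j
        · simpa using contDiff_const
        · simpa using contDiff_apply ℝ ℝ j)) Real.two_pi_pos.le (-arg q)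
      (fun x hx => hmem _)
      (fun x => by
        have h := exp_add_two_pi 0 (x 0)
        refine Eq.trans ?_ (congrArg (fun z => (![z] : Vec 1)) h)
        change (![exp ((0 : ℝ) + (x 0 + (2 * Real.pi - 0) : ℝ) * I)] : Vec 1) = _
        rw [sub_zero])
      (fun x => by
        refine (congrArg (fun z => (![z] : Vec 1)) (exp_shift q (x 0))).trans ?_
        ext j
        fin_cases j
        rfl)
    rw [e0, e1]
    simp
  · intro x hx
    exact Form.contDiffAt ω (hmem _)

end

section

open MeasureTheory
variable {q : ℂˣ} {n k m : ℕ} {U : Opens (Hopf q n)}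

/-! ### Forms given by explicit formulas -/

open Classical in
/-- The form on `U` given by an invariant form on the inverse image of `U`. -/
def Form.ofCover (U : Opens (Hopf q n)) (ω : Vec n → Alt n k)
    (h : ContDiffOn ℝ (⊤ : ℕ∞) ω (cover U))
    (h' : ∀ p ∈ cover U, ∀ v, ω ((q : ℂ) • p) (fun i => (q : ℂ) • v i) = ω p v) : Form U k :=
  ⟨(cover U).indicator ω, h.congr fun p hp => by simp [hp],
    fun p hp v => by
      simp only [Set.indicator_of_mem hp, Set.indicator_of_mem (smul_mem_cover hp)]
      exact h' p hp v,
    fun p hp => by simp [hp]⟩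

theorem Form.ofCover_apply {ω : Vec n → Alt n k} {h : ContDiffOn ℝ (⊤ : ℕ∞) ω (cover U)}
    {h' : ∀ p ∈ cover U, ∀ v, ω ((q : ℂ) • p) (fun i => (q : ℂ) • v i) = ω p v} {p : Vec n}
    (hp : p ∈ cover U) : (Form.ofCover U ω h h').1 p = ω p := by
  simp [Form.ofCover, hp]

theorem mem_cover_top {p : Vec n} : p ∈ cover (⊤ : Opens (Hopf q n)) ↔ p ≠ 0 :=
  ⟨fun ⟨h, _⟩ => h, fun h => ⟨h, trivial⟩⟩

theorem mk_mem_coordOpen {i : Fin n} {p : Vec n} (hp : p ≠ 0) :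
    Hopf.mk q p hp ∈ coordOpen q i ↔ p i ≠ 0 := by
  constructor
  · rintro ⟨p', hp', h, hi⟩
    obtain ⟨k, hk⟩ := Quotient.exact h
    have h2 : ((q ^ k : ℂˣ) : ℂ) * p' i = p i := congrFun hk i
    rw [← h2]
    exact mul_ne_zero (Units.ne_zero _) hi
  · intro h
    exact ⟨p, hp, rfl, h⟩

theorem mem_cover_coordOpen {i : Fin n} {p : Vec n} : p ∈ cover (coordOpen q i) ↔ p i ≠ 0 := by
  constructor
  · rintro ⟨hp, h⟩
    exact (mk_mem_coordOpen hp).1 h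
  · intro h
    have hp : p ≠ 0 := fun h0 => h (by rw [h0]; rfl)
    exact ⟨hp, (mk_mem_coordOpen hp).2 h⟩

theorem mem_cover_inf {U W : Opens (Hopf q n)} {p : Vec n} :
    p ∈ cover (U ⊓ W) ↔ p ∈ cover U ∧ p ∈ cover W :=
  ⟨fun ⟨h, h1, h2⟩ => ⟨⟨h, h1⟩, ⟨h, h2⟩⟩, fun ⟨⟨h, h1⟩, ⟨_, h2⟩⟩ => ⟨h, h1, h2⟩⟩

theorem ne_zero_of_mem_cover {p : Vec n} (hp : p ∈ cover U) : p ≠ 0 := hp.1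

@[simp] theorem val_fn (f : Vec n → ℂ) : val (fn f) = f := rfl

theorem contDiffOn_fn {f : Vec n → ℂ} {s : Set (Vec n)} {m : WithTop ℕ∞}
    (h : ContDiffOn ℝ m f s) : ContDiffOn ℝ m (fn f) s :=
  (ContinuousAlternatingMap.constOfIsEmptyLIE ℝ (Vec n) ℂ (Fin 0)).contDiff.comp_contDiffOn h

theorem contDiffAt_fn {f : Vec n → ℂ} {p : Vec n} {m : WithTop ℕ∞}
    (h : ContDiffAt ℝ m f p) : ContDiffAt ℝ m (fn f) p :=
  (ContinuousAlternatingMap.constOfIsEmptyLIE ℝ (Vec n) ℂ (Fin 0)).contDiff.contDiffAt.comp p h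

theorem differentiableAt_fn {f : Vec n → ℂ} {p : Vec n}
    (h : DifferentiableAt ℝ f p) : DifferentiableAt ℝ (fn f) p :=
  (ContinuousAlternatingMap.constOfIsEmptyLIE ℝ (Vec n) ℂ
    (Fin 0)).toContinuousLinearEquiv.differentiableAt.comp p h

theorem dop_fn {ε : ℂ} {f : Vec n → ℂ} {p : Vec n} (h : DifferentiableAt ℝ f p) :
    dop ε (fn f) p = ofLin (part ε (fderiv ℝ f p)) := by
  rw [← ofLin_toLin (dop ε (fn f) p), toLin_dop (differentiableAt_fn h), val_fn]

/-- An invariant function as a `0`-form. -/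
def Form.ofFun (U : Opens (Hopf q n)) (f : Vec n → ℂ) (h : ContDiffOn ℝ (⊤ : ℕ∞) f (cover U))
    (h' : ∀ p ∈ cover U, f ((q : ℂ) • p) = f p) : Form U 0 :=
  Form.ofCover U (fn f) (contDiffOn_fn h) fun p hp _ => h' p hp

theorem Form.ofFun_apply {f : Vec n → ℂ} {h : ContDiffOn ℝ (⊤ : ℕ∞) f (cover U)}
    {h' : ∀ p ∈ cover U, f ((q : ℂ) • p) = f p} {p : Vec n} (hp : p ∈ cover U) :
    (Form.ofFun U f h h').1 p = fn f p :=
  Form.ofCover_apply hp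

theorem Form.val_ofFun {f : Vec n → ℂ} {h : ContDiffOn ℝ (⊤ : ℕ∞) f (cover U)}
    {h' : ∀ p ∈ cover U, f ((q : ℂ) • p) = f p} {p : Vec n} (hp : p ∈ cover U) :
    val (Form.ofFun U f h h').1 p = f p := by
  rw [val, Form.ofFun_apply hp]
  rfl

theorem Form.ddbar_apply (s : Form U 0) {p : Vec n} (hp : p ∈ cover U) :
    (Form.ddbar U s).1 p = dop 1 (dop (-1) s.1) p := by
  have e : (Form.ddbar U s).1 p = (Form.delbar U 1 (Form.del U 0 s)).1 p := rfl
  rw [e, Form.delbar_apply _ hp,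
    dop_congr (Form.eventuallyEq (fun x => Form.del_apply s) hp)]

theorem dop_congr_eventually {ε : ℂ} {ω ω' : Vec n → Alt n k} {p : Vec n} (h : ω =ᶠ[nhds p] ω') :
    dop ε ω =ᶠ[nhds p] dop ε ω' :=
  h.eventuallyEq_nhds.mono fun _ hx => dop_congr hx

theorem Form.ddbar_ofFun {f : Vec n → ℂ} {h : ContDiffOn ℝ (⊤ : ℕ∞) f (cover U)}
    {h' : ∀ p ∈ cover U, f ((q : ℂ) • p) = f p} {p : Vec n} (hp : p ∈ cover U) :
    (Form.ddbar U (Form.ofFun U f h h')).1 p = dop 1 (dop (-1) (fn f)) p := by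
  rw [Form.ddbar_apply _ hp]
  exact dop_congr (dop_congr_eventually (Form.eventuallyEq (fun x hx => Form.ofFun_apply hx) hp))

theorem Form.ext_val {s t : Form U 0} (h : ∀ p ∈ cover U, val s.1 p = val t.1 p) : s = t := by
  refine Form.ext_on fun p hp => ?_
  ext v
  rw [Subsingleton.elim v ![]]
  exact h p hp

theorem Form.res_apply {U W : Opens (Hopf q n)} (h : W ≤ U) (ω : Form U k) {p : Vec n}
    (hp : p ∈ cover W) : (Form.res h k ω).1 p = ω.1 p := by
  simp [Form.res, hp]

theorem Form.val_res {U W : Opens (Hopf q n)} (h : W ≤ U) (s : Form U 0) {p : Vec n}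
    (hp : p ∈ cover W) : val (Form.res h 0 s).1 p = val s.1 p := by
  rw [val, Form.res_apply h s hp]
  rfl

/-! ### Complex linear and antilinear derivatives -/

section Linear
variable {F : Type*} [NormedAddCommGroup F] [NormedSpace ℂ F] {D : Vec n →L[ℝ] F}

theorem part_neg_one_of_linear (h : ∀ v, D (I • v) = I • D v) : part (-1) D = D := by
  ext v
  rw [part_apply, h, smul_smul, neg_one_mul, neg_mul, I_mul_I, neg_neg, one_smul]
  module

theorem part_one_of_linear (h : ∀ v, D (I • v) = I • D v) : part 1 D = 0 := by
  ext v
  rw [part_apply, h, smul_smul, one_mul, I_mul_I, neg_one_smul, add_neg_cancel, smul_zero]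
  rfl

theorem part_neg_one_of_antilinear (h : ∀ v, D (I • v) = -(I • D v)) : part (-1) D = 0 := by
  ext v
  rw [part_apply, h, smul_neg, smul_smul, neg_one_mul, neg_mul, I_mul_I, neg_neg, one_smul,
    add_neg_cancel, smul_zero]
  rfl

theorem part_one_of_antilinear (h : ∀ v, D (I • v) = -(I • D v)) : part 1 D = D := by
  ext v
  rw [part_apply, h, smul_neg, smul_smul, one_mul, I_mul_I, neg_one_smul, neg_neg]
  module

theorem part_neg_one_add_part_one (D : Vec n →L[ℝ] F) : part (-1) D + part 1 D = D := by
  ext v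
  rw [add_apply, part_apply, part_apply]
  module

end Linear

/-- `dz_i` as a real linear map. -/
abbrev dz (i : Fin n) : Vec n →L[ℝ] ℂ := ContinuousLinearMap.proj i

/-- `dz̄_i` as a real linear map. -/
abbrev dzBar (i : Fin n) : Vec n →L[ℝ] ℂ :=
  (conjCLE : ℂ →L[ℝ] ℂ).comp (ContinuousLinearMap.proj i)

theorem smul_dz_I (c : ℂ) (i : Fin n) (v : Vec n) : (c • dz i) (I • v) = I • (c • dz i) v := by
  simp
  ring

theorem smul_dzBar_I (c : ℂ) (i : Fin n) (v : Vec n) :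
    (c • dzBar i) (I • v) = -(I • (c • dzBar i) v) := by
  simp
  ring

theorem part_neg_one_dz_add (a b : ℂ) (i : Fin n) :
    part (-1) (a • dz i + b • dzBar i) = a • dz i := by
  rw [part_add, part_neg_one_of_linear (smul_dz_I a i), part_neg_one_of_antilinear
    (smul_dzBar_I b i), add_zero]

theorem part_one_dz_add (a b : ℂ) (i : Fin n) : part 1 (a • dz i + b • dzBar i) = b • dzBar i := by
  rw [part_add, part_one_of_linear (smul_dz_I a i), part_one_of_antilinear
    (smul_dzBar_I b i), zero_add]

theorem hasFDerivAt_log_norm_sq {i : Fin n} {p : Vec n} (h : p i ≠ 0) :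
    HasFDerivAt (fun x : Vec n => ((Real.log (‖x i‖ ^ 2) : ℝ) : ℂ))
      ((p i)⁻¹ • dz i + (starRingEnd ℂ (p i))⁻¹ • dzBar i) p := by
  have h1 : HasFDerivAt (fun x : Vec n => ‖x i‖ ^ 2) _ p :=
    (ContinuousLinearMap.proj (R := ℝ) (φ := fun _ : Fin n => ℂ) i).hasFDerivAt.norm_sq
  have h2 := ofRealCLM.hasFDerivAt.comp p (h1.log (by positivity))
  refine h2.congr_fderiv ?_
  ext v
  have hc : starRingEnd ℂ (p i) ≠ 0 := (map_ne_zero _).2 h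
  have e : ((‖p i‖ : ℂ)) ^ 2 = p i * starRingEnd ℂ (p i) := by
    rw [mul_conj, normSq_eq_norm_sq]
    push_cast
    rfl
  have e2 : (((v i).re : ℂ) * (p i).re + (v i).im * (p i).im) * 2 =
      v i * starRingEnd ℂ (p i) + p i * starRingEnd ℂ (v i) := by
    apply Complex.ext <;> simp <;> ring
  simp
  field_simp
  rw [e]
  field_simp
  linear_combination e2

theorem contDiffAt_log_norm_sq {i : Fin n} {p : Vec n} (h : p i ≠ 0) {m : WithTop ℕ∞}
    (hm : m ≤ (⊤ : ℕ∞)) :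
    ContDiffAt ℝ m (fun x : Vec n => ((Real.log (‖x i‖ ^ 2) : ℝ) : ℂ)) p := by
  refine ContDiffAt.of_le
    (ofRealCLM.contDiff.contDiffAt.comp p (ContDiffAt.log ?_ (by positivity))) hm
  exact (contDiff_apply ℝ ℂ i).contDiffAt.norm_sq ℝ

theorem dop_log_norm_sq_neg_one {i : Fin n} {p : Vec n} (h : p i ≠ 0) :
    dop (-1) (fn fun x : Vec n => ((Real.log (‖x i‖ ^ 2) : ℝ) : ℂ)) p = dlog i p := by
  rw [dop_fn (hasFDerivAt_log_norm_sq h).differentiableAt, (hasFDerivAt_log_norm_sq h).fderiv,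
    part_neg_one_dz_add, dlog]

theorem dop_log_norm_sq_one {i : Fin n} {p : Vec n} (h : p i ≠ 0) :
    dop 1 (fn fun x : Vec n => ((Real.log (‖x i‖ ^ 2) : ℝ) : ℂ)) p = dlogBar i p := by
  rw [dop_fn (hasFDerivAt_log_norm_sq h).differentiableAt, (hasFDerivAt_log_norm_sq h).fderiv,
    part_one_dz_add, dlogBar]

theorem isOpen_coord_ne (i : Fin n) : IsOpen {p : Vec n | p i ≠ 0} :=
  isOpen_ne_fun (continuous_apply i) continuous_const

theorem hasFDerivAt_inv_coord {i : Fin n} {p : Vec n} (h : p i ≠ 0) :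
    HasFDerivAt (fun x : Vec n => (x i)⁻¹) ((-((p i) ^ 2)⁻¹ : ℂ) • dz i) p := by
  have h1 := ((hasDerivAt_inv h).hasFDerivAt.restrictScalars ℝ).comp p (dz (n := n) i).hasFDerivAt
  refine h1.congr_fderiv ?_
  ext v
  simp
  ring

theorem dlog_eq_smul (i : Fin n) : dlog i = fun p => (p i)⁻¹ • ofLin (dz (n := n) i) := rfl

/-- The form `d log z_i` is holomorphic and closed. -/
theorem dop_dlog {i : Fin n} {p : Vec n} (h : p i ≠ 0) {ε : ℂ} (hε : ε = -1 ∨ ε = 1) :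
    dop ε (dlog i) p = 0 := by
  have hi := hasFDerivAt_inv_coord h
  rcases hε with rfl | rfl
  · have e : dlog i =ᶠ[nhds p]
        dop (-1) (fn fun x : Vec n => ((Real.log (‖x i‖ ^ 2) : ℝ) : ℂ)) := by
      filter_upwards [(isOpen_coord_ne i).mem_nhds h] with x hx
      exact (dop_log_norm_sq_neg_one hx).symm
    rw [dop_congr e]
    exact dop_dop_self (contDiffAt_fn (contDiffAt_log_norm_sq h
      (WithTop.coe_le_coe.2 (le_top : (2 : ℕ∞) ≤ ⊤))))
  · rw [dlog_eq_smul, dop_smul hi.differentiableAt (differentiableAt_const _), hi.fderiv,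
      part_one_of_linear (smul_dz_I _ i)]
    have e0 : dop 1 (fun _ : Vec n => ofLin (dz (n := n) i)) p = 0 := by
      rw [dop, fderiv_fun_const]
      ext v
      simp [ContinuousAlternatingMap.alternatizeUncurryFin_apply, part_apply]
    rw [e0, smul_zero, add_zero]
    exact LinearMap.map_zero₂ ((wedgeLinL n 1).toLinearMap₁₂) _

/-- `∂̄∂ log |z_i|² = 0`. -/
theorem dop_dop_log_norm_sq {i : Fin n} {p : Vec n} (h : p i ≠ 0) :
    dop 1 (dop (-1) (fn fun x : Vec n => ((Real.log (‖x i‖ ^ 2) : ℝ) : ℂ))) p = 0 := by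
  rw [← dop_dlog h (Or.inr rfl)]
  refine dop_congr ?_
  filter_upwards [(isOpen_coord_ne i).mem_nhds h] with x hx
  exact dop_log_norm_sq_neg_one hx

end

section

open MeasureTheory
variable {q : ℂˣ} {n k m : ℕ} {U : Opens (Hopf q n)}

/-! ### Metrics and connections of the hyperplane bundle -/

theorem isType10_iff {θ : Connection U} :
    IsType10 θ ↔ ∀ p ∈ cover U, ∀ (c : ℂ) (v : Vec n),
      toLin (θ.1 p) (c • v) = c * toLin (θ.1 p) v := by
  constructor
  · intro h p _ c v
    have h1 := h p ![v] c
    rw [toLin_apply, toLin_apply]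
    have e : (fun i => c • (![v] : Fin 1 → Vec n) i) = ![c • v] := by
      ext i
      fin_cases i
      rfl
    rw [e] at h1
    rw [h1]
    simp
  · intro h p v c
    by_cases hp : p ∈ cover U
    · have h1 := h p hp c (v 0)
      rw [toLin_apply, toLin_apply] at h1
      have e : ∀ w : Fin 1 → Vec n, w = ![w 0] := fun w => by
        ext i
        fin_cases i
        rfl
      rw [e v, e (fun i => c • (![v 0] : Fin 1 → Vec n) i)]
      simpa using h1
    · rw [θ.2.2.2 p hp]
      simp

theorem isType10_of_dop {θ : Connection U} {f : Vec n → Vec n →L[ℝ] ℂ}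
    (h : ∀ p ∈ cover U, θ.1 p = ofLin (part (-1) (f p))) : IsType10 θ := by
  refine isType10_iff.2 fun p hp c v => ?_
  rw [h p hp, toLin_ofLin, part_neg_one_smul, smul_eq_mul]

/-- The linear coordinates are holomorphic sections of the hyperplane bundle. -/
theorem isSection_coord (U : Opens (Hopf q n)) (i : Fin n) : IsSection U fun p => p i :=
  ⟨(contDiff_apply ℝ ℂ i).contDiffOn,
    fun v => (LinearMap.proj i : Vec n →ₗ[ℂ] ℂ).comp (hopfProj v).submodule.subtype,
    fun _ _ _ => rfl⟩

namespace HermMetric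

variable (h : HermMetric U)

theorem differentiableAt {p : Vec n} (hp : p ∈ cover U) : DifferentiableAt ℝ h.N p :=
  (h.smooth.contDiffAt ((isOpen_cover U).mem_nhds hp)).differentiableAt (by simp)

/-- The function `log h(ν, ν)`. -/
def logN (p : Vec n) : ℂ := (Real.log (h.N p) : ℝ)

theorem contDiffOn_logN : ContDiffOn ℝ (⊤ : ℕ∞) h.logN (cover U) :=
  ofRealCLM.contDiff.comp_contDiffOn (h.smooth.log fun p hp => (h.pos p hp).ne')

theorem contDiffAt_logN {p : Vec n} (hp : p ∈ cover U) : ContDiffAt ℝ (⊤ : ℕ∞) h.logN p :=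
  h.contDiffOn_logN.contDiffAt ((isOpen_cover U).mem_nhds hp)

theorem contDiffAt_two_logN {p : Vec n} (hp : p ∈ cover U) : ContDiffAt ℝ 2 h.logN p :=
  (h.contDiffAt_logN hp).of_le (WithTop.coe_le_coe.2 (le_top : (2 : ℕ∞) ≤ ⊤))

theorem differentiableAt_logN {p : Vec n} (hp : p ∈ cover U) : DifferentiableAt ℝ h.logN p :=
  (h.contDiffAt_logN hp).differentiableAt (by simp)

theorem hasFDerivAt_logN {p : Vec n} (hp : p ∈ cover U) :
    HasFDerivAt h.logN (ofRealCLM.comp ((h.N p)⁻¹ • fderiv ℝ h.N p)) p :=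
  ofRealCLM.hasFDerivAt.comp p ((h.differentiableAt hp).hasFDerivAt.log (h.pos p hp).ne')

theorem logN_smul {p : Vec n} (hp : p ∈ cover U) :
    h.logN ((q : ℂ) • p) = (Real.log ((‖(q : ℂ)‖ ^ 2)⁻¹) : ℝ) + h.logN p := by
  have hq : ‖(q : ℂ)‖ ≠ 0 := norm_ne_zero_iff.2 q.ne_zero
  rw [logN, h.equivariant p hp, Real.log_mul (by positivity) (h.pos p hp).ne']
  push_cast
  rfl

theorem fderiv_logN_smul {p : Vec n} (hp : p ∈ cover U) (v : Vec n) :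
    fderiv ℝ h.logN ((q : ℂ) • p) ((q : ℂ) • v) = fderiv ℝ h.logN p v := by
  have h1 : HasFDerivAt (fun x => h.logN (scal n (q : ℂ) x))
      ((fderiv ℝ h.logN ((q : ℂ) • p)).comp (scal n (q : ℂ))) p :=
    HasFDerivAt.comp p (h.differentiableAt_logN (smul_mem_cover hp)).hasFDerivAt
      (scal n (q : ℂ)).hasFDerivAt
  have h2 : HasFDerivAt (fun x => h.logN (scal n (q : ℂ) x)) (fderiv ℝ h.logN p) p := by
    refine ((h.differentiableAt_logN hp).hasFDerivAt.const_add
      ((Real.log ((‖(q : ℂ)‖ ^ 2)⁻¹) : ℝ) : ℂ)).congr_of_eventuallyEq ?_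
    filter_upwards [(isOpen_cover U).mem_nhds hp] with x hx
    exact h.logN_smul hx
  rw [h2.unique h1]
  rfl

/-- The metric connection of `h`, with connection form `∂ log h(ν, ν)`. -/
def connection : Connection U :=
  Form.ofCover U (fun p => ofLin (part (-1) (fderiv ℝ h.logN p)))
    ((ofLinL n).contDiff.comp_contDiffOn (contDiffOn_part
      (h.contDiffOn_logN.fderiv_of_isOpen (isOpen_cover U) (by simp))))
    (fun p hp v => by
      change part (-1) _ _ = part (-1) _ _
      rw [part_apply, part_apply, h.fderiv_logN_smul hp, smul_comm I, h.fderiv_logN_smul hp])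

theorem connection_apply {p : Vec n} (hp : p ∈ cover U) :
    h.connection.1 p = ofLin (part (-1) (fderiv ℝ h.logN p)) :=
  Form.ofCover_apply hp

theorem connection_eq_dop {p : Vec n} (hp : p ∈ cover U) :
    h.connection.1 p = dop (-1) (fn h.logN) p := by
  rw [h.connection_apply hp, dop_fn (h.differentiableAt_logN hp)]

end HermMetric

theorem fderiv_herm (h : HermMetric U) {s t : Vec n → ℂ} {p : Vec n} (hp : p ∈ cover U)
    (hs : DifferentiableAt ℝ s p) (ht : DifferentiableAt ℝ t p) (u : Vec n) :
    fderiv ℝ (h.herm s t) p u = fderiv ℝ h.N p u * (s p * starRingEnd ℂ (t p)) +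
      h.N p * (fderiv ℝ s p u * starRingEnd ℂ (t p) +
        s p * starRingEnd ℂ (fderiv ℝ t p u)) := by
  have h1 : HasFDerivAt (fun x => (h.N x : ℂ)) (ofRealCLM.comp (fderiv ℝ h.N p)) p :=
    ofRealCLM.hasFDerivAt.comp p (h.differentiableAt hp).hasFDerivAt
  have h2 : HasFDerivAt (fun x => starRingEnd ℂ (t x))
      ((conjCLE : ℂ →L[ℝ] ℂ).comp (fderiv ℝ t p)) p :=
    (conjCLE : ℂ →L[ℝ] ℂ).hasFDerivAt.comp p ht.hasFDerivAt
  have h3 : HasFDerivAt (h.herm s t) _ p := h1.mul (hs.hasFDerivAt.mul h2)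
  rw [h3.fderiv]
  simp
  ring

/-- A connection is compatible with `h` exactly when `d h(ν, ν) = (θ + θ̄) h(ν, ν)`. -/
theorem isHConnection_iff {h : HermMetric U} {θ : Connection U} :
    IsHConnection h θ ↔ ∀ p ∈ cover U, ∀ u : Vec n, (fderiv ℝ h.N p u : ℂ) =
      h.N p * (toLin (θ.1 p) u + starRingEnd ℂ (toLin (θ.1 p) u)) := by
  have hd : ∀ s, IsSection U s → ∀ p ∈ cover U, DifferentiableAt ℝ s p := fun s hs p hp =>
    (hs.1.contDiffAt ((isOpen_cover U).mem_nhds hp)).differentiableAt (by simp)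
  constructor
  · intro H p hp u
    obtain ⟨i, hi⟩ := Function.ne_iff.1 (ne_zero_of_mem_cover hp)
    have hs := isSection_coord U i
    have h1 := H _ _ hs hs p hp u
    rw [fderiv_herm h hp (hd _ hs p hp) (hd _ hs p hp)] at h1
    simp only [covDeriv, add_apply, smul_apply, smul_eq_mul, map_add, map_mul] at h1
    have h0 : p i * starRingEnd ℂ (p i) ≠ 0 := mul_ne_zero hi ((map_ne_zero _).2 hi)
    refine mul_right_cancel₀ h0 ?_
    linear_combination h1
  · intro H s t hs ht p hp u
    rw [fderiv_herm h hp (hd _ hs p hp) (hd _ ht p hp), H p hp u]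
    simp only [covDeriv, add_apply, smul_apply, smul_eq_mul, map_add, map_mul]
    ring

/-- A real linear form is twice the real part of its complex linear part. -/
theorem part_neg_one_add_conj (E : Vec n →L[ℝ] ℝ) (u : Vec n) :
    part (-1) (ofRealCLM.comp E) u + starRingEnd ℂ (part (-1) (ofRealCLM.comp E) u) = E u := by
  rw [part_apply]
  simp [conj_ofNat]
  ring

theorem HermMetric.isMetricConnection_connection (h : HermMetric U) :
    IsMetricConnection h h.connection := by
  refine ⟨isType10_of_dop fun p hp => h.connection_apply hp, isHConnection_iff.2 fun p hp u => ?_⟩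
  rw [h.connection_apply hp, toLin_ofLin, (h.hasFDerivAt_logN hp).fderiv, part_neg_one_add_conj]
  have : (h.N p : ℂ) ≠ 0 := ofReal_ne_zero.2 (h.pos p hp).ne'
  simp
  field_simp

/-- A connection of type `(1, 0)` compatible with a metric is unique, as its form is the complex
linear part of the derivative of `log h(ν, ν)`. -/
theorem IsMetricConnection.eq {h : HermMetric U} {θ : Connection U} (H : IsMetricConnection h θ) :
    θ = h.connection := by
  refine Form.ext_on fun p hp => ?_
  rw [h.connection_apply hp, ← ofLin_toLin (θ.1 p)]
  congr 1
  ext1 u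
  have h1 := isHConnection_iff.1 H.2 p hp u
  have h2 := isHConnection_iff.1 H.2 p hp (I • u)
  rw [isType10_iff.1 H.1 p hp] at h2
  have hN : (h.N p : ℂ) ≠ 0 := ofReal_ne_zero.2 (h.pos p hp).ne'
  rw [(h.hasFDerivAt_logN hp).fderiv, part_apply]
  simp only [ContinuousLinearMap.comp_apply, smul_apply, ofRealCLM_apply, smul_eq_mul]
  push_cast
  rw [h1, h2]
  simp only [map_mul, conj_I]
  field_simp
  linear_combination (toLin (θ.1 p) u - starRingEnd ℂ (toLin (θ.1 p) u)) * I_sq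

/-! ### Chern forms -/

theorem chernForm_mem_ZBC (h : HermMetric U) : chernForm h.connection ∈ ZBC U := by
  have h0 : Form.del U 1 h.connection = 0 := by
    refine Form.ext_on fun p hp => ?_
    rw [Form.del_apply _ hp, dop_congr (Form.eventuallyEq (fun x => h.connection_eq_dop) hp),
      dop_dop_self (contDiffAt_fn (h.contDiffAt_two_logN hp))]
    rfl
  refine ⟨?_, ?_⟩
  · rw [chernForm, Form.d_eq, h0, zero_add]
    exact Submodule.smul_mem _ _
      (Form.delbar_mem_type (a := 1) (b := 0) h.isMetricConnection_connection.1)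
  · change Form.d U 2 (_ • _) = 0
    rw [map_smul, Form.d_d, smul_zero]

theorem chernForm_connection_apply (h : HermMetric U) {p : Vec n} (hp : p ∈ cover U) :
    (chernForm h.connection).1 p =
      (I / (2 * Real.pi) : ℂ) • dop 1 (dop (-1) (fn h.logN)) p := by
  have e := Form.eventuallyEq (fun x => h.connection_eq_dop) hp
  rw [chernForm, Submodule.coe_smul, Pi.smul_apply, Form.d_eq, Submodule.coe_add, Pi.add_apply,
    Form.del_apply _ hp, Form.delbar_apply _ hp, dop_congr e, dop_congr e,
    dop_dop_self (contDiffAt_fn (h.contDiffAt_two_logN hp)), zero_add]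

/-- The function `log (h' / h)`, for two metrics. -/
def logRatio (h h' : HermMetric U) : Form U 0 :=
  Form.ofFun U (fun p => h'.logN p - h.logN p) (h'.contDiffOn_logN.sub h.contDiffOn_logN)
    fun p hp => by rw [h.logN_smul hp, h'.logN_smul hp, add_sub_add_left_eq_sub]

theorem dop_sub {ε : ℂ} {ω ω' : Vec n → Alt n k} {p : Vec n} (h : DifferentiableAt ℝ ω p)
    (h' : DifferentiableAt ℝ ω' p) :
    dop ε (fun x => ω x - ω' x) p = dop ε ω p - dop ε ω' p := by
  rw [dop, fderiv_fun_sub h h', part_sub, dop, dop]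
  exact map_sub (ContinuousAlternatingMap.alternatizeUncurryFinCLM ℝ (Vec n) ℂ) _ _

theorem dop_const_smul {ε : ℂ} {ω : Vec n → Alt n k} {p : Vec n} (c : ℂ)
    (h : DifferentiableAt ℝ ω p) :
    dop ε (fun x => c • ω x) p = c • dop ε ω p := by
  rw [dop, fderiv_fun_const_smul h, part_smul, dop]
  exact ContinuousAlternatingMap.alternatizeUncurryFin_smul ..

theorem differentiableAt_dop {ε : ℂ} {ω : Vec n → Alt n k} {p : Vec n} (h : ContDiffAt ℝ 2 ω p) :
    DifferentiableAt ℝ (dop ε ω) p := by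
  have h1 : DifferentiableAt ℝ (fderiv ℝ ω) p :=
    (h.fderiv_right (m := 1) (by norm_num)).differentiableAt (by norm_num)
  exact (ContinuousAlternatingMap.alternatizeUncurryFinCLM ℝ (Vec n) ℂ).differentiableAt.comp p
    (hasFDerivAt_part h1.hasFDerivAt).differentiableAt

theorem dop_dop_sub {ε ε' : ℂ} {ω ω' : Vec n → Alt n k} {p : Vec n} (h : ContDiffAt ℝ 2 ω p)
    (h' : ContDiffAt ℝ 2 ω' p) :
    dop ε (dop ε' fun x => ω x - ω' x) p = dop ε (dop ε' ω) p - dop ε (dop ε' ω') p := by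
  rw [← dop_sub (differentiableAt_dop h) (differentiableAt_dop h')]
  refine dop_congr ?_
  filter_upwards [h.eventually (by simp), h'.eventually (by simp)] with x hx hx'
  exact dop_sub (hx.differentiableAt (by norm_num)) (hx'.differentiableAt (by norm_num))

/-- The Chern forms of two metrics differ by `∂̄∂` of the logarithm of their ratio, so that the
Bott-Chern class does not depend on the metric. -/
theorem chernForm_sub (h h' : HermMetric U) :
    chernForm h'.connection - chernForm h.connection =
      Form.ddbar U ((I / (2 * Real.pi) : ℂ) • logRatio h h') := by
  refine Form.ext_on fun p hp => ?_
  rw [map_smul, Submodule.coe_sub, Pi.sub_apply, chernForm_connection_apply h hp,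
    chernForm_connection_apply h' hp, Submodule.coe_smul, Pi.smul_apply, logRatio,
    Form.ddbar_ofFun hp, ← smul_sub,
    ← dop_dop_sub (contDiffAt_fn (h'.contDiffAt_two_logN hp))
      (contDiffAt_fn (h.contDiffAt_two_logN hp))]
  rfl

/-- The metric with `h(ν, ν) = 1 / |z_i|²` where `z_i ≠ 0`. -/
def coordMetric (q : ℂˣ) (i : Fin n) : HermMetric (coordOpen q i) where
  N p := (‖p i‖ ^ 2)⁻¹
  smooth := ((contDiff_apply ℝ ℂ i).norm_sq ℝ).contDiffOn.inv fun p hp => by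
    have := mem_cover_coordOpen.1 hp
    positivity
  pos p hp := by
    have := mem_cover_coordOpen.1 hp
    positivity
  equivariant p _ := by
    rw [Pi.smul_apply, smul_eq_mul, norm_mul, mul_pow, mul_inv]

theorem coordMetric_logN (i : Fin n) (p : Vec n) :
    (coordMetric q i).logN p = -((Real.log (‖p i‖ ^ 2) : ℝ) : ℂ) := by
  rw [HermMetric.logN, ← ofReal_neg, ← Real.log_inv]
  rfl

theorem coordMetric_connection_apply {i : Fin n} {p : Vec n} (hp : p ∈ cover (coordOpen q i)) :
    (coordMetric q i).connection.1 p = -dlog i p := by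
  have h := (hasFDerivAt_log_norm_sq (mem_cover_coordOpen.1 hp)).fun_neg
  have e : (coordMetric q i).logN = fun x => -((Real.log (‖x i‖ ^ 2) : ℝ) : ℂ) :=
    funext (coordMetric_logN i)
  rw [HermMetric.connection_apply _ hp, e, h.fderiv, neg_add, ← neg_smul, ← neg_smul,
    part_neg_one_dz_add, dlog, neg_smul]
  rfl

theorem d_eq_zero_of_apply {θ : Connection U} {i : Fin n} {c : ℂ} (hi : ∀ p ∈ cover U, p i ≠ 0)
    (h : ∀ p ∈ cover U, θ.1 p = c • dlog i p) : Form.d U 1 θ = 0 := by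
  have hd : ∀ p ∈ cover U, DifferentiableAt ℝ (dlog i) p := fun p hp => by
    rw [dlog_eq_smul]
    exact (hasFDerivAt_inv_coord (hi p hp)).differentiableAt.smul_const _
  rw [Form.d_eq]
  refine Form.ext_on fun p hp => ?_
  have e := Form.eventuallyEq (U := U) h hp
  rw [Submodule.coe_add, Pi.add_apply, Form.del_apply _ hp, Form.delbar_apply _ hp, dop_congr e,
    dop_congr e, dop_const_smul c (hd p hp), dop_const_smul c (hd p hp),
    dop_dlog (hi p hp) (Or.inl rfl), dop_dlog (hi p hp) (Or.inr rfl), smul_zero, add_zero]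
  rfl

theorem chernForm_coordMetric (i : Fin n) : chernForm (coordMetric q i).connection = 0 := by
  rw [chernForm, d_eq_zero_of_apply (i := i) (c := -1) (fun p hp => mem_cover_coordOpen.1 hp)
    fun p hp => by rw [coordMetric_connection_apply hp, neg_one_smul], smul_zero]

/-- The metric with `h(ν, ν) = 1 / (|x|² + |y|²)`. -/
def sumMetric (q : ℂˣ) : HermMetric (⊤ : Opens (Hopf q 2)) where
  N p := (‖p 0‖ ^ 2 + ‖p 1‖ ^ 2)⁻¹
  smooth := (((contDiff_apply ℝ ℂ 0).norm_sq ℝ).add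
      ((contDiff_apply ℝ ℂ 1).norm_sq ℝ)).contDiffOn.inv fun p hp h0 => by
    have h : ‖p 0‖ ^ 2 + ‖p 1‖ ^ 2 = 0 := h0
    have h1 : p 0 = 0 := norm_eq_zero.1 (pow_eq_zero_iff two_ne_zero |>.1
      (by nlinarith [sq_nonneg ‖p 0‖, sq_nonneg ‖p 1‖]))
    have h2 : p 1 = 0 := norm_eq_zero.1 (pow_eq_zero_iff two_ne_zero |>.1
      (by nlinarith [sq_nonneg ‖p 0‖, sq_nonneg ‖p 1‖]))
    refine ne_zero_of_mem_cover hp ?_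
    ext i
    fin_cases i
    · exact h1
    · exact h2
  pos p hp := by
    obtain ⟨i, hi⟩ := Function.ne_iff.1 (ne_zero_of_mem_cover hp)
    have hi' : 0 < ‖p i‖ := norm_pos_iff.2 hi
    fin_cases i
    · have : 0 < ‖p 0‖ := hi'
      positivity
    · have : 0 < ‖p 1‖ := hi'
      positivity
  equivariant p _ := by
    simp only [Pi.smul_apply, smul_eq_mul, norm_mul, mul_pow, ← mul_add, mul_inv]

theorem sumMetric_logN (p : Vec 2) :
    (sumMetric q).logN p = -((Real.log (‖p 0‖ ^ 2 + ‖p 1‖ ^ 2) : ℝ) : ℂ) := by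
  rw [HermMetric.logN, ← ofReal_neg, ← Real.log_inv]
  rfl

theorem γ_eq : γ = -(I / (2 * Real.pi)) := by
  have : (Real.pi : ℂ) ≠ 0 := ofReal_ne_zero.2 Real.pi_ne_zero
  rw [γ]
  field_simp
  rw [I_sq, neg_neg]

end

section

open MeasureTheory
variable {q : ℂˣ} {n k m : ℕ} {U : Opens (Hopf q n)}

/-! ### The foliation and the curve -/

theorem mem_fol {p w : Vec 3} : w ∈ fol p ↔ ∃ a b : ℂ, a • v₁ p + b • v₂ p = w :=
  Submodule.mem_span_pair

theorem fol_smul (q : ℂˣ) (p : Vec 3) : fol ((q : ℂ) • p) = fol p := by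
  have h : v₁ ((q : ℂ) • p) = (q : ℂ) • v₁ p := by
    ext i
    fin_cases i <;> simp [v₁]
  ext w
  rw [mem_fol, mem_fol, h]
  constructor
  · rintro ⟨a, b, rfl⟩
    exact ⟨a * q, b, by rw [mul_smul]; rfl⟩
  · rintro ⟨a, b, rfl⟩
    exact ⟨a * (q : ℂ)⁻¹, b, by rw [smul_smul, inv_mul_cancel_right₀ q.ne_zero]; rfl⟩

theorem bracket_linear (A B : Vec n →L[ℂ] Vec n) (p : Vec n) :
    bracket A B p = B (A p) - A (B p) := by
  have h : ∀ A : Vec n →L[ℂ] Vec n, linPart (fderiv ℝ A p) = A.restrictScalars ℝ := fun A => by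
    have e : fderiv ℝ A p = A.restrictScalars ℝ := (A.restrictScalars ℝ).hasFDerivAt.fderiv
    rw [e, linPart_eq_part]
    exact part_neg_one_of_linear fun v => A.map_smul I v
  rw [bracket, h, h]
  rfl

/-- The field `y ∂/∂y + z ∂/∂z` as a linear map. -/
def v₁L : Vec 3 →L[ℂ] Vec 3 :=
  ContinuousLinearMap.pi ![0, ContinuousLinearMap.proj 1, ContinuousLinearMap.proj 2]

theorem v₁_eq : v₁ = v₁L := by
  funext p
  ext i
  fin_cases i <;> rfl

theorem bracket_v₁_v₂ (p : Vec 3) : bracket v₁ v₂ p = 0 := by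
  have e : fderiv ℝ v₁ p = v₁L.restrictScalars ℝ := by
    rw [v₁_eq]
    exact (v₁L.restrictScalars ℝ).hasFDerivAt.fderiv
  have h2 : fderiv ℝ v₂ p = 0 := (hasFDerivAt_const (𝕜 := ℝ) (![1, 0, 0] : Vec 3) p).fderiv
  rw [bracket, linPart_eq_part, linPart_eq_part, e, h2,
    part_neg_one_of_linear (D := v₁L.restrictScalars ℝ) fun v => v₁L.map_smul I v]
  ext i
  fin_cases i <;> simp [part_apply, v₁L, v₂]

theorem inclVec_two (p : Vec 2) : inclVec p 2 = 0 := rfl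

theorem eq_zero_of_mem_fol {p : Vec 2} {w : Vec 3} (h : w ∈ fol (inclVec p)) : w 2 = 0 := by
  obtain ⟨a, b, rfl⟩ := mem_fol.1 h
  simp [v₁, v₂, inclVec_two]

/-- The generators of the foliation are dependent exactly where `y = z = 0`. -/
theorem finrank_fol_lt {p : Vec 3} : Module.finrank ℂ (fol p) < 2 ↔ p 1 = 0 ∧ p 2 = 0 := by
  constructor
  · intro h
    by_contra hp
    have hl : LinearIndependent ℂ ![v₁ p, v₂ p] := by
      rw [LinearIndependent.pair_iff]
      intro s t hst
      have h0 := congrFun hst 0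
      have h1 := congrFun hst 1
      have h2 := congrFun hst 2
      simp [v₁, v₂] at h0 h1 h2
      refine ⟨?_, h0⟩
      by_contra hs
      exact hp ⟨h1.resolve_left hs, h2.resolve_left hs⟩
    have := finrank_span_eq_card hl
    rw [Matrix.range_cons_cons_empty, Fintype.card_fin] at this
    rw [fol, this] at h
    exact lt_irrefl _ h
  · rintro ⟨h1, h2⟩
    have hv : v₁ p = 0 := by
      ext i
      fin_cases i <;> simp [v₁, h1, h2]
    rw [fol, hv, Submodule.span_insert_zero]
    have h0 : v₂ p ≠ 0 := fun h => one_ne_zero (congrFun h 0)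
    rw [finrank_span_singleton h0]
    exact one_lt_two

theorem incl_mk {p : Vec n} (hp : p ≠ 0) :
    Hopf.incl (Hopf.mk q p hp) = Hopf.mk q (inclVec p) (inclVec_ne hp) := rfl

theorem Hopf.exists_mk (v : Hopf q n) : ∃ (p : Vec n) (hp : p ≠ 0), Hopf.mk q p hp = v := by
  obtain ⟨p, rfl⟩ := Quotient.exists_rep v
  exact ⟨p.1, p.2, rfl⟩

theorem mk_eq_mk {p p' : Vec n} {hp : p ≠ 0} {hp' : p' ≠ 0} :
    Hopf.mk q p hp = Hopf.mk q p' hp' ↔ ∃ k : ℤ, ((q ^ k : ℂˣ) : ℂ) • p = p' :=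
  ⟨fun h => Quotient.exact h, fun h => Quotient.sound h⟩

theorem mk_mem_curve {p : Vec 2} (hp : p ≠ 0) : Hopf.mk q p hp ∈ curve q ↔ p 1 = 0 := by
  constructor
  · rintro ⟨v, hv⟩
    obtain ⟨p', hp', rfl⟩ := Hopf.exists_mk v
    obtain ⟨k, rfl⟩ := mk_eq_mk.1 hv
    have : inclVec p' 1 = 0 := rfl
    rw [Pi.smul_apply, this, smul_zero]
  · intro h
    have e : inclVec ![p 0] = p := by
      ext i
      fin_cases i
      · rfl
      · exact h.symm
    have h0 : (![p 0] : Vec 1) ≠ 0 := fun h0 => hp (by rw [← e, h0]; ext i; fin_cases i <;> rfl)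
    refine ⟨Hopf.mk q ![p 0] h0, ?_⟩
    rw [incl_mk]
    congr 1

theorem mk_mem_singularSet {p : Vec 3} (hp : p ≠ 0) :
    Hopf.mk q p hp ∈ singularSet q ↔ p 1 = 0 ∧ p 2 = 0 := by
  constructor
  · rintro ⟨p', hp', h, hf⟩
    obtain ⟨k, rfl⟩ := mk_eq_mk.1 h
    obtain ⟨h1, h2⟩ := finrank_fol_lt.1 hf
    simp [h1, h2]
  · intro h
    exact ⟨p, hp, rfl, finrank_fol_lt.2 h⟩

theorem singularSet_eq (q : ℂˣ) : singularSet q = Hopf.incl '' curve q := by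
  ext v
  constructor
  · intro hv
    obtain ⟨p, hp, rfl⟩ := Hopf.exists_mk v
    obtain ⟨h1, h2⟩ := (mk_mem_singularSet hp).1 hv
    have e : inclVec ![p 0, p 1] = p := by
      ext i
      fin_cases i
      · rfl
      · rfl
      · exact h2.symm
    have h0 : (![p 0, p 1] : Vec 2) ≠ 0 := fun h0 =>
      hp (by rw [← e, h0]; ext i; fin_cases i <;> rfl)
    refine ⟨Hopf.mk q ![p 0, p 1] h0, (mk_mem_curve h0).2 h1, ?_⟩
    rw [incl_mk]
    congr 1
  · rintro ⟨w, hw, rfl⟩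
    obtain ⟨p, hp, rfl⟩ := Hopf.exists_mk w
    rw [incl_mk]
    exact (mk_mem_singularSet _).2 ⟨(mk_mem_curve hp).1 hw, rfl⟩

theorem curve_eq_fiber (q : ℂˣ) :
    curve q = {v | (hopfProj v).submodule = Submodule.span ℂ {![1, 0]}} := by
  ext v
  obtain ⟨p, hp, rfl⟩ := Hopf.exists_mk v
  have e : (hopfProj (Hopf.mk q p hp)).submodule = Submodule.span ℂ {p} :=
    Projectivization.submodule_mk p hp
  rw [mk_mem_curve, Set.mem_ofPred_eq, e]
  constructor
  · intro h
    have hp0 : p 0 ≠ 0 := fun h0 => hp (by ext i; fin_cases i <;> assumption)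
    have e2 : p = p 0 • ![1, 0] := by
      ext i
      fin_cases i <;> simp [h]
    rw [e2]
    exact Submodule.span_singleton_smul_eq (IsUnit.mk0 _ hp0) _
  · intro h
    have : p ∈ Submodule.span ℂ {(![1, 0] : Vec 2)} := h ▸ Submodule.mem_span_singleton_self p
    obtain ⟨a, rfl⟩ := Submodule.mem_span_singleton.1 this
    simp

theorem coordOpen_one_eq (q : ℂˣ) : (coordOpen q (1 : Fin 2) : Set (Hopf q 2)) = (curve q)ᶜ := by
  ext v
  obtain ⟨p, hp, rfl⟩ := Hopf.exists_mk v
  rw [SetLike.mem_coe, mk_mem_coordOpen, Set.mem_compl_iff, mk_mem_curve]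

/-! ### The normal bundle -/

theorem smul_zpow_mem_cover {p : Vec n} (hp : p ∈ cover U) (k : ℤ) :
    ((q ^ k : ℂˣ) : ℂ) • p ∈ cover U := by
  obtain ⟨h0, h⟩ := hp
  have h1 : ((q ^ k : ℂˣ) : ℂ) • p ≠ 0 := smul_ne_zero (Units.ne_zero _) h0
  refine ⟨h1, ?_⟩
  rwa [← mk_eq_mk.2 ⟨k, rfl⟩]

theorem equivariant_zpow {f : Vec n → ℂ} {c : ℂˣ} (h : ∀ p ∈ cover U, f ((q : ℂ) • p) = c * f p)
    {p : Vec n} (hp : p ∈ cover U) (k : ℤ) :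
    f (((q ^ k : ℂˣ) : ℂ) • p) = ((c ^ k : ℂˣ) : ℂ) * f p := by
  induction k with
  | zero => simp
  | succ k ih =>
    rw [zpow_add, zpow_one, mul_comm, Units.val_mul, mul_smul, h _ (smul_zpow_mem_cover hp _), ih,
      zpow_add, zpow_one, mul_comm (c ^ (k : ℤ)), Units.val_mul, mul_assoc]
  | pred k ih =>
    have h1 := h _ (smul_zpow_mem_cover hp (-k - 1))
    have e : ∀ r : ℂˣ, (r : ℂ) * ((r ^ (-(k : ℤ) - 1) : ℂˣ) : ℂ) = ((r ^ (-(k : ℤ)) : ℂˣ) : ℂ) := by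
      intro r
      rw [← Units.val_mul, ← zpow_one_add]
      congr 2
      ring
    rw [smul_smul, e, ih] at h1
    refine mul_left_cancel₀ c.ne_zero ?_
    rw [← h1, ← mul_assoc, e]

/-- Sections of the hyperplane bundle are the functions homogeneous under `p ↦ q p`. -/
theorem isSection_iff {f : Vec n → ℂ} : IsSection U f ↔
    ContDiffOn ℝ (⊤ : ℕ∞) f (cover U) ∧ ∀ p ∈ cover U, f ((q : ℂ) • p) = q * f p := by
  constructor
  · rintro ⟨h, s, hs⟩
    refine ⟨h, fun p hp => ?_⟩
    obtain ⟨h0, hU⟩ := hp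
    obtain ⟨h0', hU'⟩ := smul_mem_cover (q := q) (⟨h0, hU⟩ : p ∈ cover U)
    have e : ∀ (v v' : Hopf q n) (_ : v = v') (x : Vec n) (hx : x ∈ (hopfProj v).submodule)
        (hx' : x ∈ (hopfProj v').submodule), s v ⟨x, hx⟩ = s v' ⟨x, hx'⟩ := by
      rintro v _ rfl x hx hx'
      rfl
    rw [hs _ h0' hU', hs _ h0 hU, e _ _ (mk_smul p h0 h0') _ _
      (Submodule.smul_mem _ _ (mem_hopfProj p h0))]
    exact (s _).map_smul (q : ℂ) ⟨p, mem_hopfProj p h0⟩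
  · rintro ⟨h, he⟩
    choose rep hrep0 hrep using Hopf.exists_mk (q := q) (n := n)
    choose i hi using fun v => Function.ne_iff.1 (hrep0 v)
    refine ⟨h, fun v => (f (rep v) / rep v (i v)) •
      (LinearMap.proj (i v) : Vec n →ₗ[ℂ] ℂ).comp (hopfProj v).submodule.subtype,
      fun p hp hU => ?_⟩
    obtain ⟨k, hk⟩ := mk_eq_mk.1 (hrep (Hopf.mk q p hp))
    set v := Hopf.mk q p hp with hv
    have hc : rep v ∈ cover U := ⟨hrep0 v, by rwa [hrep v]⟩
    have hiv : rep v (i v) ≠ 0 := hi v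
    change f p = f (rep v) / rep v (i v) * p (i v)
    rw [← hk, equivariant_zpow he hc, Pi.smul_apply, smul_eq_mul]
    field_simp

/-- A section of `L` is a function homogeneous of degree one under `p ↦ q p`, which is also the
equivariance of the component `∂/∂z` of a vector field on the threefold. -/
theorem isSection_iff_normal {U : Opens (Hopf q 2)} {f : Vec 2 → ℂ} : IsSection U f ↔
    ∃ w : Vec 2 → Vec 3, IsVectorField U w ∧ ∀ p ∈ cover U, f p = w p 2 := by
  rw [isSection_iff]
  constructor
  · rintro ⟨h, he⟩
    refine ⟨fun p => ![0, 0, f p], ⟨contDiffOn_pi.2 fun i => ?_, fun p hp => ?_⟩, fun p hp => rfl⟩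
    · fin_cases i
      · exact contDiffOn_const
      · exact contDiffOn_const
      · exact h
    · ext i
      fin_cases i
      · simp
      · simp
      · exact he p hp
  · rintro ⟨w, ⟨h, he⟩, hw⟩
    refine ⟨(contDiffOn_pi.1 h 2).congr hw, fun p hp => ?_⟩
    rw [hw p hp, hw _ (smul_mem_cover hp), he p hp]
    rfl

/-! ### The Chern class and the Atiyah class -/

theorem coh_mk_eq_zero {A : Type*} [AddCommGroup A] [Module ℂ A] {Z B : Submodule ℂ A} {z : Z} :
    Coh.mk B z = 0 ↔ z.1 ∈ B := by
  rw [Coh.mk, Submodule.mkQ_apply, Submodule.Quotient.mk_eq_zero]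
  rfl

theorem coh_mk_eq {A : Type*} [AddCommGroup A] [Module ℂ A] {Z B : Submodule ℂ A} {z z' : Z} :
    Coh.mk B z = Coh.mk B z' ↔ z.1 - z'.1 ∈ B := by
  rw [← sub_eq_zero, Coh.mk, Coh.mk, ← map_sub]
  exact coh_mk_eq_zero

/-- A Chern form is the differential of a multiple of the connection form, which is globally defined
because the frame `ν` is invariant. -/
theorem isChernClass_zero : IsChernClass (0 : HdR (⊤ : Opens (Hopf q n))) := by
  intro θ
  have h : chernForm θ = Form.d ⊤ 1 ((I / (2 * Real.pi) : ℂ) • θ) := by rw [map_smul, chernForm]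
  refine ⟨⟨chernForm θ, ?_⟩, rfl, coh_mk_eq_zero.2 ⟨_, h.symm⟩⟩
  change Form.d ⊤ 2 (chernForm θ) = 0
  rw [h, Form.d_d]

theorem isAtiyahClass_zero : IsAtiyahClass (0 : HDol (⊤ : Opens (Hopf q n))) := by
  intro θ hθ
  have h : atiyahForm θ = Form.delbar ⊤ 1 ((I / (2 * Real.pi) : ℂ) • θ) := by
    rw [map_smul, atiyahForm]
  have ht : (I / (2 * Real.pi) : ℂ) • θ ∈ Form.type ⊤ 1 1 0 := Submodule.smul_mem _ _ hθ
  refine ⟨⟨atiyahForm θ, ?_, ?_⟩, rfl, coh_mk_eq_zero.2 ⟨_, ht, h.symm⟩⟩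
  · rw [h]
    exact Form.delbar_mem_type (a := 1) (b := 0) ht
  · change Form.delbar ⊤ 2 (atiyahForm θ) = 0
    rw [h, Form.delbar_delbar]

/-! ### The connection given by the foliation -/

theorem isVectorField_linear {U : Opens (Hopf q n)} (A : Vec n →L[ℂ] Vec m) :
    IsVectorField U A :=
  ⟨(A.restrictScalars ℝ).contDiff.contDiffOn, fun p _ => A.map_smul _ p⟩

theorem disjoint_coordOpen_singularSet :
    Disjoint (coordOpen q (1 : Fin 3) : Set (Hopf q 3)) (singularSet q) := by
  rw [Set.disjoint_left]
  intro v hv hs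
  obtain ⟨p, hp, rfl⟩ := Hopf.exists_mk v
  exact (mk_mem_coordOpen hp).1 hv ((mk_mem_singularSet hp).1 hs).1

/-- The Camacho-Sad condition determines the connection: it has to be `-dy / y`. -/
theorem IsCamachoSadConnection.toLin_eq {θ : Connection (coordOpen q (1 : Fin 2))}
    (H : IsCamachoSadConnection θ) {p : Vec 2} (hp : p 1 ≠ 0) (u : Vec 2) :
    toLin (θ.1 p) u = -((p 1)⁻¹ * u 1) := by
  have hpc : p ∈ cover (coordOpen q (1 : Fin 2)) := mem_cover_coordOpen.2 hp
  have hlin := isType10_iff.1 H.1 p hpc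
  -- the normal field `y ∂/∂z`, tested against `y ∂/∂y + z ∂/∂z` and `y ∂/∂x`
  let v : Vec 3 →L[ℂ] Vec 3 := ContinuousLinearMap.pi ![0, 0, ContinuousLinearMap.proj 1]
  let u₂ : Vec 3 →L[ℂ] Vec 3 := ContinuousLinearMap.pi ![ContinuousLinearMap.proj 1, 0, 0]
  have hW : inclVec p ∈ cover (coordOpen q (1 : Fin 3)) := mem_cover_coordOpen.2 hp
  have hD : linPart (covDeriv θ (fun x => v (inclVec x) 2) p) =
      dz 1 + p 1 • toLin (θ.1 p) := by
    have e : covDeriv θ (fun x => v (inclVec x) 2) p = dz 1 + p 1 • toLin (θ.1 p) := by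
      rw [covDeriv]
      congr 1
      exact (dz (n := 2) 1).hasFDerivAt.fderiv
    rw [e, linPart_eq_part]
    refine part_neg_one_of_linear fun w => ?_
    simp only [add_apply, smul_apply, hlin, smul_eq_mul, ContinuousLinearMap.proj_apply,
      Pi.smul_apply]
    ring
  have h1 := H.2 _ disjoint_coordOpen_singularSet v₁L v (isVectorField_linear _)
    (isVectorField_linear _) (fun x _ => by
      rw [← v₁_eq]
      exact Submodule.subset_span (Set.mem_insert _ _)) p hW
  have h2 := H.2 _ disjoint_coordOpen_singularSet u₂ v (isVectorField_linear _)
    (isVectorField_linear _) (fun x _ => mem_fol.2 ⟨0, x 1, by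
      ext i
      fin_cases i <;> simp [v₂, u₂]⟩) p hW
  rw [hD, bracket_linear] at h1 h2
  have a1 : (![v₁L (inclVec p) 0, v₁L (inclVec p) 1] : Vec 2) = p 1 • ![0, 1] := by
    ext i
    fin_cases i
    · simp [v₁L]
    · simp [v₁L]
      rfl
  have a2 : (![u₂ (inclVec p) 0, u₂ (inclVec p) 1] : Vec 2) = p 1 • ![1, 0] := by
    ext i
    fin_cases i
    · simp [u₂]
      rfl
    · simp [u₂]
  have b1 : (v (v₁L (inclVec p)) - v₁L (v (inclVec p))) 2 = 0 := by
    change inclVec p 1 - inclVec p 1 = 0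
    rw [sub_self]
  have b2 : (v (u₂ (inclVec p)) - u₂ (v (inclVec p))) 2 = 0 := by
    change (0 : ℂ) - 0 = 0
    rw [sub_self]
  rw [a1, b1] at h1
  rw [a2, b2] at h2
  simp only [add_apply, smul_apply, hlin, smul_eq_mul, ContinuousLinearMap.proj_apply,
    Pi.smul_apply] at h1 h2
  have c1 : toLin (θ.1 p) ![0, 1] = -(p 1)⁻¹ := by
    simp at h1
    field_simp
    have : p 1 * (p 1 * toLin (θ.1 p) ![0, 1] + 1) = 0 := by linear_combination h1
    linear_combination (mul_eq_zero.1 this).resolve_left hp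
  have c2 : toLin (θ.1 p) ![1, 0] = 0 := by
    simpa [hp] using h2
  have eu : u = u 0 • ![1, 0] + u 1 • ![0, 1] := by
    ext i
    fin_cases i <;> simp
  rw [eu, map_add, hlin, hlin, c1, c2]
  simp
  ring

theorem inclVec_eq (p : Vec 2) : inclVec p = ![p 0, p 1, 0] := by
  ext i
  fin_cases i <;> rfl

/-- The inclusion `(x, y) ↦ (x, y, 0)` as a linear map. -/
def inclL : Vec 2 →L[ℝ] Vec 3 := ContinuousLinearMap.pi ![dz 0, dz 1, 0]

theorem inclL_apply (p : Vec 2) : inclL p = inclVec p := by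
  ext i
  fin_cases i <;> rfl

theorem part_comp_proj (ε : ℂ) (D : Vec n →L[ℝ] Vec m) (i : Fin m) (w : Vec n) :
    part ε ((dz i).comp D) w = part ε D w i := by
  simp [part_apply]

/-- The metric connection of `1 / |y|²` extends the Camacho-Sad action: near the surface a field
tangent to the foliation has normal component `z g` with `g = u_y / y`, so that only `z g ∂/∂z`
contributes to the normal component of the bracket beyond the derivative of the normal field. -/
theorem isCamachoSadConnection_connection :
    IsCamachoSadConnection (coordMetric q (1 : Fin 2)).connection := by
  refine ⟨(coordMetric q 1).isMetricConnection_connection.1, fun W hW u v hu hv hf p hp => ?_⟩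
  set P := inclVec p with hP
  have hp1 : p 1 ≠ 0 := fun h0 => by
    obtain ⟨h, hPW⟩ := hp
    exact Set.disjoint_left.1 hW hPW ((mk_mem_singularSet h).2 ⟨h0, rfl⟩)
  have hP1 : P 1 = p 1 := rfl
  have hP2 : P 2 = 0 := rfl
  have hd : ∀ w : Vec 3 → Vec 3, IsVectorField W w → DifferentiableAt ℝ w P := fun w hw =>
    (hw.1.contDiffAt ((isOpen_cover W).mem_nhds hp)).differentiableAt (by simp)
  -- tangency to the foliation determines the normal component near the surface
  have hu2 : (fun x => u x 2) =ᶠ[nhds P] fun x => x 2 * ((x 1)⁻¹ * u x 1) := by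
    filter_upwards [(isOpen_cover W).mem_nhds hp, (isOpen_coord_ne (1 : Fin 3)).mem_nhds
      (show P 1 ≠ 0 from hp1)] with x hx hx1
    have hx1' : x 1 ≠ 0 := hx1
    obtain ⟨a, b, hab⟩ := mem_fol.1 (hf x hx)
    rw [← hab]
    simp [v₁, v₂]
    field_simp
  have hu1 : DifferentiableAt ℝ (fun x => u x 1) P := differentiableAt_pi.1 (hd u hu) 1
  have hg : DifferentiableAt ℝ (fun x : Vec 3 => (x 1)⁻¹ * u x 1) P :=
    (hasFDerivAt_inv_coord (show P 1 ≠ 0 from hp1)).differentiableAt.mul hu1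
  have hdu : (dz 2).comp (fderiv ℝ u P) = ((p 1)⁻¹ * u P 1) • dz 2 := by
    have h1 : HasFDerivAt (fun x => u x 2) ((dz 2).comp (fderiv ℝ u P)) P :=
      (dz (n := 3) 2).hasFDerivAt.comp P (hd u hu).hasFDerivAt
    have h2 : HasFDerivAt (fun x : Vec 3 => x 2 * ((x 1)⁻¹ * u x 1)) _ P :=
      (dz (n := 3) 2).hasFDerivAt.mul hg.hasFDerivAt
    rw [h1.unique (h2.congr_of_eventuallyEq hu2)]
    ext w
    simp [hP2, hP1]
  have hcov : fderiv ℝ (fun x => v (inclVec x) 2) p = ((dz 2).comp (fderiv ℝ v P)).comp inclL := by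
    have e : (fun x => v (inclVec x) 2) = fun x => v (inclL x) 2 := by
      funext x
      rw [inclL_apply]
    have h1 : HasFDerivAt v (fderiv ℝ v P) (inclL p) := by
      rw [inclL_apply]
      exact (hd v hv).hasFDerivAt
    rw [e]
    exact ((dz (n := 3) 2).hasFDerivAt.comp p (h1.comp p inclL.hasFDerivAt)).fderiv
  have huP : inclL ![u P 0, u P 1] = u P := by
    rw [inclL_apply, inclVec_eq]
    ext i
    fin_cases i
    · rfl
    · rfl
    · exact (eq_zero_of_mem_fol (hf P hp)).symm
  have hinc : ∀ (D : Vec 3 →L[ℝ] ℂ) (w : Vec 2),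
      part (-1) (D.comp inclL) w = part (-1) D (inclL w) := by
    intro D w
    have hI : inclL (I • w) = I • inclL w := by
      rw [inclL_apply, inclL_apply, inclVec_smul]
    rw [part_apply, part_apply, ContinuousLinearMap.comp_apply, ContinuousLinearMap.comp_apply, hI]
  rw [bracket, Pi.sub_apply, linPart_eq_part, linPart_eq_part, linPart_eq_part,
    ← part_comp_proj, ← part_comp_proj, hdu, covDeriv, part_add, part_smul, hcov, add_apply, hinc,
    huP, sub_eq_add_neg, part_neg_one_of_linear (smul_dz_I _ 2)]
  congr 1
  have hθ : toLin ((coordMetric q (1 : Fin 2)).connection.1 p) = (-(p 1)⁻¹) • dz 1 := by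
    rw [coordMetric_connection_apply (mem_cover_coordOpen.2 hp1), dlog, neg_smul]
    rfl
  rw [hθ, part_neg_one_of_linear (smul_dz_I _ 1)]
  simp
  ring

theorem IsCamachoSadConnection.eq {θ : Connection (coordOpen q (1 : Fin 2))}
    (H : IsCamachoSadConnection θ) : θ = (coordMetric q (1 : Fin 2)).connection := by
  refine Form.ext_on fun p hp => ?_
  have hp1 := mem_cover_coordOpen.1 hp
  rw [← ofLin_toLin (θ.1 p),
    ← ofLin_toLin ((coordMetric q (1 : Fin 2)).connection.1 p)]
  congr 1
  ext1 u
  rw [H.toLin_eq hp1, isCamachoSadConnection_connection.toLin_eq hp1]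

end

section

open MeasureTheory
variable {q : ℂˣ} {n k m : ℕ} {U : Opens (Hopf q n)}

/-! ### The Bott-Chern class -/

/-- The Bott-Chern class of the hyperplane bundle of the Hopf surface. -/
def bottChern (q : ℂˣ) : HBC (⊤ : Opens (Hopf q 2)) :=
  Coh.mk _ ⟨chernForm (sumMetric q).connection, chernForm_mem_ZBC _⟩

theorem isBottChernClass_bottChern (q : ℂˣ) : IsBottChernClass (bottChern q) := by
  intro h θ hθ
  refine ⟨⟨chernForm h.connection, chernForm_mem_ZBC _⟩, by rw [hθ.eq], ?_⟩
  exact coh_mk_eq.2 ⟨_, (chernForm_sub (sumMetric q) h).symm⟩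

theorem dop_dop_const_smul {ε ε' : ℂ} {ω : Vec n → Alt n k} {p : Vec n} (c : ℂ)
    (h : ContDiffAt ℝ 2 ω p) :
    dop ε (dop ε' fun x => c • ω x) p = c • dop ε (dop ε' ω) p := by
  rw [← dop_const_smul c (differentiableAt_dop h)]
  refine dop_congr ?_
  filter_upwards [h.eventually (by simp)] with x hx
  exact dop_const_smul c (hx.differentiableAt (by norm_num))

theorem chernForm_sumMetric_apply {p : Vec 2} (hp : p ≠ 0) :
    (chernForm (sumMetric q).connection).1 p = γ • delbar (del
      (fn fun z => (Real.log (‖z 0‖ ^ 2 + ‖z 1‖ ^ 2) : ℂ))) p := by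
  have hp' : p ∈ cover (⊤ : Opens (Hopf q 2)) := mem_cover_top.2 hp
  have h := contDiffAt_fn ((sumMetric q).contDiffAt_two_logN hp')
  have e : (fn fun z : Vec 2 => (Real.log (‖z 0‖ ^ 2 + ‖z 1‖ ^ 2) : ℂ)) =
      fun z => (-1 : ℂ) • fn (sumMetric q).logN z := by
    funext z
    ext v
    change _ = (-1 : ℂ) * (sumMetric q).logN z
    rw [sumMetric_logN, neg_one_mul, neg_neg]
    rfl
  rw [chernForm_connection_apply _ hp', e, delbar_eq_dop, del_eq_dop, dop_dop_const_smul _ h, γ_eq,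
    smul_smul, mul_neg_one, neg_neg]

/-- On a complex line, `∂̄∂` is a multiple of the Laplacian. -/
theorem dop_one_dop_neg_one_apply {F : Vec n → ℂ} {p : Vec n} (hF : ContDiffAt ℝ 2 F p)
    (v : Vec n) :
    dop 1 (dop (-1) (fn F)) p ![v, I • v] = I / 2 *
      (fderiv ℝ (fderiv ℝ F) p v v + fderiv ℝ (fderiv ℝ F) p (I • v) (I • v)) := by
  have h1 : DifferentiableAt ℝ (fderiv ℝ F) p :=
    (hF.fderiv_right (m := 1) (by norm_num)).differentiableAt (by norm_num)
  have hs : IsSymmSndFDerivAt ℝ F p := hF.isSymmSndFDerivAt (by simp)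
  have e : (fun x => toLin (dop (-1) (fn F) x)) =ᶠ[nhds p] fun x => part (-1) (fderiv ℝ F x) := by
    filter_upwards [hF.eventually (by simp)] with x hx
    rw [toLin_dop (differentiableAt_fn (hx.differentiableAt (by norm_num))), val_fn]
  rw [dop_apply_two (differentiableAt_dop (contDiffAt_fn hF)), e.fderiv_eq,
    (hasFDerivAt_part h1.hasFDerivAt).fderiv]
  have hI : ∀ w : Vec n, I • I • w = -w := fun w => by
    rw [smul_smul, I_mul_I, neg_one_smul]
  simp [part_apply, hI, hs (I • v) v]
  ring

/-- The interval `[|q|, 1]` is a fundamental domain for multiplication by `|q|`. -/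
theorem exists_zpow_mul_mem (hq : ‖(q : ℂ)‖ < 1) {r : ℝ} (hr : 0 < r) :
    ∃ k : ℤ, ‖(q : ℂ)‖ ≤ ‖(q : ℂ)‖ ^ k * r ∧ ‖(q : ℂ)‖ ^ k * r ≤ 1 := by
  have hq0 : 0 < ‖(q : ℂ)‖ := norm_pos_iff.2 q.ne_zero
  obtain ⟨k, hk1, hk2⟩ := exists_mem_Ioc_zpow hr ((one_lt_inv₀ hq0).2 hq)
  have hpos : 0 < ‖(q : ℂ)‖ ^ (k + 1) := zpow_pos hq0 _
  refine ⟨k + 1, ?_, ?_⟩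
  · calc ‖(q : ℂ)‖ = ‖(q : ℂ)‖ ^ (k + 1) * (‖(q : ℂ)‖⁻¹) ^ k := by
          rw [inv_zpow, zpow_add₀ hq0.ne', zpow_one, mul_right_comm,
            mul_inv_cancel₀ (zpow_pos hq0 _).ne', one_mul]
      _ ≤ _ := mul_le_mul_of_nonneg_left hk1.le hpos.le
  · calc _ ≤ ‖(q : ℂ)‖ ^ (k + 1) * (‖(q : ℂ)‖⁻¹) ^ (k + 1) :=
          mul_le_mul_of_nonneg_left hk2 hpos.le
      _ = 1 := by rw [inv_zpow, mul_inv_cancel₀ hpos.ne']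

theorem norm_zpow_smul (q : ℂˣ) (k : ℤ) {E : Type*} [NormedAddCommGroup E] [NormedSpace ℂ E]
    (x : E) : ‖((q ^ k : ℂˣ) : ℂ) • x‖ = ‖(q : ℂ)‖ ^ k * ‖x‖ := by
  rw [norm_smul, Units.val_zpow_eq_zpow_val, norm_zpow]

/-- A function on `ℂ² ∖ {0}` invariant under `p ↦ q p` is bounded. -/
theorem exists_norm_val_le (hq : ‖(q : ℂ)‖ < 1) (τ : Form (⊤ : Opens (Hopf q n)) 0) :
    ∃ C, ∀ p : Vec n, p ≠ 0 → ‖val τ.1 p‖ ≤ C := by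
  have hq0 : 0 < ‖(q : ℂ)‖ := norm_pos_iff.2 q.ne_zero
  let K : Set (Vec n) := Metric.closedBall 0 1 ∩ {p | ‖(q : ℂ)‖ ≤ ‖p‖}
  have hK : IsCompact K := (isCompact_closedBall 0 1).inter_right
    (isClosed_le continuous_const continuous_norm)
  have hK0 : K ⊆ cover (⊤ : Opens (Hopf q n)) := fun p hp =>
    mem_cover_top.2 (norm_pos_iff.1 (hq0.trans_le hp.2))
  obtain ⟨C, hC⟩ := hK.exists_bound_of_continuousOn ((Form.contDiffOn_val τ).continuousOn.mono hK0)
  refine ⟨C, fun p hp => ?_⟩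
  obtain ⟨k, hk1, hk2⟩ := exists_zpow_mul_mem hq (norm_pos_iff.2 hp)
  have e := equivariant_zpow (f := val τ.1) (c := 1) (fun p hp => by
    rw [Form.val_smul τ hp, Units.val_one, one_mul]) (mem_cover_top.2 hp) k
  rw [one_zpow, Units.val_one, one_mul] at e
  rw [← e]
  rw [← norm_zpow_smul] at hk1 hk2
  exact hC _ ⟨mem_closedBall_zero_iff.2 hk2, hk1⟩

/-- The line `y = 1`. -/
def affineLine (w : ℂ) : Vec 2 := ![w, 1]

/-- The direction of the line `y = 1`. -/
def affineDir : ℂ →L[ℝ] Vec 2 := ContinuousLinearMap.pi ![ContinuousLinearMap.id ℝ ℂ, 0]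

theorem hasFDerivAt_affineLine (w : ℂ) : HasFDerivAt affineLine affineDir w := by
  have h : affineLine = fun w => affineDir w + ![0, 1] := by
    funext w
    ext i
    fin_cases i <;> simp [affineLine, affineDir]
  rw [h]
  exact affineDir.hasFDerivAt.add_const _

theorem affineLine_ne_zero (w : ℂ) : affineLine w ≠ 0 := fun h => one_ne_zero (congrFun h 1)

/-- A solution of `∂̄∂F = 0` is harmonic on the line `y = 1`. -/
theorem harmonicAt_comp_affineLine {F : Vec 2 → ℂ} (hF : ∀ p : Vec 2, p ≠ 0 → ContDiffAt ℝ 2 F p)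
    (h : ∀ p : Vec 2, p ≠ 0 → dop 1 (dop (-1) (fn F)) p = 0) (w : ℂ) :
    InnerProductSpace.HarmonicAt (fun w => F (affineLine w)) w := by
  have hd : ∀ p : Vec 2, p ≠ 0 → DifferentiableAt ℝ (fderiv ℝ F) p := fun p hp =>
    ((hF p hp).fderiv_right (m := 1) (by norm_num)).differentiableAt (by norm_num)
  have hL : ContDiff ℝ 2 affineLine := by
    rw [contDiff_pi]
    intro i
    fin_cases i
    · exact contDiff_id
    · exact contDiff_const
  refine ⟨(hF _ (affineLine_ne_zero w)).comp w hL.contDiffAt,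
    Filter.Eventually.of_forall fun z => ?_⟩
  have e1 : fderiv ℝ (fun w => F (affineLine w)) =
      fun w => (fderiv ℝ F (affineLine w)).comp affineDir := funext fun w =>
    (((hF _ (affineLine_ne_zero w)).differentiableAt (by norm_num)).hasFDerivAt.comp w
      (hasFDerivAt_affineLine w)).fderiv
  have e2 : ∀ a b : ℂ, fderiv ℝ (fderiv ℝ fun w => F (affineLine w)) z a b =
      fderiv ℝ (fderiv ℝ F) (affineLine z) (affineDir a) (affineDir b) := by
    intro a b
    have h2 := ((ContinuousLinearMap.compL ℝ ℂ (Vec 2) ℂ).flip affineDir).hasFDerivAt.comp z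
      ((hd _ (affineLine_ne_zero z)).hasFDerivAt.comp z (hasFDerivAt_affineLine z))
    rw [e1]
    exact congrArg (fun D => D a b) h2.fderiv
  rw [InnerProductSpace.laplacian_eq_iteratedFDeriv_complexPlane]
  change iteratedFDeriv ℝ 2 _ z ![1, 1] + iteratedFDeriv ℝ 2 _ z ![I, I] = 0
  rw [iteratedFDeriv_two_apply, iteratedFDeriv_two_apply]
  have h3 := dop_one_dop_neg_one_apply (hF _ (affineLine_ne_zero z)) (affineDir 1)
  have hI : I • affineDir 1 = affineDir I := by
    ext i
    fin_cases i <;> simp [affineDir]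
  rw [h _ (affineLine_ne_zero z), hI] at h3
  have h4 := (mul_eq_zero.1 h3.symm).resolve_left (div_ne_zero I_ne_zero two_ne_zero)
  rw [← h4, ← e2, ← e2]
  rfl

/-- If the Bott-Chern class vanished, then `-log (|x|² + |y|²)` would differ from an invariant,
hence bounded function by a function `F` with `∂̄∂F = 0`. On the line `y = 1` the real part of `F`
would be harmonic and tend to `-∞`, which the mean value property excludes. -/
theorem bottChern_ne_zero (hq : ‖(q : ℂ)‖ < 1) : bottChern q ≠ 0 := by
  intro h0
  obtain ⟨τ, hτ⟩ := coh_mk_eq_zero.1 h0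
  obtain ⟨C, hC⟩ := exists_norm_val_le hq τ
  set c : ℂ := I / (2 * Real.pi) with hc
  have hc0 : c ≠ 0 := div_ne_zero I_ne_zero
    (mul_ne_zero two_ne_zero (ofReal_ne_zero.2 Real.pi_ne_zero))
  let F : Vec 2 → ℂ := fun p => (sumMetric q).logN p - c⁻¹ * val τ.1 p
  have hτ2 : ∀ p : Vec 2, p ≠ 0 → ContDiffAt ℝ 2 (val τ.1) p := fun p hp =>
    ((Form.contDiffOn_val τ).contDiffAt ((isOpen_cover _).mem_nhds (mem_cover_top.2 hp))).of_le
      (WithTop.coe_le_coe.2 (le_top : (2 : ℕ∞) ≤ ⊤))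
  have hF : ∀ p : Vec 2, p ≠ 0 → ContDiffAt ℝ 2 F p := fun p hp =>
    ((sumMetric q).contDiffAt_two_logN (mem_cover_top.2 hp)).sub (contDiffAt_const.mul (hτ2 p hp))
  have hF0 : ∀ p : Vec 2, p ≠ 0 → dop 1 (dop (-1) (fn F)) p = 0 := by
    intro p hp
    have hp' : p ∈ cover (⊤ : Opens (Hopf q 2)) := mem_cover_top.2 hp
    have h1 : (Form.ddbar ⊤ τ).1 p = (chernForm (sumMetric q).connection).1 p := by rw [hτ]
    rw [Form.ddbar_apply τ hp', chernForm_connection_apply _ hp'] at h1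
    have e : fn F = fun x => fn (sumMetric q).logN x - c⁻¹ • τ.1 x := by
      funext x
      ext v
      rw [Subsingleton.elim v ![]]
      rfl
    have hs : ContDiffAt ℝ 2 (fun x => c⁻¹ • τ.1 x) p := (Form.contDiffAt τ hp').const_smul c⁻¹
    rw [e, dop_dop_sub (contDiffAt_fn ((sumMetric q).contDiffAt_two_logN hp')) hs,
      dop_dop_const_smul _ (Form.contDiffAt τ hp'), h1, smul_smul, ← hc, inv_mul_cancel₀ hc0,
      one_smul, sub_self]
  let u : ℂ → ℝ := fun w => (F (affineLine w)).re
  have hu : ∀ w, InnerProductSpace.HarmonicAt u w := fun w =>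
    (harmonicAt_comp_affineLine hF hF0 w).comp_CLM reCLM
  set C' := ‖c⁻¹‖ * C with hC'
  have hle : ∀ w, u w ≤ -Real.log (‖w‖ ^ 2 + 1) + C' := by
    intro w
    have e : u w = -Real.log (‖w‖ ^ 2 + 1) - (c⁻¹ * val τ.1 (affineLine w)).re := by
      simp only [u, F]
      rw [sub_re, sumMetric_logN, ← ofReal_neg, ofReal_re]
      simp [affineLine]
    have h1 : -(c⁻¹ * val τ.1 (affineLine w)).re ≤ C' := by
      refine (neg_le_abs _).trans ((abs_re_le_norm _).trans ?_)
      rw [norm_mul]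
      exact mul_le_mul_of_nonneg_left (hC _ (affineLine_ne_zero w)) (norm_nonneg _)
    rw [e]
    linarith
  -- the mean value property on a large circle contradicts `u → -∞`
  have hmean : ∀ R : ℝ, u 0 ≤ -Real.log (R ^ 2 + 1) + C' := by
    intro R
    have hh : InnerProductSpace.HarmonicOnNhd u (Metric.closedBall 0 |R|) := fun w _ => hu w
    rw [← hh.circleAverage_eq]
    refine Real.circleAverage_mono_on_of_le_circle
      ((hh.continuousOn.mono Metric.sphere_subset_closedBall).circleIntegrable') ?_
    intro x hx
    have hx' : ‖x‖ ^ 2 = R ^ 2 := by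
      rw [mem_sphere_zero_iff_norm.1 hx, sq_abs]
    rw [← hx']
    exact hle x
  have h1 := hmean (Real.exp (C' - u 0 + 1))
  have h2 : C' - u 0 + 1 ≤ Real.log (Real.exp (C' - u 0 + 1) ^ 2 + 1) := by
    rw [Real.le_log_iff_exp_le (by positivity)]
    nlinarith [sq_nonneg (Real.exp (C' - u 0 + 1) - 1), Real.exp_pos (C' - u 0 + 1)]
  linarith

end

section

open MeasureTheory
variable {q : ℂˣ} {n k m : ℕ} {U : Opens (Hopf q n)}

/-! ### The localized Bott-Chern class -/

theorem integral_logDeriv_segment {a b : ℝ} (ha : 0 < a) (hb : 0 < b) :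
    ∫ t in (0 : ℝ)..1, (b - a) / ((1 - t) * a + t * b) = Real.log b - Real.log a := by
  have hpos : ∀ t ∈ Set.uIcc (0 : ℝ) 1, 0 < (1 - t) * a + t * b := by
    intro t ht
    rw [Set.uIcc_of_le zero_le_one] at ht
    rcases ht.1.eq_or_lt with rfl | h
    · simpa using ha
    · have := mul_pos h hb
      have := mul_nonneg (sub_nonneg.2 ht.2) ha.le
      linarith
  have h := intervalIntegral.integral_eq_sub_of_hasDerivAt
    (f := fun t => Real.log ((1 - t) * a + t * b))
    (f' := fun t => (b - a) / ((1 - t) * a + t * b)) (a := 0) (b := 1)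
    (fun t ht => by
      have h1 : HasDerivAt (fun t : ℝ => (1 - t) * a + t * b) (b - a) t := by
        exact ((((hasDerivAt_id' t).const_sub 1).mul_const a).add
          ((hasDerivAt_id' t).mul_const b)).congr_deriv (by ring)
      exact h1.log (hpos t ht).ne')
    (ContinuousOn.intervalIntegrable (continuousOn_const.div (by fun_prop)
      fun t ht => (hpos t ht).ne'))
  rw [h]
  simp

/-- The Bott-Chern difference form is a multiple of the logarithm of the ratio of the two metrics.
-/
theorem bcDifference_eq {U₀ U₁ : Opens (Hopf q n)} (h₀ : HermMetric U₀) (h₁ : HermMetric U₁)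
    {p : Vec n} (h0 : p ∈ cover U₀) (h1 : p ∈ cover U₁) :
    bcDifference h₀ h₁ p = (I / (2 * Real.pi) : ℂ) * (h₁.logN p - h₀.logN p) := by
  rw [bcDifference, integral_logDeriv_segment (h₀.pos p h0) (h₁.pos p h1), ofReal_sub]
  rfl

theorem isPreconnected_coord_one_ne : IsPreconnected {p : Vec 2 | p 1 ≠ 0} := by
  have h1 : IsPreconnected ({0}ᶜ : Set ℂ) :=
    (isConnected_compl_singleton_of_one_lt_rank (E := ℂ)
      (by rw [rank_real_complex]; exact Cardinal.one_lt_two) 0).isPreconnected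
  have h2 := (isPreconnected_univ (α := ℂ)).prod h1
  have h3 := h2.image (fun x : ℂ × ℂ => (![x.1, x.2] : Vec 2)) (by fun_prop)
  convert h3 using 1
  ext p
  constructor
  · intro h
    refine ⟨(p 0, p 1), ⟨trivial, h⟩, ?_⟩
    ext i
    fin_cases i <;> rfl
  · rintro ⟨x, ⟨_, hx⟩, rfl⟩
    exact hx

/-- A metric compatible with the connection given by the foliation is a constant multiple of
`1 / |y|²`. -/
theorem exists_logN_eq (h₀ : HermMetric (coordOpen q (1 : Fin 2)))
    (H : IsHConnection h₀ (coordMetric q (1 : Fin 2)).connection) :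
    ∃ K : ℂ, ∀ p ∈ cover (coordOpen q (1 : Fin 2)),
      h₀.logN p = (coordMetric q 1).logN p + K := by
  set h := coordMetric q (1 : Fin 2) with hh
  have hc : h.connection = h₀.connection :=
    IsMetricConnection.eq ⟨h.isMetricConnection_connection.1, H⟩
  have hset : cover (coordOpen q (1 : Fin 2)) = {p : Vec 2 | p 1 ≠ 0} :=
    Set.ext fun p => mem_cover_coordOpen
  have hf : ∀ p ∈ cover (coordOpen q (1 : Fin 2)), fderiv ℝ h₀.logN p = fderiv ℝ h.logN p := by
    intro p hp
    have e := congrArg (fun ω => toLin (ω.1 p)) hc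
    simp only [HermMetric.connection_apply _ hp, toLin_ofLin] at e
    rw [(h.hasFDerivAt_logN hp).fderiv, (h₀.hasFDerivAt_logN hp).fderiv] at e ⊢
    ext u
    have e1 := part_neg_one_add_conj ((h.N p)⁻¹ • fderiv ℝ h.N p) u
    rw [e, part_neg_one_add_conj] at e1
    exact e1
  have hconst : ∀ p ∈ cover (coordOpen q (1 : Fin 2)), ∀ p' ∈ cover (coordOpen q (1 : Fin 2)),
      h₀.logN p - h.logN p = h₀.logN p' - h.logN p' := by
    intro p hp p' hp'
    refine (isOpen_cover _).is_const_of_fderiv_eq_zero (𝕜 := ℝ) (f := fun p => h₀.logN p - h.logN p)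
      (hset ▸ isPreconnected_coord_one_ne) ?_ ?_ hp hp'
    · exact fun x hx => ((h₀.differentiableAt_logN hx).sub
        (h.differentiableAt_logN hx)).differentiableWithinAt
    · intro x hx
      rw [fderiv_fun_sub (h₀.differentiableAt_logN hx) (h.differentiableAt_logN hx), hf x hx,
        sub_self]
      rfl
  have hb : (![0, 1] : Vec 2) ∈ cover (coordOpen q (1 : Fin 2)) :=
    mem_cover_coordOpen.2 one_ne_zero
  refine ⟨h₀.logN ![0, 1] - h.logN ![0, 1], fun p hp => ?_⟩
  rw [← hconst p hp _ hb, add_sub_cancel]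

theorem ddbar_mem_type (τ : Form U 0) : Form.ddbar U τ ∈ Form.type U 2 1 1 :=
  Form.delbar_mem_type (a := 1) (b := 0)
    (Form.del_mem_type (a := 0) (b := 0) (Form.mem_type_zero τ))

theorem d_ddbar (τ : Form U 0) : Form.d U 2 (Form.ddbar U τ) = 0 := by
  have e : Form.ddbar U τ = Form.delbar U 1 (Form.del U 0 τ) := rfl
  rw [Form.d_eq, e, Form.delbar_delbar, Form.del_delbar, Form.del_del, map_zero, neg_zero,
    add_zero]

/-- A constant function. -/
def Form.const (U : Opens (Hopf q n)) (c : ℂ) : Form U 0 :=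
  Form.ofFun U (fun _ => c) contDiffOn_const fun _ _ => rfl

theorem Form.ddbar_const (c : ℂ) : Form.ddbar U (Form.const U c) = 0 := by
  refine Form.ext_on fun p hp => ?_
  have h : dop (-1) (fn fun _ : Vec n => c) = fun _ => 0 := by
    funext x
    rw [dop_fn (differentiableAt_const c), fderiv_fun_const]
    ext v
    simp [ofLin_apply, part_apply]
  rw [Form.const, Form.ddbar_ofFun hp, h, dop, fderiv_fun_const]
  ext v
  simp [ContinuousAlternatingMap.alternatizeUncurryFin_apply, part_apply]

theorem mem_BRel_of_eq {U₀ U₁ : Opens (Hopf q n)} (τ : Form U₁ 0) :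
    (Form.ddbar U₁ τ, Form.res (inf_le_right : U₀ ⊓ U₁ ≤ U₁) 0 τ) ∈ BRel U₀ U₁ :=
  ⟨τ, rfl⟩

theorem BRel_le_ZRel (U₀ U₁ : Opens (Hopf q n)) : BRel U₀ U₁ ≤ ZRel U₀ U₁ := by
  rintro _ ⟨τ, rfl⟩
  refine ⟨ddbar_mem_type τ, d_ddbar τ, ?_⟩
  change Form.res _ 2 (Form.ddbar U₁ τ) - Form.ddbar (U₀ ⊓ U₁) (Form.res _ 0 τ) = 0
  rw [Form.ddbar_res, sub_self]

theorem contDiffOn_log_quot (q : ℂˣ) : ContDiffOn ℝ (⊤ : ℕ∞)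
    (fun p : Vec 2 => γ * (((Real.log (‖p 0‖ ^ 2) : ℝ) : ℂ) - ((Real.log (‖p 1‖ ^ 2) : ℝ) : ℂ)))
    (cover (coordOpen q (1 : Fin 2) ⊓ coordOpen q (0 : Fin 2))) := by
  intro p hp
  obtain ⟨h1, h0⟩ := mem_cover_inf.1 hp
  exact (contDiffAt_const.mul ((contDiffAt_log_norm_sq (mem_cover_coordOpen.1 h0) le_rfl).sub
    (contDiffAt_log_norm_sq (mem_cover_coordOpen.1 h1) le_rfl))).contDiffWithinAt

/-- The function `γ log |x / y|²`. -/
def logQuot (q : ℂˣ) : Form (coordOpen q (1 : Fin 2) ⊓ coordOpen q (0 : Fin 2)) 0 :=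
  Form.ofFun _ (fun p => γ * (((Real.log (‖p 0‖ ^ 2) : ℝ) : ℂ) - ((Real.log (‖p 1‖ ^ 2) : ℝ) : ℂ)))
    (contDiffOn_log_quot q)
    fun p hp => by
      obtain ⟨h1, h0⟩ := mem_cover_inf.1 hp
      have h0' : ‖p 0‖ ≠ 0 := norm_ne_zero_iff.2 (mem_cover_coordOpen.1 h0)
      have h1' : ‖p 1‖ ≠ 0 := norm_ne_zero_iff.2 (mem_cover_coordOpen.1 h1)
      have hq : ‖(q : ℂ)‖ ≠ 0 := norm_ne_zero_iff.2 q.ne_zero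
      simp only [Pi.smul_apply, smul_eq_mul, norm_mul, mul_pow]
      rw [Real.log_mul (by positivity) (by positivity), Real.log_mul (by positivity)
        (by positivity)]
      push_cast
      ring

theorem val_logQuot {p : Vec 2}
    (hp : p ∈ cover (coordOpen q (1 : Fin 2) ⊓ coordOpen q (0 : Fin 2))) :
    val (logQuot q).1 p =
      γ * (((Real.log (‖p 0‖ ^ 2) : ℝ) : ℂ) - ((Real.log (‖p 1‖ ^ 2) : ℝ) : ℂ)) :=
  Form.val_ofFun hp

theorem ddbar_logQuot (q : ℂˣ) : Form.ddbar _ (logQuot q) = 0 := by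
  refine Form.ext_on fun p hp => ?_
  obtain ⟨h1, h0⟩ := mem_cover_inf.1 hp
  have h0' := mem_cover_coordOpen.1 h0
  have h1' := mem_cover_coordOpen.1 h1
  have hm : (2 : WithTop ℕ∞) ≤ (⊤ : ℕ∞) := WithTop.coe_le_coe.2 le_top
  have c0 := contDiffAt_fn (contDiffAt_log_norm_sq h0' hm)
  have c1 := contDiffAt_fn (contDiffAt_log_norm_sq h1' hm)
  have e : (fn fun p : Vec 2 =>
      γ * (((Real.log (‖p 0‖ ^ 2) : ℝ) : ℂ) - ((Real.log (‖p 1‖ ^ 2) : ℝ) : ℂ))) =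
      fun p => γ • (fn (fun p : Vec 2 => ((Real.log (‖p 0‖ ^ 2) : ℝ) : ℂ)) p -
        fn (fun p : Vec 2 => ((Real.log (‖p 1‖ ^ 2) : ℝ) : ℂ)) p) := rfl
  rw [logQuot, Form.ddbar_ofFun hp, e, dop_dop_const_smul _ (c0.sub c1), dop_dop_sub c0 c1,
    dop_dop_log_norm_sq h0', dop_dop_log_norm_sq h1', sub_zero]
  exact smul_zero _

theorem logQuot_mem_ZRel (q : ℂˣ) :
    ((0, logQuot q) : RelCochain (coordOpen q (1 : Fin 2)) (coordOpen q (0 : Fin 2))) ∈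
      ZRel (coordOpen q (1 : Fin 2)) (coordOpen q (0 : Fin 2)) :=
  ⟨zero_mem _, map_zero _, by rw [map_zero, ddbar_logQuot, sub_zero]⟩

/-- The localization of the Bott-Chern class, the class of `(0, γ log |x / y|²)`. -/
def localClass (q : ℂˣ) : HRel (coordOpen q (1 : Fin 2)) (coordOpen q (0 : Fin 2)) :=
  Coh.mk _ ⟨(0, logQuot q), logQuot_mem_ZRel q⟩

theorem val_logRatio {h h' : HermMetric U} {p : Vec n} (hp : p ∈ cover U) :
    val (logRatio h h').1 p = h'.logN p - h.logN p :=
  Form.val_ofFun hp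

theorem val_add (s t : Form U 0) (p : Vec n) : val (s + t).1 p = val s.1 p + val t.1 p := rfl

theorem val_sub (s t : Form U 0) (p : Vec n) : val (s - t).1 p = val s.1 p - val t.1 p := rfl

theorem val_smul (c : ℂ) (s : Form U 0) (p : Vec n) : val (c • s).1 p = c * val s.1 p := rfl

/-- The localization does not depend on the metrics: on `U₀` the metric is a constant multiple of `1
/ |y|²`, and on `U₁` a change of the metric is a coboundary. -/
theorem isLocalization_localClass (q : ℂˣ) : IsLocalization (localClass q) := by
  intro θ₀ h₀ θ₁ h₁ hθ₀ hh₀ hθ₁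
  rw [hθ₀.eq] at hh₀ ⊢
  rw [hθ₁.eq]
  refine ⟨chernForm_coordMetric 1, ?_⟩
  obtain ⟨K, hK⟩ := exists_logN_eq h₀ hh₀
  let c : ℂ := I / (2 * Real.pi)
  let τ : Form (coordOpen q (0 : Fin 2)) 0 :=
    c • logRatio (coordMetric q 0) h₁ - Form.const _ (c * K)
  have hτ := mem_BRel_of_eq (U₀ := coordOpen q (1 : Fin 2)) τ
  refine ⟨⟨_, add_mem (logQuot_mem_ZRel q) (BRel_le_ZRel _ _ hτ)⟩, ?_, fun p hp => ?_, ?_⟩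
  · change 0 + Form.ddbar _ τ = _
    rw [zero_add, map_sub, Form.ddbar_const, sub_zero, ← chernForm_sub, chernForm_coordMetric,
      sub_zero]
  · obtain ⟨h1, h0⟩ := mem_cover_inf.1 hp
    change val (logQuot q + Form.res _ 0 τ).1 p = _
    rw [val_add, Form.val_res _ _ hp, val_sub, val_smul, val_logRatio h0, Form.const,
      Form.val_ofFun h0, val_logQuot hp, bcDifference_eq h₀ h₁ h1 h0, hK p h1, coordMetric_logN,
      coordMetric_logN, γ_eq]
    simp only [c]
    ring
  · refine coh_mk_eq.2 ?_
    change _ + _ - _ ∈ _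
    rw [add_sub_cancel_left]
    exact hτ

/-- The restriction of a metric. -/
def HermMetric.res {U W : Opens (Hopf q n)} (hW : W ≤ U) (h : HermMetric U) : HermMetric W where
  N := h.N
  smooth := h.smooth.mono (cover_mono hW)
  pos p hp := h.pos p (cover_mono hW hp)
  equivariant p hp := h.equivariant p (cover_mono hW hp)

theorem chernForm_res {U W : Opens (Hopf q n)} (hW : W ≤ U) (h : HermMetric U) :
    chernForm (h.res hW).connection = Form.res hW 2 (chernForm h.connection) := by
  refine Form.ext_on fun p hp => ?_
  rw [Form.res_apply _ _ hp, chernForm_connection_apply _ hp,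
    chernForm_connection_apply _ (cover_mono hW hp)]
  rfl

/-- The ratios of a global metric to `1 / |y|²` and `1 / |x|²` bound the difference of the two
cocycles. -/
theorem jStar_localClass (q : ℂˣ) :
    jStar _ _ (localClass q) = toCech _ _ (bottChern q) := by
  let c : ℂ := I / (2 * Real.pi)
  let τ : (i : Fin 2) → Form (coordOpen q i) 0 := fun i =>
    -(c • logRatio (coordMetric q i) ((sumMetric q).res le_top))
  have hτ : ∀ i, Form.ddbar _ (τ i) = -Form.res le_top 2 (chernForm (sumMetric q).connection) := by
    intro i
    rw [map_neg, ← chernForm_sub, chernForm_coordMetric, sub_zero, chernForm_res]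
  refine (coh_mk_eq (Z := ZCech _ _) (B := BCech _ _) (z := ⟨_, _⟩) (z' := ⟨_, _⟩)).2
    ⟨(τ 1, τ 0), ?_⟩
  refine Prod.ext ?_ (Prod.ext ?_ ?_)
  · change Form.ddbar _ (τ 1) = 0 - Form.res le_top 2 (chernForm (sumMetric q).connection)
    rw [hτ, zero_sub]
  · change Form.ddbar _ (τ 0) = 0 - Form.res le_top 2 (chernForm (sumMetric q).connection)
    rw [hτ, zero_sub]
  · change Form.res inf_le_right 0 (τ 0) - Form.res inf_le_left 0 (τ 1) = logQuot q - 0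
    refine Form.ext_val fun p hp => ?_
    obtain ⟨h1, h0⟩ := mem_cover_inf.1 hp
    rw [sub_zero, val_sub, Form.val_res _ _ hp, Form.val_res _ _ hp, val_logQuot hp]
    simp only [τ, ← neg_smul]
    rw [val_smul, val_smul, val_logRatio h0, val_logRatio h1, coordMetric_logN, coordMetric_logN,
      γ_eq]
    change -c * ((sumMetric q).logN p - _) - -c * ((sumMetric q).logN p - _) = _
    simp only [c]
    ring

end

section

open MeasureTheory
variable {q : ℂˣ} {n k m : ℕ} {U : Opens (Hopf q n)}

/-! ### The invariant forms `d log z_i` and `d log z̄_i` -/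

theorem hasFDerivAt_inv_conj_coord {i : Fin n} {p : Vec n} (h : p i ≠ 0) :
    HasFDerivAt (fun x : Vec n => (starRingEnd ℂ (x i))⁻¹)
      ((-((starRingEnd ℂ (p i)) ^ 2)⁻¹ : ℂ) • dzBar i) p := by
  have h1 := ((hasDerivAt_inv ((map_ne_zero (starRingEnd ℂ)).2 h)).hasFDerivAt.restrictScalars
    ℝ).comp p (dzBar (n := n) i).hasFDerivAt
  refine h1.congr_fderiv ?_
  ext v
  simp
  ring

theorem dlogBar_eq_smul (i : Fin n) :
    dlogBar i = fun p => (starRingEnd ℂ (p i))⁻¹ • ofLin (dzBar (n := n) i) := rfl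

/-- The form `d log z̄_i` is antiholomorphic and closed. -/
theorem dop_dlogBar {i : Fin n} {p : Vec n} (h : p i ≠ 0) {ε : ℂ} (hε : ε = -1 ∨ ε = 1) :
    dop ε (dlogBar i) p = 0 := by
  have hi := hasFDerivAt_inv_conj_coord h
  rcases hε with rfl | rfl
  · rw [dlogBar_eq_smul, dop_smul hi.differentiableAt (differentiableAt_const _), hi.fderiv,
      part_neg_one_of_antilinear (smul_dzBar_I _ i)]
    have e0 : dop (-1) (fun _ : Vec n => ofLin (dzBar (n := n) i)) p = 0 := by
      rw [dop, fderiv_fun_const]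
      ext v
      simp [ContinuousAlternatingMap.alternatizeUncurryFin_apply, part_apply]
    rw [e0, smul_zero, add_zero]
    exact LinearMap.map_zero₂ ((wedgeLinL n 1).toLinearMap₁₂) _
  · have e : dlogBar i =ᶠ[nhds p]
        dop 1 (fn fun x : Vec n => ((Real.log (‖x i‖ ^ 2) : ℝ) : ℂ)) := by
      filter_upwards [(isOpen_coord_ne i).mem_nhds h] with x hx
      exact (dop_log_norm_sq_one hx).symm
    rw [dop_congr e]
    exact dop_dop_self (contDiffAt_fn (contDiffAt_log_norm_sq h
      (WithTop.coe_le_coe.2 (le_top : (2 : ℕ∞) ≤ ⊤))))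

theorem toLin_dlog (i : Fin n) (p : Vec n) (v : Vec n) : toLin (dlog i p) v = (p i)⁻¹ * v i := rfl

theorem toLin_dlogBar (i : Fin n) (p : Vec n) (v : Vec n) :
    toLin (dlogBar i p) v = (starRingEnd ℂ (p i))⁻¹ * starRingEnd ℂ (v i) := rfl

theorem contDiffOn_dlog {i : Fin n} {s : Set (Vec n)} (h : ∀ p ∈ s, p i ≠ 0) :
    ContDiffOn ℝ (⊤ : ℕ∞) (dlog i) s := by
  have h1 : ContDiffOn ℝ (⊤ : ℕ∞) (fun p : Vec n => (p i)⁻¹) s :=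
    (contDiff_apply ℝ ℂ i).contDiffOn.inv h
  rw [dlog_eq_smul]
  exact h1.smul (contDiffOn_const (c := ofLin (dz (n := n) i)))

theorem contDiffOn_dlogBar {i : Fin n} {s : Set (Vec n)} (h : ∀ p ∈ s, p i ≠ 0) :
    ContDiffOn ℝ (⊤ : ℕ∞) (dlogBar i) s := by
  have h0 : ContDiffOn ℝ (⊤ : ℕ∞) (fun p : Vec n => starRingEnd ℂ (p i)) s :=
    ((conjCLE : ℂ →L[ℝ] ℂ).contDiff.comp (contDiff_apply ℝ ℂ i)).contDiffOn
  have h1 : ContDiffOn ℝ (⊤ : ℕ∞) (fun p : Vec n => (starRingEnd ℂ (p i))⁻¹) s :=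
    h0.inv fun p hp => (map_ne_zero (starRingEnd ℂ)).2 (h p hp)
  rw [dlogBar_eq_smul]
  exact h1.smul (contDiffOn_const (c := ofLin (dzBar (n := n) i)))

/-- The form `d log z_i` on an open set where `z_i` does not vanish. -/
def Form.dlog (U : Opens (Hopf q n)) (i : Fin n) (h : ∀ p ∈ cover U, p i ≠ 0) : Form U 1 :=
  Form.ofCover U (HopfBC.dlog i) (contDiffOn_dlog h)
    fun p hp v => by
      change toLin (HopfBC.dlog i _) ((q : ℂ) • v 0) = toLin (HopfBC.dlog i _) (v 0)
      have := h p hp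
      have := q.ne_zero
      rw [toLin_dlog, toLin_dlog, Pi.smul_apply, Pi.smul_apply, smul_eq_mul, smul_eq_mul]
      field_simp

/-- The form `d log z̄_i` on an open set where `z_i` does not vanish. -/
def Form.dlogBar (U : Opens (Hopf q n)) (i : Fin n) (h : ∀ p ∈ cover U, p i ≠ 0) : Form U 1 :=
  Form.ofCover U (HopfBC.dlogBar i) (contDiffOn_dlogBar h)
    fun p hp v => by
      change toLin (HopfBC.dlogBar i _) ((q : ℂ) • v 0) = toLin (HopfBC.dlogBar i _) (v 0)
      have := (map_ne_zero (starRingEnd ℂ)).2 (h p hp)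
      have := (map_ne_zero (starRingEnd ℂ)).2 q.ne_zero
      rw [toLin_dlogBar, toLin_dlogBar, Pi.smul_apply, Pi.smul_apply, smul_eq_mul, smul_eq_mul,
        map_mul, map_mul]
      field_simp

section
variable {i : Fin n} {h : ∀ p ∈ cover U, p i ≠ 0}

theorem Form.dlog_apply {p : Vec n} (hp : p ∈ cover U) :
    (Form.dlog U i h).1 p = HopfBC.dlog i p := Form.ofCover_apply hp

theorem Form.dlogBar_apply {p : Vec n} (hp : p ∈ cover U) :
    (Form.dlogBar U i h).1 p = HopfBC.dlogBar i p := Form.ofCover_apply hp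

theorem Form.del_dlog : Form.del U 1 (Form.dlog U i h) = 0 := by
  refine Form.ext_on fun p hp => ?_
  rw [Form.del_apply _ hp, dop_congr (Form.eventuallyEq (fun x => Form.dlog_apply) hp),
    dop_dlog (h p hp) (Or.inl rfl)]
  rfl

theorem Form.delbar_dlog : Form.delbar U 1 (Form.dlog U i h) = 0 := by
  refine Form.ext_on fun p hp => ?_
  rw [Form.delbar_apply _ hp, dop_congr (Form.eventuallyEq (fun x => Form.dlog_apply) hp),
    dop_dlog (h p hp) (Or.inr rfl)]
  rfl

theorem Form.del_dlogBar : Form.del U 1 (Form.dlogBar U i h) = 0 := by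
  refine Form.ext_on fun p hp => ?_
  rw [Form.del_apply _ hp, dop_congr (Form.eventuallyEq (fun x => Form.dlogBar_apply) hp),
    dop_dlogBar (h p hp) (Or.inl rfl)]
  rfl

theorem Form.delbar_dlogBar : Form.delbar U 1 (Form.dlogBar U i h) = 0 := by
  refine Form.ext_on fun p hp => ?_
  rw [Form.delbar_apply _ hp, dop_congr (Form.eventuallyEq (fun x => Form.dlogBar_apply) hp),
    dop_dlogBar (h p hp) (Or.inr rfl)]
  rfl

theorem Form.mem_type_one_of_toLin {α : Form U 1} {a b : ℕ}
    (H : ∀ p ∈ cover U, ∀ (c : ℂ) (v : Vec n),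
      toLin (α.1 p) (c • v) = c ^ a * starRingEnd ℂ c ^ b * toLin (α.1 p) v) :
    α ∈ Form.type U 1 a b := by
  intro p v c
  by_cases hp : p ∈ cover U
  · have h1 := H p hp c (v 0)
    rw [toLin_apply, toLin_apply] at h1
    have e : ∀ w : Fin 1 → Vec n, w = ![w 0] := fun w => by
      ext i
      fin_cases i
      rfl
    rw [e v, e (fun i => c • (![v 0] : Fin 1 → Vec n) i)]
    exact h1
  · rw [α.2.2.2 p hp]
    simp

theorem Form.dlog_mem_type : Form.dlog U i h ∈ Form.type U 1 1 0 := by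
  refine Form.mem_type_one_of_toLin fun p hp c v => ?_
  rw [Form.dlog_apply hp, toLin_dlog, toLin_dlog, Pi.smul_apply, smul_eq_mul]
  ring

theorem Form.dlogBar_mem_type : Form.dlogBar U i h ∈ Form.type U 1 0 1 := by
  refine Form.mem_type_one_of_toLin fun p hp c v => ?_
  rw [Form.dlogBar_apply hp, toLin_dlogBar, toLin_dlogBar, Pi.smul_apply, smul_eq_mul, map_mul]
  ring

end

theorem wedge_one_one (α β : Alt n 1) : (wedge α β : Alt n 2) = wedgeLin (toLin α) β := by
  ext v
  rw [wedge_one_one_apply, wedgeLin_apply, Fin.sum_univ_two]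
  have e0 : (0 : Fin 2).removeNth v = ![v 1] := by ext i; fin_cases i; rfl
  have e1 : (1 : Fin 2).removeNth v = ![v 0] := by ext i; fin_cases i; rfl
  simp [e0, e1, toLin_apply]
  ring

/-- The form `(γ / (2 log |q|)) d log z_i ∧ d log z̄_i`. -/
def areaForm (U : Opens (Hopf q n)) (i : Fin n) (h : ∀ p ∈ cover U, p i ≠ 0) : Form U 2 :=
  (γ / (2 * Real.log ‖(q : ℂ)‖) : ℂ) • Form.wedge (Form.dlog U i h) (Form.dlogBar U i h)

section
variable {i : Fin n} {h : ∀ p ∈ cover U, p i ≠ 0}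

theorem areaForm_apply {p : Vec n} (hp : p ∈ cover U) :
    (areaForm U i h).1 p = (γ / (2 * Real.log ‖(q : ℂ)‖) : ℂ) •
      (wedge (dlog i p) (dlogBar i p) : Alt n 2) := by
  rw [wedge_one_one, areaForm, Submodule.coe_smul, Pi.smul_apply, Form.wedge_apply,
    Form.dlog_apply hp, Form.dlogBar_apply hp]

theorem areaForm_apply_apply {p : Vec n} (hp : p ∈ cover U) (v : Fin 2 → Vec n) :
    (areaForm U i h).1 p v = (γ / (2 * Real.log ‖(q : ℂ)‖) : ℂ) *
      ((p i)⁻¹ * v 0 i * ((starRingEnd ℂ (p i))⁻¹ * starRingEnd ℂ (v 1 i)) -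
        (p i)⁻¹ * v 1 i * ((starRingEnd ℂ (p i))⁻¹ * starRingEnd ℂ (v 0 i))) := by
  rw [areaForm_apply hp, ContinuousAlternatingMap.smul_apply, wedge_one_one_apply, smul_eq_mul,
    ← toLin_apply, ← toLin_apply, ← toLin_apply, ← toLin_apply, toLin_dlog, toLin_dlogBar,
    toLin_dlog, toLin_dlogBar]

theorem del_areaForm : Form.del U 2 (areaForm U i h) = 0 := by
  rw [areaForm, map_smul, Form.del_wedge_of_eq_zero _ _ Form.del_dlog, Form.del_dlogBar,
    Form.wedge_zero, neg_zero, smul_zero]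

theorem delbar_areaForm : Form.delbar U 2 (areaForm U i h) = 0 := by
  rw [areaForm, map_smul, Form.delbar_wedge_of_eq_zero _ _ Form.delbar_dlog, Form.delbar_dlogBar,
    Form.wedge_zero, neg_zero, smul_zero]

theorem areaForm_mem_ZA : areaForm U i h ∈ ZA U := by
  refine ⟨Submodule.smul_mem _ _ (Form.wedge_mem_type (a := 1) (b := 0) (a' := 0) (b' := 1)
    Form.dlog_mem_type Form.dlogBar_mem_type), ?_⟩
  change Form.delbar U 3 (Form.del U 2 _) = 0
  rw [del_areaForm, map_zero]

end

end

section

open MeasureTheory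
variable {q : ℂˣ} {n k m : ℕ} {U : Opens (Hopf q n)}

/-! ### The residue -/

theorem cubeIntegral_congr {c : (Fin m → ℝ) → Vec n} {a b : Fin m → ℝ} {ω ω' : Vec n → Alt n m}
    (h : ∀ s ∈ Set.Icc a b, ω (c s) = ω' (c s)) :
    cubeIntegral c a b ω = cubeIntegral c a b ω' :=
  setIntegral_congr_fun measurableSet_Icc fun s hs => by simp only [h s hs]

theorem integrableOn_cube {c : (Fin m → ℝ) → Vec n} (hc : ContDiff ℝ (⊤ : ℕ∞) c)
    {a b : Fin m → ℝ} (ω : Form U m) (h : ∀ s ∈ Set.Icc a b, c s ∈ cover U) :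
    IntegrableOn (fun s => ω.1 (c s) (fun i => fderiv ℝ c s (Pi.single i 1))) (Set.Icc a b) := by
  refine ContinuousOn.integrableOn_compact isCompact_Icc ?_
  have h1 : ContinuousOn (fun x => ω.1 (c x)) (Set.Icc a b) :=
    ω.2.1.continuousOn.comp hc.continuous.continuousOn h
  have h2 : Continuous (fderiv ℝ c) := hc.continuous_fderiv (by simp)
  exact h1.eval (by fun_prop)

theorem cubeIntegral_add {c : (Fin m → ℝ) → Vec n} (hc : ContDiff ℝ (⊤ : ℕ∞) c)
    {a b : Fin m → ℝ} (ω ω' : Form U m) (h : ∀ s ∈ Set.Icc a b, c s ∈ cover U) :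
    cubeIntegral c a b (ω + ω').1 = cubeIntegral c a b ω.1 + cubeIntegral c a b ω'.1 :=
  integral_add (integrableOn_cube hc ω h) (integrableOn_cube hc ω' h)

theorem cubeIntegral_smul {c : (Fin m → ℝ) → Vec n} {a b : Fin m → ℝ} (r : ℂ) (ω : Form U m) :
    cubeIntegral c a b (r • ω).1 = r * cubeIntegral c a b ω.1 :=
  integral_const_mul r _

theorem integralBdryR₁_congr {δ : ℝ} (h0 : 0 ≤ δ) {ω ω' : Vec 2 → Alt 2 3}
    (h : ∀ p ∈ tubeSet δ δ, ω p = ω' p) : integralBdryR₁ q δ ω = integralBdryR₁ q δ ω' :=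
  cubeIntegral_congr fun _ _ => h _ (tubePoint_mem_tubeSet h0 ⟨le_rfl, le_rfl⟩ _ _ _)

theorem integralBdryR₁_add {X : Opens (Hopf q 2)} {δ : ℝ} (h0 : 0 ≤ δ) (ω ω' : Form X 3)
    (hX : tubeSet δ δ ⊆ cover X) :
    integralBdryR₁ q δ (ω + ω').1 = integralBdryR₁ q δ ω.1 + integralBdryR₁ q δ ω'.1 :=
  cubeIntegral_add (contDiff_tube_bdry δ) ω ω' fun _ _ =>
    hX (tubePoint_mem_tubeSet h0 ⟨le_rfl, le_rfl⟩ _ _ _)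

theorem integralBdryR₁_smul {X : Opens (Hopf q 2)} {δ : ℝ} (r : ℂ) (ω : Form X 3) :
    integralBdryR₁ q δ (r • ω).1 = r * integralBdryR₁ q δ ω.1 :=
  cubeIntegral_smul r ω

theorem tubeSet_mono {a b a' b' : ℝ} (ha : a' ≤ a) (hb : b ≤ b') : tubeSet a b ⊆ tubeSet a' b' :=
  fun _ ⟨h0, h1, h2⟩ => ⟨h0, (mul_le_mul_of_nonneg_right ha (norm_nonneg _)).trans h1,
    h2.trans (mul_le_mul_of_nonneg_right hb (norm_nonneg _))⟩

/-- The integral of a closed form over `|y / x| = δ` does not depend on `δ`. -/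
theorem integralBdryR₁_eq_of_closed (hq : ‖(q : ℂ)‖ < 1) {X : Opens (Hopf q 2)} {ω : Form X 3}
    (hω : Form.d X 3 ω = 0) {δ' δ : ℝ} (h0 : 0 ≤ δ') (hδ : δ' ≤ δ)
    (hX : tubeSet δ' δ ⊆ cover X) : integralBdryR₁ q δ ω.1 = integralBdryR₁ q δ' ω.1 := by
  have h1 := integral_tube_extDeriv hq ω h0 hδ hX
  rw [cubeIntegral_congr (ω' := fun _ => 0)] at h1
  · exact sub_eq_zero.1 (h1.symm.trans
      (integral_eq_zero_of_ae (Filter.Eventually.of_forall fun _ => rfl)))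
  · intro s hs
    rw [← Form.d_apply ω (hX (tubePoint_mem_tubeSet h0 ⟨hs.1 0, hs.2 0⟩ _ _ _)), hω]
    rfl

/-- The integrand of the residue over the boundary of the tube. -/
def residueIntegrand (s : Vec 2 → Alt 2 0) (ξ : Vec 2 → Alt 2 2) (p : Vec 2) : Alt 2 3 :=
  ((wedge (del s p) (ξ p) : Alt 2 3) - (1 / 2 : ℂ) • del (fun x => val s x • ξ x) p) +
    (-(wedge (delbar s p) (ξ p) : Alt 2 3) +
      (1 / 2 : ℂ) • delbar (fun x => val s x • ξ x) p)

theorem pairing_eq (q : ℂˣ) (δ : ℝ) (σ : Vec 2 → Alt 2 2) (s : Vec 2 → Alt 2 0)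
    (ξ : Vec 2 → Alt 2 2) :
    pairing q δ σ s ξ = integralR₁ q δ (fun p => wedge (σ p) (ξ p)) -
      integralBdryR₁ q δ (residueIntegrand s ξ) := rfl

theorem residueIntegrand_congr {s s' : Vec 2 → Alt 2 0} {ξ ξ' : Vec 2 → Alt 2 2} {p : Vec 2}
    (hs : s =ᶠ[nhds p] s') (hξ : ξ =ᶠ[nhds p] ξ') :
    residueIntegrand s ξ p = residueIntegrand s' ξ' p := by
  have h : (fun x => val s x • ξ x) =ᶠ[nhds p] fun x => val s' x • ξ' x := by
    filter_upwards [hs, hξ] with x h1 h2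
    simp only [val, h1, h2]
  simp only [residueIntegrand, del_eq_dop, delbar_eq_dop]
  rw [dop_congr hs, dop_congr hs, dop_congr h, dop_congr h, hξ.eq_of_nhds]

/-- On a common domain, the integrand of the residue is the residue form. -/
theorem residueIntegrand_eq {X U W : Opens (Hopf q 2)} (hU : X ≤ U) (hW : X ≤ W) (s : Form U 0)
    (ξ : Form W 2) {p : Vec 2} (hp : p ∈ cover X) :
    residueIntegrand s.1 ξ.1 p = (residueForm (Form.res hU 0 s) (Form.res hW 2 ξ)).1 p := by
  rw [residueForm_apply _ _ hp]
  exact residueIntegrand_congr (Form.eventuallyEq_res hU s hp).symm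
    (Form.eventuallyEq_res hW ξ hp).symm

theorem residueForm_add_left (s t : Form U 0) (ξ : Form U 2) :
    residueForm (s + t) ξ = residueForm s ξ + residueForm t ξ := by
  refine Form.ext_on fun p hp => ?_
  simp only [residueForm, map_add, Submodule.coe_smul, Submodule.coe_add, Submodule.coe_sub,
    Pi.smul_apply, Pi.add_apply, Pi.sub_apply, Form.wedge_apply, Form.mul_apply]
  have hv : val (s.1 + t.1) p = val s.1 p + val t.1 p := rfl
  have h : ∀ a b : Alt n 1, toLin (a + b) = toLin a + toLin b := fun a b => map_add (toLinL n) a b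
  simp only [h, hv, wedgeLin_add_left]
  module

theorem residueForm_add_right (s : Form U 0) (ξ ζ : Form U 2) :
    residueForm s (ξ + ζ) = residueForm s ξ + residueForm s ζ := by
  refine Form.ext_on fun p hp => ?_
  simp only [residueForm, map_add, Submodule.coe_smul, Submodule.coe_add, Submodule.coe_sub,
    Pi.smul_apply, Pi.add_apply, Pi.sub_apply, Form.wedge_apply, Form.mul_apply,
    wedgeLin_add_right]
  module

theorem residueForm_smul_right (s : Form U 0) (r : ℂ) (ξ : Form U 2) :
    residueForm s (r • ξ) = r • residueForm s ξ := by
  refine Form.ext_on fun p hp => ?_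
  simp only [residueForm, map_smul, Submodule.coe_smul, Submodule.coe_add, Submodule.coe_sub,
    Pi.smul_apply, Pi.add_apply, Pi.sub_apply, Form.wedge_apply, Form.mul_apply,
    wedgeLin_smul_right]
  module

/-- Every neighborhood of `C` contains a tube `|y| ≤ δ |x|`. -/
theorem exists_tubeSet_subset (hq : ‖(q : ℂ)‖ < 1) {W : Opens (Hopf q 2)}
    (hW : curve q ⊆ (W : Set (Hopf q 2))) : ∃ δ : ℝ, 0 < δ ∧ tubeSet 0 δ ⊆ cover W := by
  have hq0 : 0 < ‖(q : ℂ)‖ := norm_pos_iff.2 q.ne_zero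
  let K : Set (Vec 2) := (fun x : ℂ => ![x, 0]) ''
    (Metric.closedBall 0 1 ∩ {x | ‖(q : ℂ)‖ ≤ ‖x‖})
  have hK : IsCompact K := ((isCompact_closedBall 0 1).inter_right
    (isClosed_le continuous_const continuous_norm)).image (by fun_prop)
  have hKW : K ⊆ cover W := by
    rintro _ ⟨x, ⟨_, hx⟩, rfl⟩
    have hx0 : x ≠ 0 := norm_pos_iff.1 (hq0.trans_le hx)
    have h0 : (![x, 0] : Vec 2) ≠ 0 := fun h => hx0 (congrFun h 0)
    exact ⟨h0, hW ((mk_mem_curve h0).2 rfl)⟩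
  obtain ⟨δ, hδ, hsub⟩ := hK.exists_thickening_subset_open (isOpen_cover W) hKW
  refine ⟨δ / 2, half_pos hδ, fun p hp => ?_⟩
  obtain ⟨k, hk1, hk2⟩ := exists_zpow_mul_mem hq (norm_pos_iff.2 hp.1)
  rw [← norm_zpow_smul] at hk1 hk2
  set r := ((q ^ k : ℂˣ) : ℂ) with hr
  have h1 : r • p ∈ cover W := by
    refine hsub (Metric.mem_thickening_iff.2 ⟨![r • p 0, 0],
      ⟨r • p 0, ⟨mem_closedBall_zero_iff.2 hk2, hk1⟩, rfl⟩, ?_⟩)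
    refine (dist_pi_lt_iff hδ).2 fun i => ?_
    fin_cases i
    · simpa using hδ
    · have h2 : ‖r * p 1‖ ≤ δ / 2 := by
        rw [norm_mul]
        calc ‖r‖ * ‖p 1‖ ≤ ‖r‖ * (δ / 2 * ‖p 0‖) :=
              mul_le_mul_of_nonneg_left hp.2.2 (norm_nonneg _)
          _ = δ / 2 * ‖r • p 0‖ := by rw [norm_smul]; ring
          _ ≤ δ / 2 * 1 := mul_le_mul_of_nonneg_left hk2 (half_pos hδ).le
          _ = δ / 2 := mul_one _
      simpa using h2.trans_lt (half_lt_self hδ)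
  have h2 := smul_zpow_mem_cover h1 (-k)
  rwa [smul_smul, hr, ← Units.val_mul, ← zpow_add, neg_add_cancel, zpow_zero, Units.val_one,
    one_smul] at h2

/-- The open set `{x ≠ 0, y ≠ 0}` of the Hopf surface. -/
abbrev overlap (q : ℂˣ) : Opens (Hopf q 2) := coordOpen q (1 : Fin 2) ⊓ coordOpen q (0 : Fin 2)

theorem tubeSet_subset_overlap {δ' δ : ℝ} (h : 0 < δ') : tubeSet δ' δ ⊆ cover (overlap q) := by
  intro p hp
  have h0 : 0 < ‖p 0‖ := norm_pos_iff.2 hp.1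
  exact mem_cover_inf.2 ⟨mem_cover_coordOpen.2 (norm_pos_iff.1 ((mul_pos h h0).trans_le hp.2.1)),
    mem_cover_coordOpen.2 hp.1⟩

theorem tubeSet_subset_inf {W : Opens (Hopf q 2)} {δ' δ : ℝ} (h : 0 < δ')
    (hW : tubeSet 0 δ ⊆ cover W) : tubeSet δ' δ ⊆ cover (overlap q ⊓ W) := fun _ hp =>
  mem_cover_inf.2 ⟨tubeSet_subset_overlap h hp, hW (tubeSet_mono h.le le_rfl hp)⟩

/-- The form whose integral over `|y / x| = δ` is, up to sign, the residue. -/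
def localResidueForm (W : Opens (Hopf q 2)) (ξ : Form W 2) : Form (overlap q ⊓ W) 3 :=
  residueForm (Form.res inf_le_left 0 (logQuot q)) (Form.res inf_le_right 2 ξ)

theorem ddbar_res_logQuot {X : Opens (Hopf q 2)} (h : X ≤ overlap q) :
    Form.ddbar X (Form.res h 0 (logQuot q)) = 0 := by
  rw [Form.ddbar_res, ddbar_logQuot, map_zero]

theorem res_mem_ZA {U W : Opens (Hopf q n)} (h : W ≤ U) {ξ : Form U 2} (hξ : ξ ∈ ZA U) :
    Form.res h 2 ξ ∈ ZA W := by
  refine ⟨Form.res_type h hξ.1, ?_⟩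
  have h2 : Form.delbar U 3 (Form.del U 2 ξ) = 0 := hξ.2
  change Form.delbar W 3 (Form.del W 2 (Form.res h 2 ξ)) = 0
  rw [Form.del_res, Form.delbar_res, h2, map_zero]

/-- The form is closed because `∂̄∂ log |x / y|² = 0`. -/
theorem d_localResidueForm {W : Opens (Hopf q 2)} {ξ : Form W 2} (hξ : ξ ∈ ZA W) :
    Form.d _ 3 (localResidueForm W ξ) = 0 := by
  refine Form.ext_on fun p hp => ?_
  rw [localResidueForm, d_residueForm _ (res_mem_ZA _ hξ) hp, ddbar_res_logQuot]
  ext v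
  exact (wedge_two_two_apply _ _ v).trans (by simp)

/-- Two different radii give the same residue. -/
theorem integralBdryR₁_localResidueForm_eq (hq : ‖(q : ℂ)‖ < 1) {W : Opens (Hopf q 2)}
    {ξ : Form W 2} (hξ : ξ ∈ ZA W) {δ δ' : ℝ} (h0 : 0 < δ) (h0' : 0 < δ')
    (h : tubeSet 0 δ ⊆ cover W) (h' : tubeSet 0 δ' ⊆ cover W) :
    integralBdryR₁ q δ (localResidueForm W ξ).1 = integralBdryR₁ q δ' (localResidueForm W ξ).1 := by
  rcases le_total δ' δ with hl | hl
  · exact integralBdryR₁_eq_of_closed hq (d_localResidueForm hξ) h0'.le hl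
      (tubeSet_subset_inf h0' h)
  · exact (integralBdryR₁_eq_of_closed hq (d_localResidueForm hξ) h0.le hl
      (tubeSet_subset_inf h0 h')).symm

/-- The residue of a coboundary of Aeppli cohomology vanishes. -/
theorem integralBdryR₁_localResidueForm_of_mem_BA (hq : ‖(q : ℂ)‖ < 1) {W : Opens (Hopf q 2)}
    {ξ : Form W 2} (hξ : ξ ∈ BA W) {δ : ℝ} (h0 : 0 < δ) (h : tubeSet 0 δ ⊆ cover W) :
    integralBdryR₁ q δ (localResidueForm W ξ).1 = 0 := by
  obtain ⟨x, ⟨α, hα, rfl⟩, y, ⟨β, hβ, rfl⟩, rfl⟩ := Submodule.mem_sup.1 hξ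
  have hX := tubeSet_subset_inf (δ := δ) h0 h
  have hz : ∀ μ : Form (overlap q ⊓ W) 2, integralBdryR₁ q δ (Form.d _ 2 μ).1 = 0 := fun μ => by
    rw [← integralBdryR₁_extDeriv hq μ h0.le hX]
    exact integralBdryR₁_congr h0.le fun p hp => Form.d_apply μ (hX hp)
  have hs := ddbar_res_logQuot (q := q) (inf_le_left : overlap q ⊓ W ≤ _)
  rw [localResidueForm, map_add, residueForm_add_right, integralBdryR₁_add h0.le _ _ hX,
    ← Form.delbar_res, ← Form.del_res, residueForm_delbar hs (Form.res_type _ hα),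
    residueForm_del hs (Form.res_type _ hβ), hz, hz, add_zero]

/-- A cocycle in the class of the localization gives the integral of `localResidueForm`. -/
theorem pairing_eq_neg (hq : ‖(q : ℂ)‖ < 1) {W : Opens (Hopf q 2)} {ξ : Form W 2} (hξ : ξ ∈ ZA W)
    {δ : ℝ} (h0 : 0 < δ) (h : tubeSet 0 δ ⊆ cover W) (τ : Form (coordOpen q (0 : Fin 2)) 0) :
    pairing q δ (Form.ddbar _ τ).1 (logQuot q + Form.res inf_le_right 0 τ).1 ξ.1 =
      -integralBdryR₁ q δ (localResidueForm W ξ).1 := by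
  let Y : Opens (Hopf q 2) := coordOpen q (0 : Fin 2) ⊓ W
  have hX := tubeSet_subset_inf (δ := δ) h0 h
  have hXY : overlap q ⊓ W ≤ Y := inf_le_inf_right W inf_le_right
  have hY : tubeSet 0 δ ⊆ cover Y := fun p hp =>
    mem_cover_inf.2 ⟨mem_cover_coordOpen.2 hp.1, h hp⟩
  let η : Form Y 3 := residueForm (Form.res inf_le_left 0 τ) (Form.res inf_le_right 2 ξ)
  have hη : ∀ p ∈ cover (overlap q ⊓ W),
      (residueForm (Form.res (inf_le_left.trans inf_le_right) 0 τ)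
        (Form.res (inf_le_right : overlap q ⊓ W ≤ W) 2 ξ)).1 p = η.1 p := by
    intro p hp
    rw [← residueIntegrand_eq _ _ τ ξ hp, ← residueIntegrand_eq _ _ τ ξ (cover_mono hXY hp)]
  -- the coboundary `τ` contributes nothing: its two integrals cancel by Stokes' theorem
  have e1 : integralR₁ q δ (fun p => wedge ((Form.ddbar _ τ).1 p) (ξ.1 p)) =
      integralBdryR₁ q δ η.1 := by
    have hs := integral_tube_extDeriv hq η le_rfl h0.le hY
    rw [integralBdryR₁_zero, sub_zero] at hs
    rw [← hs, integralR₁]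
    refine cubeIntegral_congr fun s hs => ?_
    have hp := hY (tubePoint_mem_tubeSet le_rfl ⟨hs.1 0, hs.2 0⟩ (s 1) (s 2) (s 3))
    rw [← Form.d_apply η hp, d_residueForm _ (res_mem_ZA _ hξ) hp, Form.ddbar_res,
      Form.res_apply _ _ hp, Form.res_apply _ _ hp]
  have e2 : integralBdryR₁ q δ
      (residueIntegrand (logQuot q + Form.res inf_le_right 0 τ).1 ξ.1) =
      integralBdryR₁ q δ (localResidueForm W ξ).1 + integralBdryR₁ q δ η.1 := by
    have e3 : integralBdryR₁ q δ η.1 = integralBdryR₁ q δ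
        (residueForm (Form.res (inf_le_left.trans inf_le_right) 0 τ)
          (Form.res (inf_le_right : overlap q ⊓ W ≤ W) 2 ξ)).1 :=
      integralBdryR₁_congr h0.le fun p hp => (hη p (hX hp)).symm
    rw [e3, ← integralBdryR₁_add h0.le _ _ hX, localResidueForm, ← residueForm_add_left]
    refine integralBdryR₁_congr h0.le fun p hp => ?_
    rw [residueIntegrand_eq (X := overlap q ⊓ W) inf_le_left inf_le_right _ _ (hX hp), map_add,
      Form.res_res]
  rw [pairing_eq, e1, e2]
  ring

end

section

open MeasureTheory
variable {q : ℂˣ} {n k m : ℕ} {U : Opens (Hopf q n)}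

/-- The residue of `∂̄∂`-closed forms on a neighborhood `W` of `C`, computed on a tube of radius
`δ`. -/
def residueOn (hq : ‖(q : ℂ)‖ < 1) (W : Opens (Hopf q 2)) {δ : ℝ} (h0 : 0 < δ)
    (h : tubeSet 0 δ ⊆ cover W) : HA W →ₗ[ℂ] ℂ :=
  Submodule.liftQ _
    { toFun := fun ξ : ZA W => -integralBdryR₁ q δ (localResidueForm W ξ.1).1
      map_add' := fun ξ ζ => by
        rw [Submodule.coe_add, localResidueForm, map_add, residueForm_add_right,
          integralBdryR₁_add h0.le _ _ (tubeSet_subset_inf h0 h), neg_add]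
        rfl
      map_smul' := fun r ξ => by
        rw [Submodule.coe_smul, localResidueForm, map_smul, residueForm_smul_right,
          integralBdryR₁_smul, RingHom.id_apply, smul_eq_mul, mul_neg]
        rfl }
    (fun ξ hξ => by
      refine LinearMap.mem_ker.2 ?_
      change -integralBdryR₁ q δ (localResidueForm W ξ.1).1 = 0
      rw [integralBdryR₁_localResidueForm_of_mem_BA hq (ξ := ξ.1) hξ h0 h, neg_zero])

theorem residueOn_mk (hq : ‖(q : ℂ)‖ < 1) (W : Opens (Hopf q 2)) {δ : ℝ} (h0 : 0 < δ)
    (h : tubeSet 0 δ ⊆ cover W) (ξ : ZA W) :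
    residueOn hq W h0 h (Coh.mk (BA W) ξ) = -integralBdryR₁ q δ (localResidueForm W ξ.1).1 := rfl

theorem coh_mk_surjective {A : Type*} [AddCommGroup A] [Module ℂ A] {Z : Submodule ℂ A}
    (B : Submodule ℂ A) : Function.Surjective (Coh.mk (Z := Z) B) :=
  Submodule.mkQ_surjective _

theorem localResidueForm_res {W W' : Opens (Hopf q 2)} (h : W' ≤ W) (ξ : Form W 2) {p : Vec 2}
    (hp : p ∈ cover (overlap q ⊓ W')) :
    (localResidueForm W' (Form.res h 2 ξ)).1 p = (localResidueForm W ξ).1 p := by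
  rw [localResidueForm, localResidueForm, Form.res_res,
    ← residueIntegrand_eq _ _ _ ξ hp,
    ← residueIntegrand_eq _ _ _ ξ (cover_mono (inf_le_inf_left _ h) hp)]

theorem residueOn_res (hq : ‖(q : ℂ)‖ < 1) {W W' : Opens (Hopf q 2)} (hW : W' ≤ W) {δ δ' : ℝ}
    (h0 : 0 < δ) (h : tubeSet 0 δ ⊆ cover W) (h0' : 0 < δ') (h' : tubeSet 0 δ' ⊆ cover W')
    (x : HA W) : residueOn hq W' h0' h' (HA.res hW x) = residueOn hq W h0 h x := by
  obtain ⟨ξ, rfl⟩ := coh_mk_surjective _ x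
  rw [residueOn_mk, integralBdryR₁_localResidueForm_eq hq ξ.2 h0 h0' h
    (h'.trans (cover_mono hW))]
  change -integralBdryR₁ q δ' (localResidueForm W' (Form.res hW 2 ξ.1)).1 = _
  rw [integralBdryR₁_congr h0'.le fun p hp =>
    localResidueForm_res hW ξ.1 (tubeSet_subset_inf h0' h' hp)]

/-- The residue as a linear form on the germs of Aeppli classes along `C`. -/
def residue (hq : ‖(q : ℂ)‖ < 1) : Module.Dual ℂ (HAGerm q) :=
  Module.DirectLimit.lift ℂ (Nbhd q) _ _
    (fun W => residueOn hq (OrderDual.ofDual W).1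
      (exists_tubeSet_subset hq (OrderDual.ofDual W).2).choose_spec.1
      (exists_tubeSet_subset hq (OrderDual.ofDual W).2).choose_spec.2)
    fun _ _ h x => residueOn_res hq (OrderDual.ofDual_le_ofDual.2 h) _ _ _ _ x

theorem residue_mk (hq : ‖(q : ℂ)‖ < 1) {W : Opens (Hopf q 2)} (hW : curve q ⊆ W) (ξ : ZA W)
    {δ : ℝ} (h0 : 0 < δ) (h : tubeSet 0 δ ⊆ cover W) :
    residue hq (HAGerm.mk hW ξ) = -integralBdryR₁ q δ (localResidueForm W ξ.1).1 := by
  refine (Module.DirectLimit.lift_of _ _ _).trans ?_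
  refine congrArg Neg.neg (integralBdryR₁_localResidueForm_eq hq ξ.2 ?_ h0 ?_ h)
  · exact (exists_tubeSet_subset hq hW).choose_spec.1
  · exact (exists_tubeSet_subset hq hW).choose_spec.2

theorem tubeSet_zero (δ : ℝ) : tubeSet 0 δ = {p : Vec 2 | p 0 ≠ 0 ∧ ‖p 1‖ ≤ δ * ‖p 0‖} := by
  ext p
  exact ⟨fun ⟨h0, _, h⟩ => ⟨h0, h⟩, fun ⟨h0, h⟩ => ⟨h0, by rw [zero_mul]; exact norm_nonneg _, h⟩⟩

/-- The residue can be computed with every cocycle in the class of the localization and on every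
tube. -/
theorem isPsi_residue (hq : ‖(q : ℂ)‖ < 1) : IsPsi (localClass q) (residue hq) := by
  intro σ hσ W hW ξ δ h0 h
  rw [← tubeSet_zero] at h
  obtain ⟨τ, hτ⟩ := coh_mk_eq.1 hσ
  have h1 : Form.ddbar _ τ = σ.1.1 := by
    have := congrArg Prod.fst hτ
    change Form.ddbar _ τ = σ.1.1 - 0 at this
    rw [this, sub_zero]
  have h2 : logQuot q + Form.res inf_le_right 0 τ = σ.1.2 := by
    have := congrArg Prod.snd hτ
    change Form.res inf_le_right 0 τ = σ.1.2 - logQuot q at this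
    rw [this, add_sub_cancel]
  rw [residue_mk hq hW ξ h0 h, ← h1, ← h2, pairing_eq_neg hq ξ.2 h0 h]

/-- The image of a relative class in the dual of the germs of Aeppli classes is unique. -/
theorem IsPsi.eq (hq : ‖(q : ℂ)‖ < 1)
    {c : HRel (coordOpen q (1 : Fin 2)) (coordOpen q (0 : Fin 2))}
    {R R' : Module.Dual ℂ (HAGerm q)} (h : IsPsi c R) (h' : IsPsi c R') : R' = R := by
  obtain ⟨σ, hσ⟩ := coh_mk_surjective _ c
  refine Module.DirectLimit.hom_ext fun W => LinearMap.ext fun x => ?_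
  obtain ⟨ξ, rfl⟩ := coh_mk_surjective _ x
  obtain ⟨δ, h0, hδ⟩ := exists_tubeSet_subset hq (OrderDual.ofDual W).2
  rw [tubeSet_zero] at hδ
  exact (h' σ hσ _ (OrderDual.ofDual W).2 ξ δ h0 hδ).trans
    (h σ hσ _ (OrderDual.ofDual W).2 ξ δ h0 hδ).symm

/-- The tangent vectors of the tube along its angle, `u` and `ψ`. -/
theorem fderiv_tube_bdry (δ : ℝ) (s : Fin 3 → ℝ) :
    fderiv ℝ (fun s : Fin 3 → ℝ => tubePoint δ (s 0) (s 1) (s 2)) s (Pi.single 0 1) =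
        ![0, I * tubePoint δ (s 0) (s 1) (s 2) 1] ∧
      fderiv ℝ (fun s : Fin 3 → ℝ => tubePoint δ (s 0) (s 1) (s 2)) s (Pi.single 1 1) =
        tubePoint δ (s 0) (s 1) (s 2) ∧
      fderiv ℝ (fun s : Fin 3 → ℝ => tubePoint δ (s 0) (s 1) (s 2)) s (Pi.single 2 1) =
        I • tubePoint δ (s 0) (s 1) (s 2) := by
  have hd := ((contDiff_tube_bdry δ).differentiable (by simp)).differentiableAt.hasFDerivAt (x := s)
  have key : ∀ (i : Fin 3) (w : Vec 2),
      HasDerivAt (fun t : ℝ => (fun s : Fin 3 → ℝ => tubePoint δ (s 0) (s 1) (s 2))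
        (s + t • Pi.single i 1)) w 0 →
      fderiv ℝ (fun s : Fin 3 → ℝ => tubePoint δ (s 0) (s 1) (s 2)) s (Pi.single i 1) = w := by
    intro i w hw
    have hl := hd.comp_hasDerivAt_of_eq (0 : ℝ)
      (((hasDerivAt_id (0 : ℝ)).smul_const (Pi.single i 1 : Fin 3 → ℝ)).const_add s) (by simp)
    rw [one_smul] at hl
    exact hl.unique hw
  have hlin : ∀ a : ℝ, HasDerivAt (fun t : ℝ => ((a + t : ℝ) : ℂ)) 1 0 := fun a =>
    ((hasDerivAt_id' (0 : ℝ)).const_add a).ofReal_comp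
  have hx : ∀ (b : ℂ),
      HasDerivAt (fun t : ℝ => exp (((s 1 + t : ℝ) : ℂ) + b)) (exp (s 1 + b)) 0 := by
    intro b
    have := ((hlin (s 1)).add_const b).cexp
    simpa using this
  have hψ : ∀ (b : ℂ) (r : ℝ), HasDerivAt (fun t : ℝ => exp (b + ((r + t : ℝ) : ℂ) * I))
      (I * exp (b + r * I)) 0 := by
    intro b r
    have := (((hlin r).mul_const I).const_add b).cexp
    simpa [mul_comm] using this
  refine ⟨key 0 _ ?_, key 1 _ ?_, key 2 _ ?_⟩
  · rw [hasDerivAt_pi]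
    intro i
    fin_cases i
    · simpa [tubePoint] using hasDerivAt_const (0 : ℝ) (exp (s 1 + s 2 * I))
    · have h1 := ((hψ 0 (s 0)).const_mul (δ : ℂ)).mul_const (exp (s 1 + s 2 * I))
      simp only [zero_add] at h1
      have e : I * tubePoint δ (s 0) (s 1) (s 2) 1 =
          δ * (I * exp (s 0 * I)) * exp (s 1 + s 2 * I) := by
        rw [tubePoint_one, tubePoint_zero]
        ring
      simpa [tubePoint, mul_assoc, mul_left_comm] using h1
  · rw [hasDerivAt_pi]
    intro i
    fin_cases i
    · simpa [tubePoint] using hx (s 2 * I)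
    · simpa [tubePoint] using (hx (s 2 * I)).const_mul (δ * exp (s 0 * I) : ℂ)
  · rw [hasDerivAt_pi]
    intro i
    fin_cases i
    · simpa [tubePoint] using hψ (s 1) (s 2)
    · have h1 := (hψ (s 1) (s 2)).const_mul (δ * exp (s 0 * I) : ℂ)
      simpa [tubePoint, mul_assoc, mul_left_comm] using h1

theorem ne_zero_of_mem_coordOpen {i : Fin n} :
    ∀ p ∈ cover (coordOpen q i), p i ≠ 0 := fun _ => mem_cover_coordOpen.1

theorem fderiv_logQuot {p : Vec 2} (hp : p ∈ cover (overlap q)) :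
    fderiv ℝ (val (logQuot q).1) p =
      γ • (((p 0)⁻¹ • dz 0 + (starRingEnd ℂ (p 0))⁻¹ • dzBar 0) -
        ((p 1)⁻¹ • dz 1 + (starRingEnd ℂ (p 1))⁻¹ • dzBar 1)) := by
  obtain ⟨h1, h0⟩ := mem_cover_inf.1 hp
  have h := ((hasFDerivAt_log_norm_sq (mem_cover_coordOpen.1 h0)).fun_sub
    (hasFDerivAt_log_norm_sq (mem_cover_coordOpen.1 h1))).const_mul γ
  refine (h.congr_of_eventuallyEq ?_).fderiv
  filter_upwards [(isOpen_cover _).mem_nhds hp] with x hx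
  exact val_logQuot hx

/-- The residue of the normalized area form is `1`. -/
theorem residue_areaForm (hq : ‖(q : ℂ)‖ < 1) :
    residue hq (HAGerm.mk (curve_subset q)
      ⟨areaForm (coordOpen q (0 : Fin 2)) 0 ne_zero_of_mem_coordOpen, areaForm_mem_ZA⟩) = 1 := by
  set ξ := areaForm (coordOpen q (0 : Fin 2)) 0 ne_zero_of_mem_coordOpen with hξ
  have hlog : Real.log ‖(q : ℂ)‖ ≠ 0 := (log_norm_neg hq).ne
  have hW : tubeSet 0 1 ⊆ cover (coordOpen q (0 : Fin 2)) := fun p hp => mem_cover_coordOpen.2 hp.1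
  have hX := tubeSet_subset_inf (δ := 1) one_pos hW
  rw [residue_mk hq (curve_subset q) _ one_pos hW]
  -- on the parametrized tube the integrand of the residue is constant
  have key : ∀ s : Fin 3 → ℝ, (localResidueForm (coordOpen q (0 : Fin 2)) ξ).1
      (tubePoint 1 (s 0) (s 1) (s 2)) (fun i => fderiv ℝ
        (fun s : Fin 3 → ℝ => tubePoint 1 (s 0) (s 1) (s 2)) s (Pi.single i 1)) =
      1 / (4 * Real.pi ^ 2 * Real.log ‖(q : ℂ)‖) := by
    intro s
    set p := tubePoint 1 (s 0) (s 1) (s 2) with hp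
    have hpX := hX (tubePoint_mem_tubeSet zero_le_one ⟨le_rfl, le_rfl⟩ (s 0) (s 1) (s 2))
    rw [← hp] at hpX
    obtain ⟨hpo, hpW⟩ := mem_cover_inf.1 hpX
    obtain ⟨h1, h0⟩ := mem_cover_inf.1 hpo
    have h0' := mem_cover_coordOpen.1 h0
    have h1' := mem_cover_coordOpen.1 h1
    have e : (localResidueForm (coordOpen q (0 : Fin 2)) ξ).1 p = (1 / 2 : ℂ) •
        (wedgeLin (toLin ((Form.del _ 0 (logQuot q)).1 p)) (ξ.1 p) -
          wedgeLin (toLin ((Form.delbar _ 0 (logQuot q)).1 p)) (ξ.1 p)) := by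
      rw [localResidueForm, residueForm, Form.del_res, Form.delbar_res, Form.del_res,
        Form.delbar_res, hξ, del_areaForm, delbar_areaForm, map_zero, Form.mul_zero, sub_zero,
        add_zero, Submodule.coe_smul, Submodule.coe_sub, Pi.smul_apply, Pi.sub_apply,
        Form.wedge_apply, Form.wedge_apply, Form.res_apply _ _ hpX, Form.res_apply _ _ hpX,
        Form.res_apply _ _ hpX]
    have ht : ∀ v, toLin ((Form.del _ 0 (logQuot q)).1 p) v =
        γ * ((p 0)⁻¹ * v 0 - (p 1)⁻¹ * v 1) := by
      intro v
      rw [Form.del_apply _ hpo, toLin_dop (Form.differentiableAt _ hpo), fderiv_logQuot hpo,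
        part_smul, part_sub, part_neg_one_dz_add, part_neg_one_dz_add]
      rfl
    have ht' : ∀ v, toLin ((Form.delbar _ 0 (logQuot q)).1 p) v =
        γ * ((starRingEnd ℂ (p 0))⁻¹ * starRingEnd ℂ (v 0) -
          (starRingEnd ℂ (p 1))⁻¹ * starRingEnd ℂ (v 1)) := by
      intro v
      rw [Form.delbar_apply _ hpo, toLin_dop (Form.differentiableAt _ hpo), fderiv_logQuot hpo,
        part_smul, part_sub, part_one_dz_add, part_one_dz_add]
      rfl
    have hc0 : starRingEnd ℂ (p 0) ≠ 0 := (map_ne_zero _).2 h0'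
    have hc1 : starRingEnd ℂ (p 1) ≠ 0 := (map_ne_zero _).2 h1'
    obtain ⟨d0, d1, d2⟩ := fderiv_tube_bdry 1 s
    rw [← hp] at d0 d1 d2
    have hpi : (Real.pi : ℂ) ≠ 0 := ofReal_ne_zero.2 Real.pi_ne_zero
    have hlog' : ((Real.log ‖(q : ℂ)‖ : ℝ) : ℂ) ≠ 0 := ofReal_ne_zero.2 hlog
    rw [e, ContinuousAlternatingMap.smul_apply, ContinuousAlternatingMap.sub_apply, wedgeLin_apply,
      wedgeLin_apply, Fin.sum_univ_three, Fin.sum_univ_three, d0, d1, d2, ht, ht, ht, ht', ht', ht',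
      areaForm_apply_apply h0, areaForm_apply_apply h0, areaForm_apply_apply h0]
    have r0 : ∀ v : Fin 3 → Vec 2, (0 : Fin 3).removeNth v = ![v 1, v 2] := fun v => by
      ext i
      fin_cases i <;> rfl
    have r1 : ∀ v : Fin 3 → Vec 2, (1 : Fin 3).removeNth v = ![v 0, v 2] := fun v => by
      ext i
      fin_cases i <;> rfl
    have r2 : ∀ v : Fin 3 → Vec 2, (2 : Fin 3).removeNth v = ![v 0, v 1] := fun v => by
      ext i
      fin_cases i <;> rfl
    simp only [r0, r1, r2, d0, d1, d2, Matrix.cons_val_zero, Matrix.cons_val_one, Pi.smul_apply,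
      smul_eq_mul, map_mul, map_zero, conj_I, γ]
    simp
    field_simp
    ring_nf
    simp
  have hab : (![0, Real.log ‖(q : ℂ)‖, 0] : Fin 3 → ℝ) ≤ ![2 * Real.pi, 0, 2 * Real.pi] := by
    intro i
    fin_cases i
    · exact Real.two_pi_pos.le
    · exact (log_norm_neg hq).le
    · exact Real.two_pi_pos.le
  have hlog' : ((Real.log ‖(q : ℂ)‖ : ℝ) : ℂ) ≠ 0 := ofReal_ne_zero.2 hlog
  have hpi : (Real.pi : ℂ) ≠ 0 := ofReal_ne_zero.2 Real.pi_ne_zero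
  rw [integralBdryR₁, cubeIntegral, setIntegral_congr_fun measurableSet_Icc (fun s _ => key s),
    setIntegral_const, measureReal_def, Real.volume_Icc_pi_toReal hab, Fin.prod_univ_three]
  simp
  field_simp
  norm_num

end

section

open MeasureTheory

/-! ### Smooth dependence of integrals on parameters -/

section
variable {E G : Type} [NormedAddCommGroup E] [NormedSpace ℝ E]
  [NormedAddCommGroup G] [NormedSpace ℝ G] {s : Set E} {F : E → ℝ → G}

theorem hasFDerivAt_of_uncurry (hs : IsOpen s)
    (hF : ContDiffOn ℝ (⊤ : ℕ∞) (Function.uncurry F) (s ×ˢ Set.univ)) {x : E} (hx : x ∈ s) (t : ℝ) :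
    HasFDerivAt (fun x => F x t)
      ((fderiv ℝ (Function.uncurry F) (x, t)).comp (ContinuousLinearMap.inl ℝ E ℝ)) x := by
  have h1 : HasFDerivAt (Function.uncurry F) (fderiv ℝ (Function.uncurry F) (x, t)) (x, t) :=
    ((hF.contDiffAt ((hs.prod isOpen_univ).mem_nhds ⟨hx, trivial⟩)).differentiableAt
      (by simp)).hasFDerivAt
  exact HasFDerivAt.comp (f := fun y => (y, t)) x h1 (hasFDerivAt_prodMk_left (𝕜 := ℝ) x t)

theorem contDiffOn_partial (hs : IsOpen s)
    (hF : ContDiffOn ℝ (⊤ : ℕ∞) (Function.uncurry F) (s ×ˢ Set.univ)) :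
    ContDiffOn ℝ (⊤ : ℕ∞) (Function.uncurry fun (x : E) (t : ℝ) =>
      (fderiv ℝ (Function.uncurry F) (x, t)).comp (ContinuousLinearMap.inl ℝ E ℝ))
      (s ×ˢ Set.univ) :=
  (hF.fderiv_of_isOpen (hs.prod isOpen_univ) (by simp)).clm_comp contDiffOn_const

theorem continuous_of_uncurry
    (hF : ContDiffOn ℝ (⊤ : ℕ∞) (Function.uncurry F) (s ×ˢ Set.univ)) {x : E} (hx : x ∈ s) :
    Continuous (F x) := by
  have h := hF.continuousOn.comp (f := fun t : ℝ => (x, t)) (s := Set.univ)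
    (Continuous.continuousOn (by fun_prop)) fun t _ => ⟨hx, trivial⟩
  exact continuousOn_univ.1 h

/-- Differentiation under the integral sign over a compact interval. -/
theorem hasFDerivAt_intervalIntegral [ProperSpace E] (hs : IsOpen s)
    (hF : ContDiffOn ℝ (⊤ : ℕ∞) (Function.uncurry F) (s ×ˢ Set.univ)) {x : E} (hx : x ∈ s)
    (a b : ℝ) :
    HasFDerivAt (fun x => ∫ t in a..b, F x t)
      (∫ t in a..b, (fderiv ℝ (Function.uncurry F) (x, t)).comp (ContinuousLinearMap.inl ℝ E ℝ))
      x := by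
  obtain ⟨r, hr, hball⟩ := Metric.nhds_basis_closedBall.mem_iff.1 (hs.mem_nhds hx)
  have hF' := contDiffOn_partial hs hF
  obtain ⟨C, hC⟩ := ((isCompact_closedBall x r).prod (isCompact_uIcc (a := a)
    (b := b))).exists_bound_of_continuousOn
      (hF'.continuousOn.mono (Set.prod_mono hball (Set.subset_univ _)))
  refine intervalIntegral.hasFDerivAt_integral_of_dominated_of_fderiv_le (bound := fun _ => C)
    (F' := fun x t => (fderiv ℝ (Function.uncurry F) (x, t)).comp (ContinuousLinearMap.inl ℝ E ℝ))
    (Metric.closedBall_mem_nhds x hr) ?_ ?_ ?_ ?_ ?_ ?_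
  · filter_upwards [hs.mem_nhds hx] with y hy
    exact (continuous_of_uncurry hF hy).aestronglyMeasurable
  · exact (continuous_of_uncurry hF hx).intervalIntegrable _ _
  · exact (continuous_of_uncurry hF' hx).aestronglyMeasurable
  · exact Filter.Eventually.of_forall fun t ht y hy => hC (y, t) ⟨hy, Set.uIoc_subset_uIcc ht⟩
  · exact intervalIntegrable_const
  · exact Filter.Eventually.of_forall fun t _ y hy => hasFDerivAt_of_uncurry hs hF (hball hy) t

end

/-- The integral over a compact interval of a smooth function is smooth in the parameters. -/
theorem contDiffOn_intervalIntegral {E : Type} [NormedAddCommGroup E] [NormedSpace ℝ E]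
    [ProperSpace E] {s : Set E} (hs : IsOpen s) (a b : ℝ) {G : Type} [NormedAddCommGroup G]
    [NormedSpace ℝ G] {F : E → ℝ → G}
    (hF : ContDiffOn ℝ (⊤ : ℕ∞) (Function.uncurry F) (s ×ˢ Set.univ)) :
    ContDiffOn ℝ (⊤ : ℕ∞) (fun x => ∫ t in a..b, F x t) s := by
  refine contDiffOn_infty.2 fun m => ?_
  induction m generalizing G with
  | zero =>
    exact contDiffOn_zero.2 fun x hx =>
      (hasFDerivAt_intervalIntegral hs hF hx a b).continuousAt.continuousWithinAt
  | succ m ih =>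
    refine (contDiffOn_succ_iff_fderiv_of_isOpen hs).2 ⟨fun x hx =>
      (hasFDerivAt_intervalIntegral hs hF hx a b).differentiableAt.differentiableWithinAt,
      fun h => absurd h (WithTop.natCast_ne_top m), ?_⟩
    exact (ih (contDiffOn_partial hs hF)).congr fun x hx =>
      (hasFDerivAt_intervalIntegral hs hF hx a b).fderiv

end

section

open MeasureTheory
variable {q : ℂˣ} {n k m : ℕ} {U : Opens (Hopf q n)}

/-! ### Averaging along the flows `p ↦ e^{tc} p` -/

theorem isOpen_ne_zero : IsOpen {p : Vec n | p ≠ 0} := isOpen_ne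

/-- The integral of `f`, with weight `w`, over the arc `t ↦ e^{tc} p`, `0 ≤ t ≤ 1`. -/
def flowIntegral (w : ℝ → ℝ) (c : ℂ) (f : Vec n → ℂ) (p : Vec n) : ℂ :=
  ∫ t in (0 : ℝ)..1, (w t : ℂ) * f (exp (t * c) • p)

section
variable {w : ℝ → ℝ} {c c' : ℂ} {f : Vec n → ℂ}

theorem exp_smul_ne_zero {p : Vec n} (hp : p ≠ 0) (z : ℂ) : exp z • p ≠ 0 :=
  smul_ne_zero (exp_ne_zero z) hp

theorem contDiff_ofReal_comp (hw : ContDiff ℝ (⊤ : ℕ∞) w) :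
    ContDiff ℝ (⊤ : ℕ∞) fun t => (w t : ℂ) :=
  ofRealCLM.contDiff.comp hw

theorem contDiff_one_weight : ContDiff ℝ (⊤ : ℕ∞) (1 : ℝ → ℝ) := contDiff_const

theorem contDiff_flow (c : ℂ) :
    ContDiff ℝ (⊤ : ℕ∞) fun x : Vec n × ℝ => exp (x.2 * c) • x.1 := by
  have h : ContDiff ℝ (⊤ : ℕ∞) fun x : Vec n × ℝ => ((x.2 : ℝ) : ℂ) :=
    ofRealCLM.contDiff.comp contDiff_snd
  exact (h.mul contDiff_const).cexp.smul contDiff_fst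

theorem contDiffOn_flow_integrand (hw : ContDiff ℝ (⊤ : ℕ∞) w)
    (hf : ContDiffOn ℝ (⊤ : ℕ∞) f {p | p ≠ 0}) :
    ContDiffOn ℝ (⊤ : ℕ∞)
      (Function.uncurry fun (p : Vec n) (t : ℝ) => (w t : ℂ) * f (exp (t * c) • p))
      ({p | p ≠ 0} ×ˢ Set.univ) := by
  have h1 : ContDiff ℝ (⊤ : ℕ∞) fun x : Vec n × ℝ => (w x.2 : ℂ) :=
    (contDiff_ofReal_comp hw).comp contDiff_snd
  exact h1.contDiffOn.mul (hf.comp (contDiff_flow c).contDiffOn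
    fun x hx => exp_smul_ne_zero hx.1 _)

theorem contDiffOn_flowIntegral (hw : ContDiff ℝ (⊤ : ℕ∞) w)
    (hf : ContDiffOn ℝ (⊤ : ℕ∞) f {p | p ≠ 0}) :
    ContDiffOn ℝ (⊤ : ℕ∞) (flowIntegral w c f) {p | p ≠ 0} :=
  contDiffOn_intervalIntegral isOpen_ne_zero 0 1 (contDiffOn_flow_integrand hw hf)

theorem differentiableAt_of_ne_zero (hf : ContDiffOn ℝ (⊤ : ℕ∞) f {p | p ≠ 0}) {p : Vec n}
    (hp : p ≠ 0) : DifferentiableAt ℝ f p :=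
  (hf.contDiffAt (isOpen_ne_zero.mem_nhds hp)).differentiableAt (by simp)

theorem fderiv_flowIntegral (hw : ContDiff ℝ (⊤ : ℕ∞) w)
    (hf : ContDiffOn ℝ (⊤ : ℕ∞) f {p | p ≠ 0}) {p : Vec n} (hp : p ≠ 0) (v : Vec n) :
    fderiv ℝ (flowIntegral w c f) p v =
      ∫ t in (0 : ℝ)..1, (w t : ℂ) * fderiv ℝ f (exp (t * c) • p) (exp (t * c) • v) := by
  have hF := contDiffOn_flow_integrand (c := c) hw hf
  have h := hasFDerivAt_intervalIntegral isOpen_ne_zero hF hp 0 1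
  have hc := continuous_of_uncurry (contDiffOn_partial isOpen_ne_zero hF) hp
  have e : fderiv ℝ (flowIntegral w c f) p = _ := h.fderiv
  rw [e, ContinuousLinearMap.intervalIntegral_apply (hc.intervalIntegrable _ _)]
  refine intervalIntegral.integral_congr fun t _ => ?_
  have h1 := hasFDerivAt_of_uncurry isOpen_ne_zero hF hp t
  have h2 : HasFDerivAt (fun x : Vec n => f (scal n (exp (t * c)) x))
      ((fderiv ℝ f (exp (t * c) • p)).comp (scal n (exp (t * c)))) p :=
    HasFDerivAt.comp p (differentiableAt_of_ne_zero hf (exp_smul_ne_zero hp _)).hasFDerivAt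
      (scal n (exp (t * c))).hasFDerivAt
  exact congrArg (fun D => D v) (h1.unique (h2.const_mul (w t : ℂ)))

theorem hasDerivAt_flow (hf : ContDiffOn ℝ (⊤ : ℕ∞) f {p | p ≠ 0}) {p : Vec n} (hp : p ≠ 0)
    (t : ℝ) : HasDerivAt (fun t : ℝ => f (exp (t * c) • p))
      (fderiv ℝ f (exp (t * c) • p) (exp (t * c) • c • p)) t := by
  have h0 : HasDerivAt (fun t : ℝ => exp (t * c)) (exp (t * c) * c) t := by
    have := ((hasDerivAt_id' t).ofReal_comp.mul_const c).cexp
    simpa using this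
  have h1 : HasDerivAt (fun t : ℝ => exp (t * c) • p) (exp (t * c) • c • p) t := by
    rw [smul_smul]
    exact h0.smul_const p
  exact HasFDerivAt.comp_hasDerivAt t
    (differentiableAt_of_ne_zero hf (exp_smul_ne_zero hp _)).hasFDerivAt h1

theorem continuous_fderiv_flow (hf : ContDiffOn ℝ (⊤ : ℕ∞) f {p | p ≠ 0}) {p : Vec n} (hp : p ≠ 0)
    (v : Vec n) : Continuous fun t : ℝ => fderiv ℝ f (exp (t * c) • p) (exp (t * c) • v) := by
  have h1 : ContinuousOn (fderiv ℝ f) {p | p ≠ 0} :=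
    (hf.fderiv_of_isOpen (m := (⊤ : ℕ∞)) isOpen_ne_zero (by simp)).continuousOn
  have h2 : Continuous fun t : ℝ => fderiv ℝ f (exp (t * c) • p) :=
    continuousOn_univ.1 (h1.comp (f := fun t : ℝ => exp (t * c) • p) (s := Set.univ)
      (Continuous.continuousOn (by fun_prop)) fun t _ => exp_smul_ne_zero hp _)
  exact h2.clm_apply (by fun_prop)

/-- Integration by parts along the flow. -/
theorem fderiv_flowIntegral_id (hf : ContDiffOn ℝ (⊤ : ℕ∞) f {p | p ≠ 0}) {p : Vec n}
    (hp : p ≠ 0) : fderiv ℝ (flowIntegral id c f) p (c • p) =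
      f (exp c • p) - flowIntegral 1 c f p := by
  rw [fderiv_flowIntegral contDiff_id hf hp]
  have h := intervalIntegral.integral_mul_deriv_eq_deriv_mul (a := 0) (b := 1)
    (u := fun t : ℝ => (t : ℂ)) (u' := fun _ => 1)
    (fun t _ => (hasDerivAt_id' t).ofReal_comp) (fun t _ => hasDerivAt_flow (c := c) hf hp t)
    intervalIntegrable_const ((continuous_fderiv_flow hf hp _).intervalIntegrable _ _)
  simpa [flowIntegral] using h

/-- The derivative of an integral along the flow, in the direction of the flow, is the difference of
the values at the two ends. -/
theorem fderiv_flowIntegral_one (hf : ContDiffOn ℝ (⊤ : ℕ∞) f {p | p ≠ 0}) {p : Vec n}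
    (hp : p ≠ 0) : fderiv ℝ (flowIntegral 1 c f) p (c • p) = f (exp c • p) - f p := by
  rw [fderiv_flowIntegral contDiff_one_weight hf hp]
  have h := intervalIntegral.integral_eq_sub_of_hasDerivAt (a := 0) (b := 1)
    (fun t _ => hasDerivAt_flow (c := c) hf hp t)
    ((continuous_fderiv_flow hf hp _).intervalIntegrable _ _)
  simpa using h

theorem fderiv_flowIntegral_of_invariant (hw : ContDiff ℝ (⊤ : ℕ∞) w)
    (hf : ContDiffOn ℝ (⊤ : ℕ∞) f {p | p ≠ 0}) (h : ∀ p ≠ 0, fderiv ℝ f p (c' • p) = 0) {p : Vec n}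
    (hp : p ≠ 0) : fderiv ℝ (flowIntegral w c f) p (c' • p) = 0 := by
  rw [fderiv_flowIntegral hw hf hp]
  simp only [smul_comm (exp _) c', h _ (exp_smul_ne_zero hp _), mul_zero,
    intervalIntegral.integral_zero]

theorem flowIntegral_smul {r : ℂ} (h : ∀ p ≠ 0, f (r • p) = f p) {p : Vec n} (hp : p ≠ 0) :
    flowIntegral w c f (r • p) = flowIntegral w c f p := by
  simp only [flowIntegral, smul_comm _ r, h _ (exp_smul_ne_zero hp _)]

end

theorem isPreconnected_ne_zero : IsPreconnected {p : Vec 1 | p ≠ 0} := by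
  have h : 1 < Module.rank ℝ (Vec 1) := by
    rw [← Module.finrank_eq_rank, Module.finrank_pi_fintype]
    simp
  exact (isConnected_compl_singleton_of_one_lt_rank h 0).isPreconnected

/-- Averaging over the torus generated by two flows: an invariant function is a sum of derivatives
along the flows and a constant. -/
theorem exists_eq_fderiv_add_const {c₁ c₂ : ℂ}
    (hspan : ∀ z : ℂ, ∃ a b : ℝ, z = a * c₁ + b * c₂) {f : Vec 1 → ℂ}
    (hf : ContDiffOn ℝ (⊤ : ℕ∞) f {p | p ≠ 0}) (h₁ : ∀ p ≠ 0, f (exp c₁ • p) = f p)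
    (h₂ : ∀ p ≠ 0, f (exp c₂ • p) = f p) :
    ∃ z : ℂ, ∀ p ≠ 0, f p = fderiv ℝ (flowIntegral id c₂ f) p (c₂ • p) +
      fderiv ℝ (flowIntegral id c₁ (flowIntegral 1 c₂ f)) p (c₁ • p) + z := by
  have hg := contDiffOn_flowIntegral (c := c₂) contDiff_one_weight hf
  have hM := contDiffOn_flowIntegral (c := c₁) contDiff_one_weight hg
  -- the average over both flows is invariant under both, hence constant as `c₁`, `c₂` span `ℂ`
  obtain ⟨z, hz⟩ := isOpen_ne_zero.exists_is_const_of_fderiv_eq_zero (𝕜 := ℝ) isPreconnected_ne_zero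
    (hM.differentiableOn (by simp)) (fun p hp => by
      have d₁ := fderiv_flowIntegral_one (c := c₁) hg hp
      rw [flowIntegral_smul h₁ hp, sub_self] at d₁
      have d₂ := fderiv_flowIntegral_of_invariant (c := c₁) contDiff_one_weight hg
        (c' := c₂) (fun p hp => by
          have := fderiv_flowIntegral_one (c := c₂) hf hp
          rwa [h₂ p hp, sub_self] at this) hp
      ext v
      obtain ⟨a, b, hab⟩ := hspan (v 0 / p 0)
      have hp0 : p 0 ≠ 0 := fun h => hp (by ext i; rwa [Subsingleton.elim i 0])
      have hv : v = a • c₁ • p + b • c₂ • p := by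
        ext i
        rw [Subsingleton.elim i 0]
        have := (div_eq_iff hp0).1 hab
        simp only [Pi.add_apply, Pi.smul_apply, real_smul, smul_eq_mul]
        linear_combination this
      rw [hv, map_add, map_smul _ a, map_smul _ b, d₁, d₂]
      simp)
  refine ⟨z, fun p hp => ?_⟩
  rw [fderiv_flowIntegral_id hf hp, fderiv_flowIntegral_id hg hp, flowIntegral_smul h₁ hp, h₂ p hp]
  rw [hz p hp]
  ring

end

section

open MeasureTheory
variable {q : ℂˣ} {n k m : ℕ} {U : Opens (Hopf q n)}

/-! ### The Aeppli cohomology of the elliptic curve -/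

theorem wedgeLin_one_apply (D : Vec n →L[ℝ] ℂ) (β : Alt n 1) (v : Fin 2 → Vec n) :
    wedgeLin D β v = D (v 0) * toLin β (v 1) - D (v 1) * toLin β (v 0) := by
  have h := wedge_one_one (ofLin D) β
  rw [toLin_ofLin] at h
  rw [← h, wedge_one_one_apply, ← toLin_apply, ← toLin_apply, ← toLin_apply, ← toLin_apply,
    toLin_ofLin]

/-- The `2`-forms on `ℂ` are spanned by `dz ∧ dz̄`. -/
theorem alt_one_two_apply (α : Alt 1 2) (v : Fin 2 → Vec 1) :
    α v = α ![![1], ![I]] / (-2 * I) *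
      (v 0 0 * starRingEnd ℂ (v 1 0) - v 1 0 * starRingEnd ℂ (v 0 0)) := by
  let e : Module.Basis (Fin 2) ℝ (Vec 1) :=
    Complex.basisOneI.map (LinearEquiv.funUnique (Fin 1) ℝ ℂ).symm
  have e0 : e 0 = ![1] := by
    ext i
    fin_cases i
    simp [e]
  have e1 : e 1 = ![I] := by
    ext i
    fin_cases i
    simp [e]
  set r := α ![![1], ![I]] / (-2 * I)
  set β : Alt 1 2 := r • wedgeLin (dz 0) (ofLin (dzBar 0)) with hβ
  have hβv : ∀ v : Fin 2 → Vec 1,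
      β v = r * (v 0 0 * starRingEnd ℂ (v 1 0) - v 1 0 * starRingEnd ℂ (v 0 0)) := by
    intro v
    rw [hβ, ContinuousAlternatingMap.smul_apply, wedgeLin_one_apply, toLin_ofLin]
    rfl
  have h01 : α ![e 0, e 1] = β ![e 0, e 1] := by
    have hI : (I : ℂ) ≠ 0 := I_ne_zero
    rw [hβv, e0, e1]
    simp only [r, Matrix.cons_val_zero, Matrix.cons_val_one, map_one, conj_I]
    field_simp
    ring
  have h : α.toAlternatingMap = β.toAlternatingMap := by
    refine e.ext_alternating fun w hw => ?_
    have hv : (fun i => e (w i)) = ![e (w 0), e (w 1)] := by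
      ext i
      fin_cases i <;> rfl
    have hne : w 0 ≠ w 1 := fun h => absurd (hw h) (by decide)
    change α _ = β _
    rw [hv]
    obtain ⟨h0, h1⟩ | ⟨h0, h1⟩ : (w 0 = 0 ∧ w 1 = 1) ∨ (w 0 = 1 ∧ w 1 = 0) := by omega
    · rw [h0, h1, h01]
    · rw [h0, h1, map_swap_two, map_swap_two β, h01]
  rw [← hβv]
  exact congrArg (fun β => β v) h

theorem coord_ne_zero {p : Vec 1} (hp : p ≠ 0) : p 0 ≠ 0 :=
  fun h => hp (by ext i; rwa [Subsingleton.elim i 0])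

theorem coord_ne_zero_of_mem_cover {U : Opens (Hopf q 1)} : ∀ p ∈ cover U, p (0 : Fin 1) ≠ 0 :=
  fun _ hp => coord_ne_zero hp.1

/-- The form `d log x ∧ d log x̄` on the elliptic curve. -/
def logArea (q : ℂˣ) : Form (⊤ : Opens (Hopf q 1)) 2 :=
  Form.wedge (Form.dlog ⊤ 0 coord_ne_zero_of_mem_cover)
    (Form.dlogBar ⊤ 0 coord_ne_zero_of_mem_cover)

theorem logArea_apply {p : Vec 1} (hp : p ≠ 0) (v : Fin 2 → Vec 1) :
    (logArea q).1 p v = v 0 0 / p 0 * starRingEnd ℂ (v 1 0 / p 0) -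
      v 1 0 / p 0 * starRingEnd ℂ (v 0 0 / p 0) := by
  have hp' : p ∈ cover (⊤ : Opens (Hopf q 1)) := mem_cover_top.2 hp
  rw [logArea, Form.wedge_apply, wedgeLin_one_apply, Form.dlog_apply hp', Form.dlogBar_apply hp',
    toLin_dlog, toLin_dlog, toLin_dlogBar, toLin_dlogBar]
  simp only [map_div₀]
  ring

theorem areaForm_eq_smul_logArea :
    areaForm (⊤ : Opens (Hopf q 1)) 0 coord_ne_zero_of_mem_cover =
      (γ / (2 * Real.log ‖(q : ℂ)‖) : ℂ) • logArea q := rfl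

/-- Every `2`-form on the elliptic curve is a multiple of `d log x ∧ d log x̄`. -/
theorem exists_eq_mul_logArea (ω : Form (⊤ : Opens (Hopf q 1)) 2) :
    ∃ s : Form (⊤ : Opens (Hopf q 1)) 0, ω = Form.mul s (logArea q) := by
  let g : Vec 1 → ℂ := fun p => ω.1 p ![![1], ![I]] / (-2 * I) * (p 0 * starRingEnd ℂ (p 0))
  have hg : ContDiffOn ℝ (⊤ : ℕ∞) g (cover (⊤ : Opens (Hopf q 1))) := by
    have h1 : ContDiffOn ℝ (⊤ : ℕ∞) (fun p => ω.1 p ![![1], ![I]])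
        (cover (⊤ : Opens (Hopf q 1))) :=
      (ContinuousAlternatingMap.apply ℝ (Vec 1) ℂ ![![1], ![I]]).contDiff.comp_contDiffOn ω.2.1
    have h2 : ContDiff ℝ (⊤ : ℕ∞) fun p : Vec 1 => p 0 := contDiff_apply ℝ ℂ 0
    have h3 : ContDiff ℝ (⊤ : ℕ∞) fun p : Vec 1 => starRingEnd ℂ (p 0) :=
      (conjCLE : ℂ →L[ℝ] ℂ).contDiff.comp h2
    exact (h1.div_const _).mul (h2.mul h3).contDiffOn
  have hinv : ∀ p ∈ cover (⊤ : Opens (Hopf q 1)), g ((q : ℂ) • p) = g p := by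
    intro p hp
    have h1 := ω.2.2.1 p hp ![![1], ![I]]
    rw [alt_one_two_apply] at h1
    have hI : (I : ℂ) ≠ 0 := I_ne_zero
    simp only [g, ← h1, Pi.smul_apply, Matrix.cons_val_zero, Matrix.cons_val_one, smul_eq_mul,
      map_mul, conj_I, map_one]
    field_simp
    ring
  refine ⟨Form.ofFun ⊤ g hg hinv, Form.ext_on fun p hp => ?_⟩
  ext v
  have hp0 := coord_ne_zero hp.1
  have hc : starRingEnd ℂ (p 0) ≠ 0 := (map_ne_zero _).2 hp0
  rw [Form.mul_apply, Form.val_ofFun hp, ContinuousAlternatingMap.smul_apply, logArea_apply hp.1,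
    alt_one_two_apply, smul_eq_mul]
  simp only [g, map_div₀]
  field_simp

theorem cover_top_eq : cover (⊤ : Opens (Hopf q n)) = {p | p ≠ 0} := Set.ext fun _ => mem_cover_top

/-- A derivative along a flow times `d log x ∧ d log x̄` is
`c ∂(B d log x̄) - c̄ ∂̄(B d log x)`, a coboundary of Aeppli cohomology. -/
theorem exists_mem_BA_eq_fderiv (B : Form (⊤ : Opens (Hopf q 1)) 0) (c : ℂ) :
    ∃ ω ∈ BA (⊤ : Opens (Hopf q 1)),
      ∀ p ≠ 0, ω.1 p = fderiv ℝ (val B.1) p (c • p) • (logArea q).1 p := by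
  set x := Form.dlog (⊤ : Opens (Hopf q 1)) 0 coord_ne_zero_of_mem_cover with hx
  set y := Form.dlogBar (⊤ : Opens (Hopf q 1)) 0 coord_ne_zero_of_mem_cover with hy
  refine ⟨Form.delbar ⊤ 1 (-starRingEnd ℂ c • Form.mul B x) + Form.del ⊤ 1 (c • Form.mul B y),
    Submodule.add_mem_sup
      (Submodule.mem_map_of_mem (Submodule.smul_mem _ _ (Form.mul_mem_type Form.dlog_mem_type)))
      (Submodule.mem_map_of_mem (Submodule.smul_mem _ _
        (Form.mul_mem_type Form.dlogBar_mem_type))), fun p hp0' => ?_⟩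
  have hp : p ∈ cover (⊤ : Opens (Hopf q 1)) := mem_cover_top.2 hp0'
  have hp0 := coord_ne_zero hp0'
  ext v
  have hv : ∀ i, v i = (v i 0 / p 0) • p := by
    intro i
    ext j
    rw [Subsingleton.elim j 0, Pi.smul_apply, smul_eq_mul, div_mul_cancel₀ _ hp0]
  set D := fderiv ℝ (val B.1) p
  have hD : D (c • p) = c • part (-1) D p + starRingEnd ℂ c • part 1 D p := by
    rw [← part_neg_one_smul, ← part_one_smul, ← add_apply, part_neg_one_add_part_one]
  rw [map_smul, map_smul, Form.del_mul, Form.delbar_mul, hx, hy, Form.del_dlogBar,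
    Form.delbar_dlog, Form.mul_zero, add_zero, add_zero, hD,
    ContinuousAlternatingMap.smul_apply, logArea_apply hp.1, Submodule.coe_add,
    Submodule.coe_smul, Submodule.coe_smul, Pi.add_apply, Pi.smul_apply, Pi.smul_apply,
    ContinuousAlternatingMap.add_apply, ContinuousAlternatingMap.smul_apply,
    ContinuousAlternatingMap.smul_apply, Form.wedge_apply, Form.wedge_apply, wedgeLin_one_apply,
    wedgeLin_one_apply, Form.dlog_apply hp, Form.dlogBar_apply hp, Form.del_apply _ hp,
    Form.delbar_apply _ hp, toLin_dop (Form.differentiableAt _ hp),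
    toLin_dop (Form.differentiableAt _ hp), toLin_dlog, toLin_dlog, toLin_dlogBar, toLin_dlogBar]
  change -starRingEnd ℂ c • (part 1 D (v 0) * _ - part 1 D (v 1) * _) +
    c • (part (-1) D (v 0) * _ - part (-1) D (v 1) * _) = _
  have a0 : ∀ i, part (-1) D (v i) = v i 0 / p 0 * part (-1) D p := fun i => by
    conv_lhs => rw [hv i]
    exact part_neg_one_smul _ _ _
  have a1 : ∀ i, part 1 D (v i) = starRingEnd ℂ (v i 0 / p 0) * part 1 D p := fun i => by
    conv_lhs => rw [hv i]
    exact part_one_smul _ _ _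
  rw [a0, a0, a1, a1]
  simp only [smul_eq_mul, map_div₀]
  ring

/-- The integral of an invariant function along a flow, which is again invariant, as a `0`-form. -/
def Form.flowIntegral {w : ℝ → ℝ} (hw : ContDiff ℝ (⊤ : ℕ∞) w) (c : ℂ)
    (s : Form (⊤ : Opens (Hopf q n)) 0) : Form (⊤ : Opens (Hopf q n)) 0 :=
  Form.ofFun ⊤ (HopfBC.flowIntegral w c (val s.1))
    (by
      have h := Form.contDiffOn_val s
      rw [cover_top_eq] at h ⊢
      exact contDiffOn_flowIntegral hw h)
    fun _ hp => flowIntegral_smul (fun _ hp => Form.val_smul s (mem_cover_top.2 hp)) hp.1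

theorem Form.fderiv_val_flowIntegral {w : ℝ → ℝ} (hw : ContDiff ℝ (⊤ : ℕ∞) w) (c : ℂ)
    (s : Form (⊤ : Opens (Hopf q n)) 0) {p : Vec n} (hp : p ≠ 0) :
    fderiv ℝ (val (Form.flowIntegral hw c s).1) p =
      fderiv ℝ (HopfBC.flowIntegral w c (val s.1)) p := by
  refine Filter.EventuallyEq.fderiv_eq ?_
  filter_upwards [(isOpen_cover _).mem_nhds (mem_cover_top.2 hp)] with x hx
  exact Form.val_ofFun hx

end

section

open MeasureTheory
variable {q : ℂˣ} {n k m : ℕ} {U : Opens (Hopf q n)}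

theorem fderiv_flowIntegral_congr {w : ℝ → ℝ} {c : ℂ} {f g : Vec n → ℂ} (h : ∀ p ≠ 0, f p = g p)
    {p : Vec n} (hp : p ≠ 0) :
    fderiv ℝ (flowIntegral w c f) p = fderiv ℝ (flowIntegral w c g) p := by
  refine Filter.EventuallyEq.fderiv_eq ?_
  filter_upwards [isOpen_ne_zero.mem_nhds hp] with x hx
  simp only [flowIntegral, h _ (exp_smul_ne_zero hx _)]

/-- The periods `2πi` and `log q` of the elliptic curve span `ℂ` over `ℝ`. -/
theorem exists_eq_mul_add_mul (hq : ‖(q : ℂ)‖ < 1) (z : ℂ) :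
    ∃ a b : ℝ, z = a * (2 * Real.pi * I) + b * log q := by
  have hb : z.re / Real.log ‖(q : ℂ)‖ * Real.log ‖(q : ℂ)‖ = z.re :=
    div_mul_cancel₀ _ (log_norm_neg hq).ne
  set b := z.re / Real.log ‖(q : ℂ)‖
  have ha : (z.im - b * arg q) / (2 * Real.pi) * (2 * Real.pi) = z.im - b * arg q :=
    div_mul_cancel₀ _ Real.two_pi_pos.ne'
  set a := (z.im - b * arg q) / (2 * Real.pi)
  refine ⟨a, b, Complex.ext ?_ ?_⟩
  · simp [log_re, hb]
  · simp [log_im, ha]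

/-- Up to the coboundaries of Aeppli cohomology, every `2`-form on the elliptic curve is a constant
multiple of `d log x ∧ d log x̄`. -/
theorem exists_sub_smul_logArea_mem_BA (hq : ‖(q : ℂ)‖ < 1)
    (ω : Form (⊤ : Opens (Hopf q 1)) 2) : ∃ z : ℂ, ω - z • logArea q ∈ BA ⊤ := by
  obtain ⟨s, rfl⟩ := exists_eq_mul_logArea ω
  have hs : ContDiffOn ℝ (⊤ : ℕ∞) (val s.1) {p | p ≠ 0} := by
    have h := Form.contDiffOn_val s
    rwa [cover_top_eq] at h
  obtain ⟨z, hz⟩ := exists_eq_fderiv_add_const (exists_eq_mul_add_mul hq) hs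
    (fun p hp => by rw [exp_two_pi_mul_I, one_smul])
    (fun p hp => by
      rw [exp_log q.ne_zero]
      exact Form.val_smul s (mem_cover_top.2 hp))
  obtain ⟨ω₂, h₂, e₂⟩ :=
    exists_mem_BA_eq_fderiv (Form.flowIntegral contDiff_id (log q) s) (log q)
  obtain ⟨ω₁, h₁, e₁⟩ := exists_mem_BA_eq_fderiv (Form.flowIntegral contDiff_id (2 * Real.pi * I)
    (Form.flowIntegral contDiff_one_weight (log q) s)) (2 * Real.pi * I)
  refine ⟨z, ?_⟩
  have e : Form.mul s (logArea q) - z • logArea q = ω₂ + ω₁ := by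
    refine Form.ext_on fun p hp => ?_
    have hv : ∀ x ≠ 0, val (Form.flowIntegral contDiff_one_weight (log q) s).1 x =
        HopfBC.flowIntegral 1 (log q) (val s.1) x := fun x hx =>
      Form.val_ofFun (mem_cover_top.2 hx)
    rw [Submodule.coe_sub, Submodule.coe_smul, Submodule.coe_add, Pi.sub_apply, Pi.smul_apply,
      Pi.add_apply, Form.mul_apply, e₂ p hp.1, e₁ p hp.1, hz p hp.1,
      Form.fderiv_val_flowIntegral _ _ _ hp.1, Form.fderiv_val_flowIntegral _ _ _ hp.1,
      fderiv_flowIntegral_congr hv hp.1]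
    module
  rw [e]
  exact Submodule.add_mem _ h₂ h₁

theorem curve_param_mem (s : Fin 2 → ℝ) :
    (![exp (s 0 + s 1 * I)] : Vec 1) ∈ cover (⊤ : Opens (Hopf q 1)) :=
  mem_cover_top.2 fun h => exp_ne_zero _ (congrFun h 0)

theorem fderiv_curve_param (s : Fin 2 → ℝ) :
    fderiv ℝ (fun s : Fin 2 → ℝ => (![exp (s 0 + s 1 * I)] : Vec 1)) s (Pi.single 0 1) 0 =
        exp (s 0 + s 1 * I) ∧
      fderiv ℝ (fun s : Fin 2 → ℝ => (![exp (s 0 + s 1 * I)] : Vec 1)) s (Pi.single 1 1) 0 =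
        I * exp (s 0 + s 1 * I) := by
  have hp : ∀ i : Fin 2, HasFDerivAt (fun s : Fin 2 → ℝ => ((s i : ℝ) : ℂ))
      (ofRealCLM.comp (ContinuousLinearMap.proj i)) s := fun i =>
    (ofRealCLM.comp (ContinuousLinearMap.proj i : (Fin 2 → ℝ) →L[ℝ] ℝ)).hasFDerivAt
  have h := ((hp 0).fun_add ((hp 1).mul_const I)).cexp
  have h' : HasFDerivAt (fun s : Fin 2 → ℝ => (![exp (s 0 + s 1 * I)] : Vec 1))
      (ContinuousLinearMap.pi fun _ : Fin 1 => exp (s 0 + s 1 * I) •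
        (ofRealCLM.comp (ContinuousLinearMap.proj 0 : (Fin 2 → ℝ) →L[ℝ] ℝ) +
          I • ofRealCLM.comp (ContinuousLinearMap.proj 1))) s := by
    rw [hasFDerivAt_pi]
    intro i
    fin_cases i
    exact h
  rw [h'.fderiv]
  simp [mul_comm]

/-- The normalized area form has integral `1` over the elliptic curve. -/
theorem integralC_areaForm (hq : ‖(q : ℂ)‖ < 1) :
    integralC q (areaForm (⊤ : Opens (Hopf q 1)) 0 coord_ne_zero_of_mem_cover).1 = 1 := by
  have key : ∀ s : Fin 2 → ℝ, (areaForm (⊤ : Opens (Hopf q 1)) 0 coord_ne_zero_of_mem_cover).1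
      (![exp (s 0 + s 1 * I)] : Vec 1) (fun i => fderiv ℝ
        (fun s : Fin 2 → ℝ => (![exp (s 0 + s 1 * I)] : Vec 1)) s (Pi.single i 1)) =
      -(1 / (2 * Real.pi * Real.log ‖(q : ℂ)‖)) := by
    intro s
    obtain ⟨d0, d1⟩ := fderiv_curve_param s
    rw [areaForm_apply_apply (curve_param_mem s), d0, d1]
    have hx := exp_ne_zero (s 0 + s 1 * I)
    generalize exp (s 0 + s 1 * I) = x at hx
    have hc : starRingEnd ℂ x ≠ 0 := (map_ne_zero _).2 hx
    have hpi : (Real.pi : ℂ) ≠ 0 := ofReal_ne_zero.2 Real.pi_ne_zero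
    have hlog : ((Real.log ‖(q : ℂ)‖ : ℝ) : ℂ) ≠ 0 := ofReal_ne_zero.2 (log_norm_neg hq).ne
    have hI : (I : ℂ) ≠ 0 := I_ne_zero
    simp only [Matrix.cons_val_zero, map_mul, conj_I, γ]
    field_simp
    ring
  have hab : (![Real.log ‖(q : ℂ)‖, 0] : Fin 2 → ℝ) ≤ ![0, 2 * Real.pi] := by
    intro i
    fin_cases i
    · exact (log_norm_neg hq).le
    · exact Real.two_pi_pos.le
  have hlog : ((Real.log ‖(q : ℂ)‖ : ℝ) : ℂ) ≠ 0 := ofReal_ne_zero.2 (log_norm_neg hq).ne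
  have hpi : (Real.pi : ℂ) ≠ 0 := ofReal_ne_zero.2 Real.pi_ne_zero
  rw [integralC, cubeIntegral, setIntegral_congr_fun measurableSet_Icc (fun s _ => key s),
    setIntegral_const, measureReal_def, Real.volume_Icc_pi_toReal hab, Fin.prod_univ_two]
  simp
  field_simp

/-- There are no nonzero forms of type `(2, 0)` or `(0, 2)` in dimension one: multiplication by `i`
preserves every `2`-form, but acts on these types by `-1`. -/
theorem eq_zero_of_type_two {a b : ℕ} {ω : Form (⊤ : Opens (Hopf q 1)) 2}
    (hab : a = 2 ∧ b = 0 ∨ a = 0 ∧ b = 2) (h : ω ∈ Form.type ⊤ 2 a b) : ω = 0 := by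
  refine Form.ext_on fun p _ => ?_
  ext v
  have h1 : ω.1 p (fun i => I • v i) = ω.1 p v := by
    rw [alt_one_two_apply, alt_one_two_apply (ω.1 p) v]
    simp only [Pi.smul_apply, smul_eq_mul, map_mul, conj_I]
    linear_combination (-(ω.1 p ![![1], ![I]] / (-2 * I)) *
      (v 0 0 * starRingEnd ℂ (v 1 0) - v 1 0 * starRingEnd ℂ (v 0 0))) * I_sq
  have h2 : ω.1 p (fun i => I • v i) = -ω.1 p v := by
    rw [h p v I]
    rcases hab with ⟨rfl, rfl⟩ | ⟨rfl, rfl⟩ <;> simp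
  exact self_eq_neg.1 (h1.symm.trans h2)

/-- Coboundaries of Aeppli cohomology on the elliptic curve are exact. -/
theorem integralC_of_mem_BA (hq : ‖(q : ℂ)‖ < 1) {ω : Form (⊤ : Opens (Hopf q 1)) 2}
    (h : ω ∈ BA ⊤) : integralC q ω.1 = 0 := by
  obtain ⟨_, ⟨α, hα, rfl⟩, _, ⟨β, hβ, rfl⟩, rfl⟩ := Submodule.mem_sup.1 h
  have h1 : Form.del ⊤ 1 α = 0 := eq_zero_of_type_two (Or.inl ⟨rfl, rfl⟩) (Form.del_mem_type hα)
  have h2 : Form.delbar ⊤ 1 β = 0 :=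
    eq_zero_of_type_two (Or.inr ⟨rfl, rfl⟩) (Form.delbar_mem_type hβ)
  have e : Form.delbar ⊤ 1 α + Form.del ⊤ 1 β = Form.d ⊤ 1 (α + β) := by
    rw [Form.d_eq, map_add, map_add, h1, h2]
    abel
  rw [e, ← integralC_extDeriv hq (α + β)]
  exact cubeIntegral_congr fun s _ => Form.d_apply _ (curve_param_mem s)

theorem coh_mk_eq_smul {A : Type*} [AddCommGroup A] [Module ℂ A] {Z B : Submodule ℂ A} {z z' : Z}
    {r : ℂ} : Coh.mk B z = r • Coh.mk B z' ↔ z.1 - r • z'.1 ∈ B :=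
  coh_mk_eq (z' := r • z')

/-- The Aeppli cohomology `H^{1,1}_A(C)` is one-dimensional. -/
theorem existsUnique_eq_smul_areaForm (hq : ‖(q : ℂ)‖ < 1) (a : HA (⊤ : Opens (Hopf q 1))) :
    ∃! z : ℂ, a = z • Coh.mk (BA ⊤)
      ⟨areaForm (⊤ : Opens (Hopf q 1)) 0 coord_ne_zero_of_mem_cover, areaForm_mem_ZA⟩ := by
  obtain ⟨ω, rfl⟩ := coh_mk_surjective _ a
  obtain ⟨ξ, hξ⟩ : ∃ ξ : ZA (⊤ : Opens (Hopf q 1)), ξ =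
      ⟨areaForm (⊤ : Opens (Hopf q 1)) 0 coord_ne_zero_of_mem_cover, areaForm_mem_ZA⟩ := ⟨_, rfl⟩
  have hξ' : ξ.1 = areaForm (⊤ : Opens (Hopf q 1)) 0 coord_ne_zero_of_mem_cover :=
    congrArg Subtype.val hξ
  rw [← hξ]
  have hκ : (γ / (2 * Real.log ‖(q : ℂ)‖) : ℂ) ≠ 0 := by
    have hpi : (Real.pi : ℂ) ≠ 0 := ofReal_ne_zero.2 Real.pi_ne_zero
    have hlog : ((Real.log ‖(q : ℂ)‖ : ℝ) : ℂ) ≠ 0 := ofReal_ne_zero.2 (log_norm_neg hq).ne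
    have hI : (I : ℂ) ≠ 0 := I_ne_zero
    rw [γ]
    exact div_ne_zero (one_div_ne_zero (mul_ne_zero (mul_ne_zero two_ne_zero hpi) hI))
      (mul_ne_zero two_ne_zero hlog)
  obtain ⟨z, hz⟩ := exists_sub_smul_logArea_mem_BA hq ω.1
  refine ⟨z / (γ / (2 * Real.log ‖(q : ℂ)‖)), ?_, fun w hw => ?_⟩
  · refine coh_mk_eq_smul.2 ?_
    rw [hξ', areaForm_eq_smul_logArea, smul_smul, div_mul_cancel₀ _ hκ]
    exact hz
  · have h1 := coh_mk_eq_smul.1 hw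
    rw [hξ', areaForm_eq_smul_logArea, smul_smul] at h1
    have h2 := integralC_of_mem_BA hq (Submodule.sub_mem _ hz h1)
    have e : ω.1 - z • logArea q - (ω.1 - (w * (γ / (2 * Real.log ‖(q : ℂ)‖))) • logArea q) =
        (w - z / (γ / (2 * Real.log ‖(q : ℂ)‖))) •
          areaForm (⊤ : Opens (Hopf q 1)) 0 coord_ne_zero_of_mem_cover := by
      rw [areaForm_eq_smul_logArea, smul_smul, sub_mul, div_mul_cancel₀ _ hκ]
      module
    rw [e, integralC, cubeIntegral_smul, ← integralC, integralC_areaForm hq, mul_one] at h2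
    exact sub_eq_zero.1 h2

end

section

variable {q : ℂˣ}

/-! ### The explicit representatives -/

theorem val_logQuot_eq_log_div {p : Vec 2} (h0 : p 0 ≠ 0) (h1 : p 1 ≠ 0) :
    val (logQuot q).1 p = γ * (Real.log (‖p 0 / p 1‖ ^ 2) : ℂ) := by
  rw [val_logQuot (mem_cover_inf.2 ⟨mem_cover_coordOpen.2 h1, mem_cover_coordOpen.2 h0⟩), norm_div,
    div_pow, Real.log_div (pow_ne_zero 2 (norm_ne_zero_iff.2 h0))
      (pow_ne_zero 2 (norm_ne_zero_iff.2 h1)), ofReal_sub]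

/-- The area form on `{x ≠ 0}` restricts to the one on the elliptic curve. -/
theorem areaForm_apply_eq_inclVec {p : Vec 1} (hp : p ≠ 0) (v : Fin 2 → Vec 1) :
    (areaForm (⊤ : Opens (Hopf q 1)) 0 coord_ne_zero_of_mem_cover).1 p v =
      (areaForm (coordOpen q (0 : Fin 2)) 0 ne_zero_of_mem_coordOpen).1 (inclVec p)
        (fun i => inclVec (v i)) := by
  have hp' : inclVec p ∈ cover (coordOpen q (0 : Fin 2)) :=
    mem_cover_coordOpen.2 (coord_ne_zero hp)
  rw [areaForm_apply_apply (mem_cover_top.2 hp), areaForm_apply_apply hp']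
  rfl

end

end HopfBC

end

theorem mainTheorem12 (q : ℂˣ) (hq : ‖(q : ℂ)‖ < 1) :
    -- the foliation descends to the threefold, is involutive and leaves the surface invariant
    ((∀ p : HopfBC.Vec 3, HopfBC.fol ((q : ℂ) • p) = HopfBC.fol p) ∧
      (∀ p : HopfBC.Vec 3, HopfBC.bracket HopfBC.v₁ HopfBC.v₂ p ∈ HopfBC.fol p) ∧
      (∀ p : HopfBC.Vec 2, ∀ w ∈ HopfBC.fol (HopfBC.inclVec p), w 2 = 0) ∧
      HopfBC.singularSet q = HopfBC.Hopf.incl '' HopfBC.curve q ∧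
      HopfBC.curve q = {v | (HopfBC.hopfProj v).submodule = Submodule.span ℂ {![1, 0]}} ∧
      (HopfBC.coordOpen q (1 : Fin 2) : Set (HopfBC.Hopf q 2)) = (HopfBC.curve q)ᶜ) ∧
    -- the normal bundle of the surface is `L`
    (∀ (U : TopologicalSpace.Opens (HopfBC.Hopf q 2)) (f : HopfBC.Vec 2 → ℂ),
      HopfBC.IsSection U f ↔
        ∃ w : HopfBC.Vec 2 → HopfBC.Vec 3,
          HopfBC.IsVectorField U w ∧ ∀ p ∈ HopfBC.cover U, f p = w p 2) ∧
    -- the Chern class and the Atiyah class of `L` vanish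
    HopfBC.IsChernClass (0 : HopfBC.HdR (⊤ : TopologicalSpace.Opens (HopfBC.Hopf q 2))) ∧
    HopfBC.IsAtiyahClass (0 : HopfBC.HDol (⊤ : TopologicalSpace.Opens (HopfBC.Hopf q 2))) ∧
    -- the connection given by the foliation is unique, flat and Hermitian
    (∃! θ₀ : HopfBC.Connection (HopfBC.coordOpen q (1 : Fin 2)),
      HopfBC.IsCamachoSadConnection θ₀) ∧
    (∃ (θ₀ : HopfBC.Connection (HopfBC.coordOpen q (1 : Fin 2)))
        (h₀ : HopfBC.HermMetric (HopfBC.coordOpen q (1 : Fin 2))),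
      HopfBC.IsCamachoSadConnection θ₀ ∧
      (∀ p ∈ HopfBC.cover (HopfBC.coordOpen q (1 : Fin 2)),
        θ₀.1 p = -HopfBC.dlog 1 p ∧ h₀.N p = (‖p 1‖ ^ 2)⁻¹) ∧
      HopfBC.IsMetricConnection h₀ θ₀ ∧ HopfBC.chernForm θ₀ = 0) ∧
    -- the standard metric near the curve
    (∃ (θ₁ : HopfBC.Connection (HopfBC.coordOpen q (0 : Fin 2)))
        (h₁ : HopfBC.HermMetric (HopfBC.coordOpen q (0 : Fin 2))),
      (∀ p ∈ HopfBC.cover (HopfBC.coordOpen q (0 : Fin 2)),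
        θ₁.1 p = -HopfBC.dlog 0 p ∧ h₁.N p = (‖p 0‖ ^ 2)⁻¹) ∧
      HopfBC.IsMetricConnection h₁ θ₁) ∧
    -- the Bott-Chern class, its localization and the residue
    ∃ (c : HopfBC.HBC (⊤ : TopologicalSpace.Opens (HopfBC.Hopf q 2)))
      (cloc : HopfBC.HRel (HopfBC.coordOpen q (1 : Fin 2)) (HopfBC.coordOpen q (0 : Fin 2)))
      (R : Module.Dual ℂ (HopfBC.HAGerm q))
      (ξ₀ : HopfBC.ZA (HopfBC.coordOpen q (0 : Fin 2)))
      (ξC : HopfBC.ZA (⊤ : TopologicalSpace.Opens (HopfBC.Hopf q 1))),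
      (HopfBC.IsBottChernClass c ∧
        (∃ (h : HopfBC.HermMetric (⊤ : TopologicalSpace.Opens (HopfBC.Hopf q 2)))
            (θ : HopfBC.Connection (⊤ : TopologicalSpace.Opens (HopfBC.Hopf q 2))),
          HopfBC.IsMetricConnection h θ) ∧
        (∃ ω : HopfBC.ZBC (⊤ : TopologicalSpace.Opens (HopfBC.Hopf q 2)),
          (∀ p : HopfBC.Vec 2, p ≠ 0 → ω.1.1 p = HopfBC.γ • HopfBC.delbar (HopfBC.del
            (HopfBC.fn fun z => (Real.log (‖z 0‖ ^ 2 + ‖z 1‖ ^ 2) : ℂ))) p) ∧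
          HopfBC.Coh.mk _ ω = c) ∧
        c ≠ 0) ∧
      (HopfBC.IsLocalization cloc ∧
        (∃ σ : HopfBC.ZRel (HopfBC.coordOpen q (1 : Fin 2)) (HopfBC.coordOpen q (0 : Fin 2)),
          σ.1.1 = 0 ∧
          (∀ p : HopfBC.Vec 2, p 0 ≠ 0 → p 1 ≠ 0 →
            HopfBC.val σ.1.2.1 p = HopfBC.γ * (Real.log (‖p 0 / p 1‖ ^ 2) : ℂ)) ∧
          HopfBC.Coh.mk _ σ = cloc) ∧
        HopfBC.jStar _ _ cloc = HopfBC.toCech _ _ c) ∧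
      (HopfBC.IsPsi cloc R ∧ ∀ R' : Module.Dual ℂ (HopfBC.HAGerm q),
        HopfBC.IsPsi cloc R' → R' = R) ∧
      ((∀ p : HopfBC.Vec 2, p 0 ≠ 0 →
          ξ₀.1.1 p = (HopfBC.γ / (2 * Real.log ‖(q : ℂ)‖)) •
            HopfBC.wedge (HopfBC.dlog 0 p) (HopfBC.dlogBar 0 p)) ∧
        (∀ p : HopfBC.Vec 1, p ≠ 0 → ∀ v : Fin 2 → HopfBC.Vec 1,
          ξC.1.1 p v = ξ₀.1.1 (HopfBC.inclVec p) (fun i => HopfBC.inclVec (v i))) ∧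
        HopfBC.integralC q ξC.1.1 = 1 ∧
        (∀ a : HopfBC.HA (⊤ : TopologicalSpace.Opens (HopfBC.Hopf q 1)),
          ∃! z : ℂ, a = z • HopfBC.Coh.mk (HopfBC.BA ⊤) ξC)) ∧
      R (HopfBC.HAGerm.mk (HopfBC.curve_subset q) ξ₀) = 1 := by
  refine ⟨⟨HopfBC.fol_smul q, fun p => ?_, fun p w => HopfBC.eq_zero_of_mem_fol,
    HopfBC.singularSet_eq q, HopfBC.curve_eq_fiber q, HopfBC.coordOpen_one_eq q⟩,
    fun U f => HopfBC.isSection_iff_normal, HopfBC.isChernClass_zero, HopfBC.isAtiyahClass_zero,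
    ⟨_, HopfBC.isCamachoSadConnection_connection, fun θ h => h.eq⟩,
    ⟨_, HopfBC.coordMetric q 1, HopfBC.isCamachoSadConnection_connection,
      fun p hp => ⟨HopfBC.coordMetric_connection_apply hp, rfl⟩,
      HopfBC.HermMetric.isMetricConnection_connection _, HopfBC.chernForm_coordMetric 1⟩,
    ⟨_, HopfBC.coordMetric q 0, fun p hp => ⟨HopfBC.coordMetric_connection_apply hp, rfl⟩,
      HopfBC.HermMetric.isMetricConnection_connection _⟩,
    HopfBC.bottChern q, HopfBC.localClass q, HopfBC.residue hq,
    ⟨HopfBC.areaForm _ 0 HopfBC.ne_zero_of_mem_coordOpen, HopfBC.areaForm_mem_ZA⟩,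
    ⟨HopfBC.areaForm ⊤ 0 HopfBC.coord_ne_zero_of_mem_cover, HopfBC.areaForm_mem_ZA⟩,
    ⟨HopfBC.isBottChernClass_bottChern q,
      ⟨HopfBC.sumMetric q, _, HopfBC.HermMetric.isMetricConnection_connection _⟩,
      ⟨⟨HopfBC.chernForm (HopfBC.sumMetric q).connection, HopfBC.chernForm_mem_ZBC _⟩,
        fun p hp => HopfBC.chernForm_sumMetric_apply hp, rfl⟩, HopfBC.bottChern_ne_zero hq⟩,
    ⟨HopfBC.isLocalization_localClass q,
      ⟨⟨(0, HopfBC.logQuot q), HopfBC.logQuot_mem_ZRel q⟩, rfl,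
        fun p h0 h1 => HopfBC.val_logQuot_eq_log_div h0 h1, rfl⟩, HopfBC.jStar_localClass q⟩,
    ⟨HopfBC.isPsi_residue hq, fun R' h => HopfBC.IsPsi.eq hq (HopfBC.isPsi_residue hq) h⟩,
    ⟨fun p h0 => HopfBC.areaForm_apply (HopfBC.mem_cover_coordOpen.2 h0),
      fun p hp v => HopfBC.areaForm_apply_eq_inclVec hp v, HopfBC.integralC_areaForm hq,
      HopfBC.existsUnique_eq_smul_areaForm hq⟩,
    HopfBC.residue_areaForm hq⟩
  rw [HopfBC.bracket_v₁_v₂]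
  exact Submodule.zero_mem _
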